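/- Let $-\infty\le A<B\le\infty$, let $0<\alpha,\beta\le 1$ and $c$ be real constants, put $\xi(x)=(1+|x|)^{-1-\beta}$ and let $$\mathbb Z^2(A,B)=\{(n,j)\in\mathbb Z^2:\ 2^{-n}\le B-A,\ j2^{-n}\in(A,B]\}.$$ Let $\{\phi_{n,j}:(n,j)\in\mathbb Z^2(A,B)\}\subset L^2(\mathbb R)\cap L^\infty(\mathbb R)$ be an orthonormal system in $L^2(\mathbb R)$ of real functions such that for every $(n,j)\in\mathbb Z^2(A,B)$: $\operatorname{supp}\phi_{n,j}\subset[A,B]$; $\int_{\mathbb R}\phi_{n,j}(t)\,dt=0$; $|\phi_{n,j}(t)|\le c\,2^{n/2}\xi(2^nt-j)$ for $t\in[A,B]$; and $$|\phi_{n,j}(t)-\phi_{n,j}(t')|\le c\,2^{n/2}(2^n|t-t'|)^\alpha\,\xi(2^nt-j)\quad\text{for } t,t'\in[A,B],\ |t-t'|\le 2^{-n}.$$ (Here $[A,B]$ denotes the set of real $x$ with $A\le x\le B$.) Say that a sequence $w(1),w(2),\dots$ is an RC-multiplier for the system if for every sequence $(n_k,j_k)_{k\ge1}$ of pairwise distinct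 elements of $\mathbb Z^2(A,B)$, in any order, and all real $a_k$ with $\sum_{k\ge1}a_k^2w(k)<\infty$, the series $\sum_{k\ge1}a_k\phi_{n_k,j_k}(x)$ converges for almost every $x\in\mathbb R$. Then the sequence $\log n$ is an RC-multiplier for the system. Moreover, no nondecreasing sequence $w(n)$ of positive numbers with $w(n)=o(\log n)$ as $n\to\infty$ is an RC-multiplier for the system. -/

import Mathlib

open Filter Topology MeasureTheory

/-- The closed interval `[A, B]` of real numbers, where the endpoints `A`, `B` may be infinite. -/
def closedInterval (A B : EReal) : Set ℝ := {x : ℝ | A ≤ (x : EReal) ∧ (x : EReal) ≤ B}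

/-- The index set `ℤ²(A, B)`: the pairs `(n, j)` with `2⁻ⁿ ≤ B - A` and `j 2⁻ⁿ ∈ (A, B]`. -/
def waveletIndex (A B : EReal) : Set (ℤ × ℤ) :=
  {p | (((2 : ℝ) ^ (-p.1) : ℝ) : EReal) ≤ B - A ∧
    A < (((p.2 : ℝ) * (2 : ℝ) ^ (-p.1) : ℝ) : EReal) ∧
    (((p.2 : ℝ) * (2 : ℝ) ^ (-p.1) : ℝ) : EReal) ≤ B}

/-- The decay profile `ξ(x) = (1 + |x|)^{-(1+β)}`. -/
noncomputable def waveletDecay (β x : ℝ) : ℝ := 1 / (1 + |x|) ^ (1 + β)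

/-- A (not necessarily orthogonal) wavelet-type system on the interval `(A, B)` with constant `c`
and exponents `α`, `β`. The Hölder bound is required for pairs of points at distance at most
`2⁻ⁿ`: the right-hand side decays in `t` only, so without this localization it could be compared
with a point `t` far away from `t'` and would exclude every normalized system. -/
structure IsWaveletType (A B : EReal) (c α β : ℝ) (φ : waveletIndex A B → ℝ → ℝ) : Prop where
  memLp_two : ∀ p, MemLp (φ p) 2 volume
  memLp_top : ∀ p, MemLp (φ p) ⊤ volume
  support_subset : ∀ p, Function.support (φ p) ⊆ closedInterval A B
  integral_eq_zero : ∀ p, ∫ t, φ p t = 0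
  decay : ∀ p : waveletIndex A B, ∀ t ∈ closedInterval A B,
    |φ p t| ≤ c * (2 : ℝ) ^ ((p.1.1 : ℝ) / 2) * waveletDecay β ((2 : ℝ) ^ p.1.1 * t - p.1.2)
  holder : ∀ p : waveletIndex A B, ∀ t ∈ closedInterval A B, ∀ t' ∈ closedInterval A B,
    |t - t'| ≤ (2 : ℝ) ^ (-p.1.1) →
    |φ p t - φ p t'| ≤ c * (2 : ℝ) ^ ((p.1.1 : ℝ) / 2) * ((2 : ℝ) ^ p.1.1 * |t - t'|) ^ α *
      waveletDecay β ((2 : ℝ) ^ p.1.1 * t - p.1.2)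

/-- Orthonormality in `L²(ℝ)` of a family of real functions. -/
structure IsOrthonormalSystem {ι : Type*} (φ : ι → ℝ → ℝ) : Prop where
  memLp_two : ∀ i, MemLp (φ i) 2 volume
  integral_sq : ∀ i, ∫ t, φ i t ^ 2 = 1
  integral_mul : ∀ i j, i ≠ j → ∫ t, φ i t * φ j t = 0

/-- The weights `w 1, w 2, …` form an almost everywhere convergence Weyl multiplier for the
sequence of functions `ψ`: if `∑_{n ≥ 1} aₙ² w(n) < ∞`, then `∑_{n ≥ 1} aₙ ψₙ(x)` converges for
almost every `x`. The `n`-th term (`n ≥ 1`) has Lean index `k = n - 1`; `w 0` plays no role.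
Positivity and monotonicity of the weights are imposed where the notion is used. -/
def IsWeylMultiplier (w : ℕ → ℝ) (ψ : ℕ → ℝ → ℝ) : Prop :=
  ∀ a : ℕ → ℝ, Summable (fun k => a k ^ 2 * w (k + 1)) →
    ∀ᵐ x ∂(volume : Measure ℝ), ∃ s : ℝ,
      Tendsto (fun N : ℕ => ∑ k ∈ Finset.range N, a k * ψ k x) atTop (𝓝 s)

/-- `w` is an RC-multiplier for the system `φ`: it is a Weyl multiplier for every sequence of
members of the system with pairwise distinct indices, taken in any order. -/
def IsRCMultiplier {ι : Type*} (w : ℕ → ℝ) (φ : ι → ℝ → ℝ) : Prop :=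
  ∀ σ : ℕ → ι, Function.Injective σ → IsWeylMultiplier w (fun k => φ (σ k))

/-!
Both halves start from the atoms `2 ^ (-n / 2) φ_{n,j}`, which are bounded by shifts and dilations
of one decay profile, Hölder continuous on `[A, B]` at the scale `2 ^ (-n)`, and of mean zero.

**The weights `log n` suffice.** On a short interval `J ⊆ [A, B]` a finite sum `S` of atoms is
expanded as a martingale with respect to the dyadic subdivisions of `J`. The increment of one atom
on a cell is small when the level of the cell is far from the level of the atom: on small cells
by smoothness, on large cells because an atom of mean zero whose mass does not straddle an endpoint
of the cell has almost no integral over it, either directly or by passing to the complement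
(`IsAtomSystem.sum_cellOsc_le`). A weighted Schur test turns this into
`IsAtomSystem.exists_sum_cellOsc_sq_le`: a square function that majorizes the quadratic variation of
every subsum of `S` has its `L²` norm controlled by the coefficients. The two increments on the
halves of a cell are opposite, so the bound `cosh t ≤ exp (t ^ 2 / 2)` gives an exponential
supermartingale (`sum_exp_le`), and where the square function is at most `√V` each subsum has tails
`exp (-λ ^ 2 / (2 V))`. A union bound over the `2 ^ 2 ^ (m + 1)` partial sums of the block of terms
with index in `[2 ^ 2 ^ m, 2 ^ 2 ^ (m + 1))` is harmless for `V` of order `λ ^ 2 / 2 ^ m`, and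
`log k` is of order `2 ^ m` in that block; so the Borel–Cantelli lemma shows that the fluctuations
inside the blocks tend to zero. The sums over whole blocks converge absolutely almost everywhere by
orthonormality (`isRCMultiplier_log`).

**Nothing smaller suffices.** Let `F_i`, `i < N`, be sums of all atoms near a point of `(A, B)`
at `N` well separated levels, with signs chosen so that their positive parts have mean bounded
below. The squares of the coefficients of `F_0 + ⋯ + F_{N-1}` sum to about `N`, and about
`2 ^ (C N)` functions are involved. Choose thresholds `θ_i` near which `F_i` spends little time,
and sort the atoms by the ternary number whose digit at place `i` says whether `F_i > θ_i` at the
centre of the atom. This is a traversal of a tree, and the initial segment belonging to the ternary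
number of a point `x` sums at `x` to `∑ F_i(x)` over the `i` with `F_i(x) > θ_i`, up to a small error
in the mean (`IsAtomSystem.exists_block`). So rearranged partial sums of order `N` occur, where the
norm is of order `√N`. Concatenating such blocks, scaled by `1 / N` and with `N` growing fast enough
for `w (2 ^ (C N)) / N` to be summable, gives a series whose block fluctuations do not tend to zero
(`not_isRCMultiplier_of_isLittleO`).
-/

/-! ### The decay profile -/

lemma waveletDecay_pos (β x : ℝ) : 0 < waveletDecay β x := by
  unfold waveletDecay; positivity

/-- Away from the origin the profile gains a small factor at the expense of half the exponent. -/
lemma waveletDecay_le_rpow_mul {β R x : ℝ} (hβ : 0 < β) (hR : 0 < R) (hx : R ≤ |x|) :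
    waveletDecay β x ≤ R ^ (-(β / 2)) * waveletDecay (β / 2) x := by
  have h1 : (1 + |x|) ^ (1 + β) = (1 + |x|) ^ (β / 2) * (1 + |x|) ^ (1 + β / 2) := by
    rw [← Real.rpow_add (by positivity)]; congr 1; ring
  have h2 : R ^ (β / 2) ≤ (1 + |x|) ^ (β / 2) :=
    Real.rpow_le_rpow hR.le (by linarith) (by positivity)
  unfold waveletDecay
  rw [h1, Real.rpow_neg hR.le, ← one_div, one_div_mul_one_div]
  exact one_div_le_one_div_of_le (by positivity) (by gcongr)

lemma integrable_waveletDecay {β : ℝ} (hβ : 0 < β) : Integrable (waveletDecay β) := by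
  have h := integrable_one_add_norm (E := ℝ) (μ := volume) (r := 1 + β) (by simp [hβ])
  refine h.congr (ae_of_all _ fun x => ?_)
  simp only [waveletDecay, Real.norm_eq_abs]
  rw [Real.rpow_neg (by positivity), one_div]

lemma summable_waveletDecay_int {β : ℝ} (hβ : 0 < β) :
    Summable fun i : ℤ => waveletDecay β i := by
  refine Summable.of_nonneg_of_le (fun i => (waveletDecay_pos _ _).le) (fun i => ?_)
    ((Real.summable_one_div_int_add_rpow (1 / 2) (1 + β)).2 (by linarith))
  unfold waveletDecay
  have h0 : 0 < |(i : ℝ) + 1 / 2| := by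
    rw [abs_pos]
    intro h
    have h2 : (2 * i + 1 : ℝ) = 0 := by linarith
    have h3 : 2 * i + 1 = 0 := by exact_mod_cast h2
    omega
  refine one_div_le_one_div_of_le (by positivity) (Real.rpow_le_rpow h0.le ?_ (by linarith))
  have := abs_add_le (i : ℝ) (1 / 2)
  rw [abs_of_pos (by norm_num : (0 : ℝ) < 1 / 2)] at this
  linarith

lemma exists_sum_waveletDecay_le {β : ℝ} (hβ : 0 < β) :
    ∃ K : ℝ, ∀ (x : ℝ) (F : Finset ℤ), ∑ j ∈ F, waveletDecay β (x - j) ≤ K := by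
  refine ⟨(2 : ℝ) ^ (1 + β) * ∑' i : ℤ, waveletDecay β i, fun x F => ?_⟩
  have hs := summable_waveletDecay_int hβ
  have hs' : Summable fun j : ℤ => waveletDecay β ((j - ⌊x⌋ : ℤ) : ℝ) :=
    by
    have := (Equiv.subRight ⌊x⌋).summable_iff.2 hs
    exact this
  have hle : ∀ j : ℤ, waveletDecay β (x - j) ≤
      (2 : ℝ) ^ (1 + β) * waveletDecay β ((j - ⌊x⌋ : ℤ) : ℝ) := by
    intro j
    have h1 : |((j - ⌊x⌋ : ℤ) : ℝ)| ≤ |x - j| + 1 := by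
      have h2 : ((j - ⌊x⌋ : ℤ) : ℝ) = -(x - j) + Int.fract x := by
        push_cast; rw [← Int.self_sub_floor]; ring
      rw [h2]
      refine (abs_add_le _ _).trans ?_
      rw [abs_neg, abs_of_nonneg (Int.fract_nonneg x)]
      linarith [Int.fract_lt_one x]
    unfold waveletDecay
    rw [mul_one_div, div_le_div_iff₀ (by positivity) (by positivity), one_mul,
      ← Real.mul_rpow (by norm_num) (by positivity)]
    exact Real.rpow_le_rpow (by positivity) (by linarith [abs_nonneg (x - j)]) (by linarith)
  calc ∑ j ∈ F, waveletDecay β (x - j)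
      ≤ ∑ j ∈ F, (2 : ℝ) ^ (1 + β) * waveletDecay β ((j - ⌊x⌋ : ℤ) : ℝ) :=
        Finset.sum_le_sum fun j _ => hle j
    _ = (2 : ℝ) ^ (1 + β) * ∑ j ∈ F, waveletDecay β ((j - ⌊x⌋ : ℤ) : ℝ) := by rw [Finset.mul_sum]
    _ ≤ (2 : ℝ) ^ (1 + β) * ∑' j : ℤ, waveletDecay β ((j - ⌊x⌋ : ℤ) : ℝ) := by
        gcongr
        exact hs'.sum_le_tsum _ fun _ _ => (waveletDecay_pos _ _).le
    _ = (2 : ℝ) ^ (1 + β) * ∑' i : ℤ, waveletDecay β i := by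
        rw [← (Equiv.subRight ⌊x⌋).tsum_eq fun i : ℤ => waveletDecay β i]
        rfl

/-- `K` bounds both the sums over integer translates and the integral of the decay profile. -/
structure IsDecayConst (β K : ℝ) : Prop where
  sum_le : ∀ (x : ℝ) (F : Finset ℤ), ∑ j ∈ F, waveletDecay β (x - j) ≤ K
  integral_le : ∫ x, waveletDecay β x ≤ K

/-- A constant serving both the exponent `β` and the exponent `β / 2`. -/
lemma exists_isDecayConst {β : ℝ} (hβ : 0 < β) :
    ∃ K : ℝ, 1 ≤ K ∧ IsDecayConst β K ∧ IsDecayConst (β / 2) K := by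
  obtain ⟨K₁, h₁⟩ := exists_sum_waveletDecay_le hβ
  obtain ⟨K₂, h₂⟩ := exists_sum_waveletDecay_le (half_pos hβ)
  refine ⟨1 + |K₁| + |K₂| + |∫ x, waveletDecay β x| + |∫ x, waveletDecay (β / 2) x|, ?_, ?_, ?_⟩
  · have := abs_nonneg K₁; have := abs_nonneg K₂
    have := abs_nonneg (∫ x, waveletDecay β x); have := abs_nonneg (∫ x, waveletDecay (β / 2) x)
    linarith
  all_goals
    have := abs_nonneg K₁; have := abs_nonneg K₂
    have := abs_nonneg (∫ x, waveletDecay β x); have := abs_nonneg (∫ x, waveletDecay (β / 2) x)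
    have := le_abs_self K₁; have := le_abs_self K₂
    have := le_abs_self (∫ x, waveletDecay β x); have := le_abs_self (∫ x, waveletDecay (β / 2) x)
    constructor
    · intro x F
      first
        | exact (h₁ x F).trans (by linarith)
        | exact (h₂ x F).trans (by linarith)
    · linarith

lemma integrable_waveletDecay_dilate {β : ℝ} (hβ : 0 < β) (n j : ℤ) :
    Integrable fun t => waveletDecay β ((2 : ℝ) ^ n * t - j) :=
  ((integrable_waveletDecay hβ).comp_sub_right (j : ℝ)).comp_mul_left' (by positivity)

lemma IsDecayConst.integral_dilate_le {β K : ℝ} (h : IsDecayConst β K) (n j : ℤ) :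
    ∫ t, waveletDecay β ((2 : ℝ) ^ n * t - j) ≤ K * (2 : ℝ) ^ (-n) := by
  rw [Measure.integral_comp_mul_left (fun t => waveletDecay β (t - j)) ((2 : ℝ) ^ n),
    integral_sub_right_eq_self, abs_of_pos (by positivity), zpow_neg, smul_eq_mul, mul_comm]
  gcongr
  exact h.integral_le

/-! ### Normalized systems -/

/-- Functions `ψ (n, j)`, `n j : ℤ`, that have on the set `X` the size, smoothness and
cancellation of a wavelet-type system divided by `2 ^ (n / 2)`. All pairs of integers are allowed as
indices; pairs that do not occur carry the zero function. -/
structure IsAtomSystem (X : Set ℝ) (c α β : ℝ) (ψ : ℤ × ℤ → ℝ → ℝ) : Prop where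
  measurable : ∀ p, Measurable (ψ p)
  integral_eq_zero : ∀ p, ∫ t, ψ p t = 0
  decay : ∀ p t, |ψ p t| ≤ c * waveletDecay β ((2 : ℝ) ^ p.1 * t - p.2)
  holder : ∀ p, ∀ t ∈ X, ∀ t' ∈ X, |t - t'| ≤ (2 : ℝ) ^ (-p.1) →
    |ψ p t - ψ p t'| ≤ c * ((2 : ℝ) ^ p.1 * |t - t'|) ^ α *
      waveletDecay β ((2 : ℝ) ^ p.1 * t - p.2)

namespace IsAtomSystem

variable {X : Set ℝ} {c α β : ℝ} {ψ : ℤ × ℤ → ℝ → ℝ}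

lemma const_nonneg (h : IsAtomSystem X c α β ψ) : 0 ≤ c := by
  have h1 := (abs_nonneg _).trans (h.decay (0, 0) 0)
  exact nonneg_of_mul_nonneg_left h1 (waveletDecay_pos _ _)

lemma integrable (h : IsAtomSystem X c α β ψ) (hβ : 0 < β) (p : ℤ × ℤ) : Integrable (ψ p) :=
  ((integrable_waveletDecay_dilate hβ p.1 p.2).const_mul c).mono'
    (h.measurable p).aestronglyMeasurable (ae_of_all _ fun t => by simpa using h.decay p t)

lemma sum_abs_le (h : IsAtomSystem X c α β ψ) {K : ℝ} (hK : IsDecayConst β K) (n : ℤ)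
    (F : Finset ℤ) (x : ℝ) : ∑ j ∈ F, |ψ (n, j) x| ≤ c * K := by
  calc ∑ j ∈ F, |ψ (n, j) x| ≤ ∑ j ∈ F, c * waveletDecay β ((2 : ℝ) ^ n * x - j) :=
        Finset.sum_le_sum fun j _ => h.decay (n, j) x
    _ = c * ∑ j ∈ F, waveletDecay β ((2 : ℝ) ^ n * x - j) := by rw [Finset.mul_sum]
    _ ≤ _ := mul_le_mul_of_nonneg_left (hK.sum_le _ _) h.const_nonneg

end IsAtomSystem

/-- The functions of a wavelet-type system, divided by `2 ^ (n / 2)` and extended by zero to all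
pairs of integers. -/
noncomputable def normalizedAtom {A B : EReal} (φ : waveletIndex A B → ℝ → ℝ) (p : ℤ × ℤ) (t : ℝ) :
    ℝ :=
  open Classical in
  if h : p ∈ waveletIndex A B then (2 : ℝ) ^ (-((p.1 : ℝ) / 2)) * φ ⟨p, h⟩ t else 0

section

variable {A B : EReal} {c α β : ℝ} {φ : waveletIndex A B → ℝ → ℝ}

lemma isClosed_closedInterval (A B : EReal) : IsClosed (closedInterval A B) :=
  (isClosed_le continuous_const continuous_coe_real_ereal).inter
    (isClosed_le continuous_coe_real_ereal continuous_const)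

lemma IsWaveletType.measurable (hφ : IsWaveletType A B c α β φ) (hα : 0 < α)
    (p : waveletIndex A B) : Measurable (φ p) := by
  classical
  have hc : ContinuousOn (φ p) (closedInterval A B) := by
    intro t ht
    have hlim : Tendsto (fun t' => c * (2 : ℝ) ^ ((p.1.1 : ℝ) / 2) *
        ((2 : ℝ) ^ p.1.1 * |t - t'|) ^ α * waveletDecay β ((2 : ℝ) ^ p.1.1 * t - p.1.2))
        (𝓝[closedInterval A B] t) (𝓝 0) := by
      have hcont : Continuous fun t' : ℝ => c * (2 : ℝ) ^ ((p.1.1 : ℝ) / 2) *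
        ((2 : ℝ) ^ p.1.1 * |t - t'|) ^ α * waveletDecay β ((2 : ℝ) ^ p.1.1 * t - p.1.2) := by
        refine Continuous.mul (Continuous.mul continuous_const ?_) continuous_const
        exact (by fun_prop : Continuous fun t' : ℝ => (2 : ℝ) ^ p.1.1 * |t - t'|).rpow_const
          fun x => Or.inr hα.le
      have := (hcont.tendsto t).mono_left (nhdsWithin_le_nhds (s := closedInterval A B))
      simpa [Real.zero_rpow hα.ne'] using this
    rw [ContinuousWithinAt, tendsto_iff_norm_sub_tendsto_zero]
    refine squeeze_zero' (Eventually.of_forall fun _ => norm_nonneg _) ?_ hlim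
    have hnear : ∀ᶠ t' in 𝓝[closedInterval A B] t, |t - t'| ≤ (2 : ℝ) ^ (-p.1.1) := by
      refine nhdsWithin_le_nhds ?_
      filter_upwards [Metric.closedBall_mem_nhds t (by positivity : 0 < (2 : ℝ) ^ (-p.1.1))]
        with t' ht'
      rwa [Metric.mem_closedBall, dist_comm, Real.dist_eq] at ht'
    filter_upwards [hnear, self_mem_nhdsWithin] with t' h1 h2
    rw [Real.norm_eq_abs, abs_sub_comm]
    exact hφ.holder p t ht t' h2 h1
  have heq : φ p = (closedInterval A B).piecewise (φ p) (fun _ => 0) := by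
    ext t
    by_cases ht : t ∈ closedInterval A B
    · simp [ht]
    · simp only [Set.piecewise, ht, if_false]
      by_contra hne
      exact ht (hφ.support_subset p hne)
  rw [heq]
  exact hc.measurable_piecewise continuousOn_const (isClosed_closedInterval A B).measurableSet

lemma normalizedAtom_of_mem {p : ℤ × ℤ} (h : p ∈ waveletIndex A B) :
    normalizedAtom φ p = fun t => (2 : ℝ) ^ (-((p.1 : ℝ) / 2)) * φ ⟨p, h⟩ t := by
  ext t; simp [normalizedAtom, h]

lemma IsWaveletType.isAtomSystem (hφ : IsWaveletType A B c α β φ) (hα : 0 < α) :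
    IsAtomSystem (closedInterval A B) |c| α β (normalizedAtom φ) := by
  have hcancel : ∀ n : ℤ, (2 : ℝ) ^ (-((n : ℝ) / 2)) * (2 : ℝ) ^ ((n : ℝ) / 2) = 1 := fun n => by
    rw [← Real.rpow_add (by norm_num)]; simp
  constructor
  · intro p
    by_cases h : p ∈ waveletIndex A B
    · rw [normalizedAtom_of_mem h]; exact (hφ.measurable hα _).const_mul _
    · have : normalizedAtom φ p = fun _ => 0 := by ext t; simp [normalizedAtom, h]
      rw [this]; exact measurable_const
  · intro p
    by_cases h : p ∈ waveletIndex A B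
    · rw [normalizedAtom_of_mem h, integral_const_mul, hφ.integral_eq_zero, mul_zero]
    · simp [normalizedAtom, h]
  · intro p t
    have hpos := waveletDecay_pos β ((2 : ℝ) ^ p.1 * t - p.2)
    by_cases h : p ∈ waveletIndex A B
    · rw [normalizedAtom_of_mem h]
      by_cases ht : t ∈ closedInterval A B
      · have h1 := hφ.decay ⟨p, h⟩ t ht
        rw [abs_mul, abs_of_pos (by positivity)]
        calc (2 : ℝ) ^ (-((p.1 : ℝ) / 2)) * |φ ⟨p, h⟩ t|
            ≤ (2 : ℝ) ^ (-((p.1 : ℝ) / 2)) * (c * (2 : ℝ) ^ ((p.1 : ℝ) / 2) *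
              waveletDecay β ((2 : ℝ) ^ p.1 * t - p.2)) := by gcongr
          _ = ((2 : ℝ) ^ (-((p.1 : ℝ) / 2)) * (2 : ℝ) ^ ((p.1 : ℝ) / 2)) *
              (c * waveletDecay β ((2 : ℝ) ^ p.1 * t - p.2)) := by ring
          _ ≤ _ := by rw [hcancel, one_mul]; gcongr; exact le_abs_self c
      · have h0 : φ ⟨p, h⟩ t = 0 := by
          by_contra hne
          exact ht (hφ.support_subset _ hne)
        simp only [h0, mul_zero, abs_zero]; positivity
    · simp only [normalizedAtom, h, dif_neg, not_false_eq_true, abs_zero]; positivity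
  · intro p t ht t' ht' htt
    have hpos := waveletDecay_pos β ((2 : ℝ) ^ p.1 * t - p.2)
    by_cases h : p ∈ waveletIndex A B
    · rw [normalizedAtom_of_mem h]
      have h1 := hφ.holder ⟨p, h⟩ t ht t' ht' htt
      simp only
      rw [← mul_sub, abs_mul, abs_of_pos (by positivity)]
      calc (2 : ℝ) ^ (-((p.1 : ℝ) / 2)) * |φ ⟨p, h⟩ t - φ ⟨p, h⟩ t'|
          ≤ (2 : ℝ) ^ (-((p.1 : ℝ) / 2)) * (c * (2 : ℝ) ^ ((p.1 : ℝ) / 2) *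
            ((2 : ℝ) ^ p.1 * |t - t'|) ^ α * waveletDecay β ((2 : ℝ) ^ p.1 * t - p.2)) := by gcongr
        _ = ((2 : ℝ) ^ (-((p.1 : ℝ) / 2)) * (2 : ℝ) ^ ((p.1 : ℝ) / 2)) *
            (c * ((2 : ℝ) ^ p.1 * |t - t'|) ^ α *
              waveletDecay β ((2 : ℝ) ^ p.1 * t - p.2)) := by ring
        _ ≤ _ := by rw [hcancel, one_mul]; gcongr; exact le_abs_self c
    · simp only [normalizedAtom, h, dif_neg, not_false_eq_true, sub_zero, abs_zero]; positivity

end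

/-! ### Haar coefficients of atoms -/

/-- The unnormalized Haar coefficient of `f` on `[v, v + 2l]`. -/
noncomputable def haarCoeff (f : ℝ → ℝ) (v l : ℝ) : ℝ :=
  (∫ t in v..(v + l), f t) - ∫ t in (v + l)..(v + 2 * l), f t

lemma abs_haarCoeff_le {f : ℝ → ℝ} (hf : Integrable f) {v l : ℝ} (hl : 0 ≤ l) :
    |haarCoeff f v l| ≤ |∫ t in v..(v + l), f t| + |∫ t in (v + l)..(v + 2 * l), f t| ∧
    |haarCoeff f v l| ≤ ∫ t in v..(v + 2 * l), |f t| := by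
  have h1 : |haarCoeff f v l| ≤
      |∫ t in v..(v + l), f t| + |∫ t in (v + l)..(v + 2 * l), f t| := abs_sub _ _
  refine ⟨h1, h1.trans ?_⟩
  rw [← intervalIntegral.integral_add_adjacent_intervals (b := v + l)
    (hf.abs.intervalIntegrable) (hf.abs.intervalIntegrable)]
  exact add_le_add (intervalIntegral.abs_integral_le_integral_abs (by linarith))
    (intervalIntegral.abs_integral_le_integral_abs (by linarith))

/-- A geometric majorant of the Hölder gain at dyadic scales. -/
lemma two_zpow_neg_rpow_le {α δ : ℝ} (h : δ ≤ α) (m : ℕ) :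
    ((2 : ℝ) ^ (-(m : ℤ))) ^ α ≤ ((2 : ℝ) ^ (-δ)) ^ m := by
  rw [← Real.rpow_intCast, ← Real.rpow_mul (by norm_num), ← Real.rpow_natCast,
    ← Real.rpow_mul (by norm_num)]
  refine Real.rpow_le_rpow_of_exponent_le (by norm_num) ?_
  push_cast
  nlinarith [(Nat.cast_nonneg m : (0 : ℝ) ≤ m)]

namespace IsAtomSystem

variable {X : Set ℝ} {c α β : ℝ} {ψ : ℤ × ℤ → ℝ → ℝ}

lemma abs_haarCoeff_le_holder (h : IsAtomSystem X c α β ψ) (hβ : 0 < β) (p : ℤ × ℤ)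
    {v l : ℝ} (hl : 0 < l) (hln : l ≤ (2 : ℝ) ^ (-p.1)) (hX : Set.Icc v (v + 2 * l) ⊆ X) :
    |haarCoeff (ψ p) v l| ≤ c * ((2 : ℝ) ^ p.1 * l) ^ α *
      ∫ t in v..(v + 2 * l), waveletDecay β ((2 : ℝ) ^ p.1 * t - p.2) := by
  have hc := h.const_nonneg
  have hi := h.integrable hβ p
  have hd := integrable_waveletDecay_dilate hβ p.1 p.2
  have hshift : ∫ t in (v + l)..(v + 2 * l), ψ p t = ∫ t in v..(v + l), ψ p (t + l) := by
    rw [intervalIntegral.integral_comp_add_right]; congr 1; ring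
  have hi2 : Integrable fun t => ψ p (t + l) := hi.comp_add_right l
  rw [haarCoeff, hshift, ← intervalIntegral.integral_sub hi.intervalIntegrable
    hi2.intervalIntegrable]
  have hvl : v ≤ v + l := by linarith
  have step : ∀ t ∈ Set.Ioc v (v + l), ‖ψ p t - ψ p (t + l)‖ ≤
      c * ((2 : ℝ) ^ p.1 * l) ^ α * waveletDecay β ((2 : ℝ) ^ p.1 * t - p.2) := by
    intro t ht
    have hdist : |t - (t + l)| = l := by rw [sub_add_cancel_left, abs_neg, abs_of_pos hl]
    have := h.holder p t (hX ⟨by linarith [ht.1], by linarith [ht.2]⟩) (t + l)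
      (hX ⟨by linarith [ht.1], by linarith [ht.2]⟩) (by rwa [hdist])
    rwa [hdist] at this
  calc |∫ t in v..(v + l), ψ p t - ψ p (t + l)|
      ≤ ∫ t in v..(v + l), c * ((2 : ℝ) ^ p.1 * l) ^ α *
          waveletDecay β ((2 : ℝ) ^ p.1 * t - p.2) := by
        refine intervalIntegral.norm_integral_le_of_norm_le hvl (ae_of_all _ step)
          (hd.const_mul _).intervalIntegrable
    _ = c * ((2 : ℝ) ^ p.1 * l) ^ α *
          ∫ t in v..(v + l), waveletDecay β ((2 : ℝ) ^ p.1 * t - p.2) := by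
        rw [intervalIntegral.integral_const_mul]
    _ ≤ _ := by
        gcongr ?_ * ?_
        refine intervalIntegral.integral_mono_interval le_rfl hvl (by linarith)
          (ae_of_all _ fun t => (waveletDecay_pos _ _).le) hd.intervalIntegrable

/-- Summing over all positions at one level, the integrals over an interval `(v, w]` are controlled
by the boundary of the interval: an atom centred inside has the same integral over the complement,
up to sign, an atom centred outside sees only its tail, and in both cases either the atom is centred
near the point of integration, which is then near an endpoint, or the decay gives a small factor. -/
lemma sum_abs_integral_le (h : IsAtomSystem X c α β ψ) (hβ : 0 < β) {K : ℝ}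
    (hK : IsDecayConst β K) (hK' : IsDecayConst (β / 2) K) (n : ℤ) (F : Finset ℤ) {v w r : ℝ}
    (hvw : v ≤ w) (hr : 0 < r) :
    ∑ j ∈ F, |∫ t in v..w, ψ (n, j) t| ≤
      c * K * (4 * r + ((2 : ℝ) ^ n * r) ^ (-(β / 2)) * (2 * (w - v) + (2 : ℝ) ^ (-n))) := by
  classical
  have hc := h.const_nonneg
  have h2n : (0 : ℝ) < (2 : ℝ) ^ n := by positivity
  set I : Set ℝ := Set.Ioc v w with hI
  set Z : Set ℝ := Set.Icc (v - r) (v + r) ∪ Set.Icc (w - r) (w + r) with hZ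
  set y : ℤ → ℝ := fun j => (2 : ℝ) ^ (-n) * j with hy
  set ε : ℝ := ((2 : ℝ) ^ n * r) ^ (-(β / 2)) with hε
  have hε0 : 0 ≤ ε := by positivity
  set f : ℤ → ℝ → ℝ := fun j t => waveletDecay β ((2 : ℝ) ^ n * t - j) with hf
  set g : ℤ → ℝ → ℝ := fun j t => waveletDecay (β / 2) ((2 : ℝ) ^ n * t - j) with hg
  have hfi : ∀ j, Integrable (f j) := fun j => integrable_waveletDecay_dilate hβ n j
  have hgi : ∀ j, Integrable (g j) := fun j => integrable_waveletDecay_dilate (half_pos hβ) n j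
  have hf0 : ∀ j t, 0 ≤ f j t := fun j t => (waveletDecay_pos _ _).le
  have hg0 : ∀ j t, 0 ≤ g j t := fun j t => (waveletDecay_pos _ _).le
  have hIm : MeasurableSet I := measurableSet_Ioc
  have hZm : MeasurableSet Z := measurableSet_Icc.union measurableSet_Icc
  have hfar : ∀ j t, r ≤ |t - y j| → f j t ≤ ε * g j t := by
    intro j t ht
    refine waveletDecay_le_rpow_mul hβ (by positivity) ?_
    have : (2 : ℝ) ^ n * t - j = (2 : ℝ) ^ n * (t - y j) := by
      simp only [hy]; rw [mul_sub, ← mul_assoc, ← zpow_add₀ (by norm_num)]; simp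
    rw [this, abs_mul, abs_of_pos h2n]
    gcongr
  have hnear : ∀ j t, |t - y j| < r → ¬ (t ∈ I ↔ y j ∈ I) → t ∈ Z := by
    intro j t ht hiff
    rw [abs_lt] at ht
    simp only [hI, hZ, Set.mem_union, Set.mem_Icc, Set.mem_Ioc] at hiff ⊢
    by_contra hcon
    apply hiff
    push Not at hcon
    constructor
    · rintro ⟨h1, h2⟩
      constructor
      · by_contra h3
        have := hcon.1 (by linarith); linarith
      · by_contra h3
        have := hcon.2 (by linarith); linarith
    · rintro ⟨h1, h2⟩
      constructor
      · by_contra h3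
        have := hcon.1 (by linarith); linarith
      · by_contra h3
        have := hcon.2 (by linarith); linarith
  -- the majorant of one integral
  have hone : ∀ j, |∫ t in v..w, ψ (n, j) t| ≤ c * ((∫ t in Z, f j t) +
      ε * (∫ t in I, g j t) + ε * (if y j ∈ I then ∫ t, g j t else 0)) := by
    intro j
    have hψi := h.integrable hβ (n, j)
    have hψf : ∀ t, |ψ (n, j) t| ≤ c * f j t := fun t => h.decay (n, j) t
    rw [intervalIntegral.integral_of_le hvw]
    set S : Set ℝ := if y j ∈ I then Iᶜ else I with hS
    have hSm : MeasurableSet S := by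
      rw [hS]; split_ifs
      · exact hIm.compl
      · exact hIm
    have hSeq : |∫ t in I, ψ (n, j) t| = |∫ t in S, ψ (n, j) t| := by
      rw [hS]
      split_ifs
      · have := integral_add_compl hIm hψi
        rw [h.integral_eq_zero] at this
        rw [eq_neg_of_add_eq_zero_left this, abs_neg]
      · rfl
    rw [hSeq]
    have hle1 : |∫ t in S, ψ (n, j) t| ≤ ∫ t in S, c * f j t := by
      exact (abs_integral_le_integral_abs).trans
        (integral_mono hψi.abs.integrableOn ((hfi j).const_mul c).integrableOn hψf)
    refine hle1.trans ?_
    rw [integral_const_mul]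
    gcongr
    set R : ℝ → ℝ := fun t => Z.indicator (f j) t + ε * I.indicator (g j) t +
      ε * (if y j ∈ I then g j t else 0) with hR
    have hite : Integrable fun t => (if y j ∈ I then g j t else 0 : ℝ) := by
      split_ifs
      · exact hgi j
      · exact integrable_zero _ _ _
    have hi1 : Integrable fun t => Z.indicator (f j) t := (hfi j).indicator hZm
    have hi2 : Integrable fun t => ε * I.indicator (g j) t := ((hgi j).indicator hIm).const_mul ε
    have hi12 : Integrable fun t => Z.indicator (f j) t + ε * I.indicator (g j) t := hi1.add hi2
    have hRi : Integrable R := hi12.add (hite.const_mul ε)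
    have hpt : ∀ t, S.indicator (f j) t ≤ R t := by
      intro t
      have hZ0 : 0 ≤ Z.indicator (f j) t := Set.indicator_nonneg (fun t _ => hf0 j t) t
      have hI0 : 0 ≤ I.indicator (g j) t := Set.indicator_nonneg (fun t _ => hg0 j t) t
      have hE0 : (0 : ℝ) ≤ if y j ∈ I then g j t else 0 := by
        split_ifs
        · exact hg0 j t
        · exact le_rfl
      by_cases htS : t ∈ S
      · rw [Set.indicator_of_mem htS]
        by_cases hfr : r ≤ |t - y j|
        · have hb := hfar j t hfr
          have hgt : g j t ≤ I.indicator (g j) t + (if y j ∈ I then g j t else 0) := by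
            by_cases hyI : y j ∈ I
            · simp only [hyI, if_true]; linarith
            · simp only [hS, hyI, if_false] at htS ⊢
              rw [Set.indicator_of_mem htS]; simp
          have := mul_le_mul_of_nonneg_left hgt hε0
          simp only [hR]; linarith
        · have htZ : t ∈ Z := by
            refine hnear j t (not_le.1 hfr) fun hiff => ?_
            by_cases hyI : y j ∈ I
            · simp only [hS, hyI, if_true] at htS
              exact htS (hiff.2 hyI)
            · simp only [hS, hyI, if_false] at htS
              exact hyI (hiff.1 htS)
          have : Z.indicator (f j) t = f j t := Set.indicator_of_mem htZ _
          simp only [hR, this]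
          have := mul_nonneg hε0 hI0
          have := mul_nonneg hε0 hE0
          linarith
      · rw [Set.indicator_of_notMem htS]
        simp only [hR]; positivity
    calc ∫ t in S, f j t = ∫ t, S.indicator (f j) t := (integral_indicator hSm).symm
      _ ≤ ∫ t, R t := integral_mono ((hfi j).indicator hSm) hRi hpt
      _ = _ := by
        simp only [hR]
        rw [integral_add hi12 (hite.const_mul ε), integral_add hi1 hi2,
          integral_indicator hZm, integral_const_mul, integral_const_mul, integral_indicator hIm]
        congr 2
        split_ifs
        · rfl
        · simp
  have hZvol : volume.real Z ≤ 4 * r := by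
    refine (measureReal_union_le _ _).trans ?_
    rw [Real.volume_real_Icc_of_le (by linarith), Real.volume_real_Icc_of_le (by linarith)]
    linarith
  have hZfin : volume Z ≠ ⊤ := by
    refine (measure_union_lt_top ?_ ?_).ne <;> simp
  have hK0 : 0 ≤ K := by simpa using hK.sum_le 0 ∅
  have hs1 : ∑ j ∈ F, ∫ t in Z, f j t ≤ K * (4 * r) := by
    rw [← integral_finsetSum _ fun j _ => (hfi j).integrableOn]
    calc ∫ t in Z, ∑ j ∈ F, f j t ≤ ∫ t in Z, K := by
          refine setIntegral_mono_on (integrable_finsetSum _ fun j _ => (hfi j)).integrableOn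
            (by simp [hZfin.lt_top]) hZm fun t _ => hK.sum_le _ _
      _ = K * volume.real Z := by simp [mul_comm]
      _ ≤ _ := by gcongr
  have hs2 : ∑ j ∈ F, ∫ t in I, g j t ≤ K * (w - v) := by
    rw [← integral_finsetSum _ fun j _ => (hgi j).integrableOn]
    calc ∫ t in I, ∑ j ∈ F, g j t ≤ ∫ t in I, K := by
          refine setIntegral_mono_on (integrable_finsetSum _ fun j _ => (hgi j)).integrableOn
            (by simp [hI]) hIm fun t _ => hK'.sum_le _ _
      _ = K * (w - v) := by simp [mul_comm, hI, hvw]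
  have hs3 : ∑ j ∈ F, (if y j ∈ I then ∫ t, g j t else 0) ≤ K * ((w - v) + (2 : ℝ) ^ (-n)) := by
    have hcard : ((F.filter fun j => y j ∈ I).card : ℝ) ≤ (2 : ℝ) ^ n * (w - v) + 1 := by
      have hsub : (F.filter fun j => y j ∈ I) ⊆
          Finset.Ioc ⌊(2 : ℝ) ^ n * v⌋ ⌊(2 : ℝ) ^ n * w⌋ := by
        intro j hj
        have hj := (Finset.mem_filter.1 hj).2
        have hyj : (2 : ℝ) ^ n * y j = j := by
          simp only [hy]; rw [← mul_assoc, ← zpow_add₀ (by norm_num)]; simp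
        rw [Finset.mem_Ioc, Int.floor_lt, Int.le_floor, ← hyj]
        exact ⟨mul_lt_mul_of_pos_left hj.1 h2n, mul_le_mul_of_nonneg_left hj.2 h2n.le⟩
      have h1 : ((F.filter fun j => y j ∈ I).card : ℝ) ≤
          ((Finset.Ioc ⌊(2 : ℝ) ^ n * v⌋ ⌊(2 : ℝ) ^ n * w⌋).card : ℝ) := by
        exact_mod_cast Finset.card_le_card hsub
      have h2 : ⌊(2 : ℝ) ^ n * v⌋ ≤ ⌊(2 : ℝ) ^ n * w⌋ :=
        Int.floor_le_floor (mul_le_mul_of_nonneg_left hvw h2n.le)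
      have h3 : ((Finset.Ioc ⌊(2 : ℝ) ^ n * v⌋ ⌊(2 : ℝ) ^ n * w⌋).card : ℝ) =
          (⌊(2 : ℝ) ^ n * w⌋ : ℝ) - ⌊(2 : ℝ) ^ n * v⌋ := by
        rw [Int.card_Ioc]
        have : ((⌊(2 : ℝ) ^ n * w⌋ - ⌊(2 : ℝ) ^ n * v⌋).toNat : ℤ) =
          ⌊(2 : ℝ) ^ n * w⌋ - ⌊(2 : ℝ) ^ n * v⌋ := Int.toNat_of_nonneg (by omega)
        exact_mod_cast this
      have h4 := Int.floor_le ((2 : ℝ) ^ n * w)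
      have h5 := Int.lt_floor_add_one ((2 : ℝ) ^ n * v)
      rw [mul_sub]
      linarith
    rw [← Finset.sum_filter]
    calc ∑ j ∈ F.filter (fun j => y j ∈ I), ∫ t, g j t
        ≤ ∑ j ∈ F.filter (fun j => y j ∈ I), K * (2 : ℝ) ^ (-n) :=
          Finset.sum_le_sum fun j _ => hK'.integral_dilate_le n j
      _ = (F.filter fun j => y j ∈ I).card * (K * (2 : ℝ) ^ (-n)) := by simp
      _ ≤ ((2 : ℝ) ^ n * (w - v) + 1) * (K * (2 : ℝ) ^ (-n)) := by gcongr
      _ = K * (((2 : ℝ) ^ n * (2 : ℝ) ^ (-n)) * (w - v) + (2 : ℝ) ^ (-n)) := by ring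
      _ = _ := by rw [← zpow_add₀ (by norm_num)]; simp
  calc ∑ j ∈ F, |∫ t in v..w, ψ (n, j) t|
      ≤ ∑ j ∈ F, c * ((∫ t in Z, f j t) +
        ε * (∫ t in I, g j t) + ε * (if y j ∈ I then ∫ t, g j t else 0)) :=
        Finset.sum_le_sum fun j _ => hone j
    _ = c * ((∑ j ∈ F, ∫ t in Z, f j t) + ε * (∑ j ∈ F, ∫ t in I, g j t) +
        ε * ∑ j ∈ F, (if y j ∈ I then ∫ t, g j t else 0)) := by
        rw [← Finset.mul_sum, Finset.sum_add_distrib, Finset.sum_add_distrib, Finset.mul_sum,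
          Finset.mul_sum]
    _ ≤ c * (K * (4 * r) + ε * (K * (w - v)) + ε * (K * ((w - v) + (2 : ℝ) ^ (-n)))) := by
        gcongr
    _ = _ := by ring

end IsAtomSystem

/-! ### Averages over dyadic cells -/

/-- The average of `f` over the `k`-th of the `2 ^ i` equal cells of `[u, u + 2 ^ (-L)]`. -/
noncomputable def cellAverage (u : ℝ) (L : ℤ) (f : ℝ → ℝ) (i k : ℕ) : ℝ :=
  (2 : ℝ) ^ (L + i) *
    ∫ t in (u + k * (2 : ℝ) ^ (-(L + i)))..(u + (k + 1) * (2 : ℝ) ^ (-(L + i))), f t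

/-- Half the difference, in absolute value, of the averages of `f` over the two halves of a cell. -/
noncomputable def cellOsc (u : ℝ) (L : ℤ) (f : ℝ → ℝ) (i k : ℕ) : ℝ :=
  (2 : ℝ) ^ (L + i) * |haarCoeff f (u + k * (2 : ℝ) ^ (-(L + i))) ((2 : ℝ) ^ (-(L + i + 1)))|

lemma two_mul_two_zpow_neg_succ (N : ℤ) : 2 * (2 : ℝ) ^ (-(N + 1)) = (2 : ℝ) ^ (-N) := by
  rw [neg_add, zpow_add₀ (by norm_num)]; norm_num; ring

lemma cellOsc_nonneg (u : ℝ) (L : ℤ) (f : ℝ → ℝ) (i k : ℕ) : 0 ≤ cellOsc u L f i k := by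
  unfold cellOsc; positivity

section Children

variable (u : ℝ) (L : ℤ) (f : ℝ → ℝ) (i k : ℕ)

lemma cellAverage_even : cellAverage u L f (i + 1) (2 * k) = 2 * (2 : ℝ) ^ (L + i) *
    ∫ t in (u + k * (2 : ℝ) ^ (-(L + i)))..(u + k * (2 : ℝ) ^ (-(L + i)) +
      (2 : ℝ) ^ (-(L + i + 1))), f t := by
  have h := two_mul_two_zpow_neg_succ (L + i)
  unfold cellAverage
  congr 1
  · rw [show L + ((i + 1 : ℕ) : ℤ) = (L + i) + 1 by push_cast; ring,
      zpow_add_one₀ (by norm_num), mul_comm]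
  · rw [show L + ((i + 1 : ℕ) : ℤ) = (L + i) + 1 by push_cast; ring, ← h]
    congr 1 <;> push_cast <;> ring

lemma cellAverage_odd : cellAverage u L f (i + 1) (2 * k + 1) = 2 * (2 : ℝ) ^ (L + i) *
    ∫ t in (u + k * (2 : ℝ) ^ (-(L + i)) + (2 : ℝ) ^ (-(L + i + 1)))..(u +
      k * (2 : ℝ) ^ (-(L + i)) + 2 * (2 : ℝ) ^ (-(L + i + 1))), f t := by
  have h := two_mul_two_zpow_neg_succ (L + i)
  unfold cellAverage
  congr 1
  · rw [show L + ((i + 1 : ℕ) : ℤ) = (L + i) + 1 by push_cast; ring,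
      zpow_add_one₀ (by norm_num), mul_comm]
  · rw [show L + ((i + 1 : ℕ) : ℤ) = (L + i) + 1 by push_cast; ring, ← h]
    congr 1 <;> push_cast <;> ring

variable {f}

lemma cellAverage_eq_half (hf : Integrable f) : cellAverage u L f i k =
    (cellAverage u L f (i + 1) (2 * k) + cellAverage u L f (i + 1) (2 * k + 1)) / 2 := by
  rw [cellAverage_even, cellAverage_odd, ← mul_add,
    intervalIntegral.integral_add_adjacent_intervals hf.intervalIntegrable hf.intervalIntegrable,
    two_mul_two_zpow_neg_succ, cellAverage, mul_assoc, mul_div_cancel_left₀ _ (by norm_num)]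
  congr 2; ring

lemma cellOsc_eq : cellOsc u L f i k =
    |cellAverage u L f (i + 1) (2 * k) - cellAverage u L f (i + 1) (2 * k + 1)| / 2 := by
  rw [cellAverage_even, cellAverage_odd, ← mul_sub, abs_mul,
    abs_of_pos (by positivity), mul_assoc, mul_div_cancel_left₀ _ (by norm_num)]
  rfl

end Children

/-- The cells at one level tile the base interval. -/
lemma sum_integral_cell (u : ℝ) (L : ℤ) {f : ℝ → ℝ} (hf : Integrable f) (i : ℕ) :
    ∑ k ∈ Finset.range (2 ^ i),
      ∫ t in (u + k * (2 : ℝ) ^ (-(L + i)))..(u + (k + 1) * (2 : ℝ) ^ (-(L + i))), f t =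
    ∫ t in u..(u + (2 : ℝ) ^ (-L)), f t := by
  have h := intervalIntegral.sum_integral_adjacent_intervals (μ := volume) (f := f) (n := 2 ^ i)
    (a := fun k : ℕ => u + k * (2 : ℝ) ^ (-(L + i))) fun k _ => hf.intervalIntegrable
  push_cast at h
  rw [h, neg_add, zpow_add₀ (by norm_num)]
  congr 1
  · simp
  · rw [mul_comm ((2 : ℝ) ^ (-L)), ← mul_assoc, zpow_neg, zpow_natCast,
      mul_inv_cancel₀ (by positivity), one_mul]

lemma cell_subset (u : ℝ) (L : ℤ) {i k : ℕ} (hk : k < 2 ^ i) :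
    Set.Icc (u + k * (2 : ℝ) ^ (-(L + i))) (u + (k + 1) * (2 : ℝ) ^ (-(L + i))) ⊆
      Set.Icc u (u + (2 : ℝ) ^ (-L)) := by
  have h1 : ((k : ℝ) + 1) * (2 : ℝ) ^ (-(L + i)) ≤ (2 : ℝ) ^ (-L) := by
    have h2 : (k : ℝ) + 1 ≤ 2 ^ i := by exact_mod_cast hk
    calc ((k : ℝ) + 1) * (2 : ℝ) ^ (-(L + i)) ≤ 2 ^ i * (2 : ℝ) ^ (-(L + i)) := by gcongr
      _ = (2 : ℝ) ^ (-L) := by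
        rw [← zpow_natCast, ← zpow_add₀ (by norm_num)]; congr 1; ring
  have h3 : 0 ≤ (k : ℝ) * (2 : ℝ) ^ (-(L + i)) := by positivity
  exact Set.Icc_subset_Icc (by linarith) (by linarith)

namespace IsAtomSystem

variable {X : Set ℝ} {c α β : ℝ} {ψ : ℤ × ℤ → ℝ → ℝ}

/-- Every oscillation is bounded by the mass of the decay profile on the cell. -/
lemma cellOsc_le (h : IsAtomSystem X c α β ψ) (hβ : 0 < β) (u : ℝ) (L : ℤ) (i k : ℕ)
    (p : ℤ × ℤ) : cellOsc u L (ψ p) i k ≤ c * ((2 : ℝ) ^ (L + i) *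
      ∫ t in (u + k * (2 : ℝ) ^ (-(L + i)))..(u + (k + 1) * (2 : ℝ) ^ (-(L + i))),
        waveletDecay β ((2 : ℝ) ^ p.1 * t - p.2)) := by
  have hd := integrable_waveletDecay_dilate hβ p.1 p.2
  have hi := h.integrable hβ p
  unfold cellOsc
  rw [mul_left_comm]
  gcongr
  refine (abs_haarCoeff_le hi (by positivity)).2.trans ?_
  rw [two_mul_two_zpow_neg_succ, ← intervalIntegral.integral_const_mul]
  rw [show u + ((k : ℝ) + 1) * (2 : ℝ) ^ (-(L + i)) =
    u + k * (2 : ℝ) ^ (-(L + i)) + (2 : ℝ) ^ (-(L + i)) by ring]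
  refine intervalIntegral.integral_mono_on ?_ hi.abs.intervalIntegrable
    (hd.const_mul c).intervalIntegrable fun t _ => h.decay p t
  have : (0 : ℝ) < (2 : ℝ) ^ (-(L + i)) := by positivity
  linarith

/-- On cells finer than the scale of the atom, smoothness gives a gain. -/
lemma cellOsc_le_of_le (h : IsAtomSystem X c α β ψ) (hβ : 0 < β) {δ : ℝ} (hδ : 0 ≤ δ)
    (hδα : δ ≤ α) {u : ℝ} {L : ℤ} (hX : Set.Icc u (u + (2 : ℝ) ^ (-L)) ⊆ X) {i k : ℕ}
    (hk : k < 2 ^ i) (p : ℤ × ℤ) (hp : p.1 ≤ L + i) :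
    cellOsc u L (ψ p) i k ≤ c * ((2 : ℝ) ^ (-δ)) ^ (L + i - p.1).natAbs * ((2 : ℝ) ^ (L + i) *
      ∫ t in (u + k * (2 : ℝ) ^ (-(L + i)))..(u + (k + 1) * (2 : ℝ) ^ (-(L + i))),
        waveletDecay β ((2 : ℝ) ^ p.1 * t - p.2)) := by
  have hc := h.const_nonneg
  have hd := integrable_waveletDecay_dilate hβ p.1 p.2
  set N : ℤ := L + i with hN
  have hcell : u + ((k : ℝ) + 1) * (2 : ℝ) ^ (-N) =
    u + k * (2 : ℝ) ^ (-N) + 2 * (2 : ℝ) ^ (-(N + 1)) := by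
    rw [two_mul_two_zpow_neg_succ]; ring
  have hsub := (cell_subset u L hk).trans hX
  rw [← hN, hcell] at hsub
  have h1 := h.abs_haarCoeff_le_holder hβ p (v := u + k * (2 : ℝ) ^ (-N))
    (l := (2 : ℝ) ^ (-(N + 1))) (by positivity)
    (zpow_le_zpow_right₀ (by norm_num) (by omega)) hsub
  have h2 : ((2 : ℝ) ^ p.1 * (2 : ℝ) ^ (-(N + 1))) ^ α ≤
      ((2 : ℝ) ^ (-δ)) ^ (N - p.1).natAbs := by
    rw [← zpow_add₀ (by norm_num),
      show p.1 + -(N + 1) = -(((N - p.1).natAbs + 1 : ℕ) : ℤ) by omega]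
    refine (two_zpow_neg_rpow_le hδα _).trans ?_
    refine pow_le_pow_of_le_one (by positivity) ?_ (by omega)
    exact Real.rpow_le_one_of_one_le_of_nonpos (by norm_num) (by linarith)
  have h3 : 0 ≤ ∫ t in (u + k * (2 : ℝ) ^ (-N))..(u + k * (2 : ℝ) ^ (-N) +
      2 * (2 : ℝ) ^ (-(N + 1))), waveletDecay β ((2 : ℝ) ^ p.1 * t - p.2) := by
    refine intervalIntegral.integral_nonneg ?_ fun t _ => (waveletDecay_pos _ _).le
    have : (0 : ℝ) < (2 : ℝ) ^ (-(N + 1)) := by positivity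
    linarith
  rw [cellOsc, ← hN, hcell, mul_left_comm]
  gcongr
  refine h1.trans ?_
  gcongr

/-- The sum of the oscillations over all atoms of one level decays with the distance between that
level and the level of the cell. -/
lemma sum_cellOsc_le (h : IsAtomSystem X c α β ψ) (hβ : 0 < β) (hβ1 : β ≤ 1) {K : ℝ}
    (hK : IsDecayConst β K) (hK' : IsDecayConst (β / 2) K) {δ : ℝ} (hδ : 0 ≤ δ)
    (hδα : δ ≤ α) (hδβ : δ ≤ β / 4) {u : ℝ} {L : ℤ}
    (hX : Set.Icc u (u + (2 : ℝ) ^ (-L)) ⊆ X) {i k : ℕ} (hk : k < 2 ^ i) (n : ℤ) (F : Finset ℤ) :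
    ∑ j ∈ F, cellOsc u L (ψ (n, j)) i k ≤
      14 * c * K * ((2 : ℝ) ^ (-δ)) ^ (L + i - n).natAbs := by
  have hc := h.const_nonneg
  have hK0 : 0 ≤ K := by simpa using hK.sum_le 0 ∅
  set N : ℤ := L + i with hN
  set Q : ℝ := (2 : ℝ) ^ (-δ) with hQ
  have hQ0 : 0 < Q := by positivity
  have hpos : (0 : ℝ) < (2 : ℝ) ^ (-N) := by positivity
  rcases le_or_gt n N with hn | hn
  · have hd : ∀ j : ℤ, Integrable fun t => waveletDecay β ((2 : ℝ) ^ n * t - j) :=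
      fun j => integrable_waveletDecay_dilate hβ n j
    have hvw : u + k * (2 : ℝ) ^ (-N) ≤ u + (k + 1) * (2 : ℝ) ^ (-N) := by linarith
    calc ∑ j ∈ F, cellOsc u L (ψ (n, j)) i k
        ≤ ∑ j ∈ F, c * Q ^ (N - n).natAbs * ((2 : ℝ) ^ N *
          ∫ t in (u + k * (2 : ℝ) ^ (-N))..(u + (k + 1) * (2 : ℝ) ^ (-N)),
            waveletDecay β ((2 : ℝ) ^ n * t - j)) :=
          Finset.sum_le_sum fun j _ => h.cellOsc_le_of_le hβ hδ hδα hX hk (n, j) hn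
      _ = c * Q ^ (N - n).natAbs * ((2 : ℝ) ^ N *
          ∫ t in (u + k * (2 : ℝ) ^ (-N))..(u + (k + 1) * (2 : ℝ) ^ (-N)),
            ∑ j ∈ F, waveletDecay β ((2 : ℝ) ^ n * t - j)) := by
          rw [← Finset.mul_sum, ← Finset.mul_sum, intervalIntegral.integral_finsetSum]
          exact fun j _ => (hd j).intervalIntegrable
      _ ≤ c * Q ^ (N - n).natAbs * ((2 : ℝ) ^ N *
          ∫ t in (u + k * (2 : ℝ) ^ (-N))..(u + (k + 1) * (2 : ℝ) ^ (-N)), K) := by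
          gcongr
          refine intervalIntegral.integral_mono_on hvw
            (integrable_finsetSum _ fun j _ => hd j).intervalIntegrable (by simp) fun t _ =>
            hK.sum_le _ _
      _ = c * K * Q ^ (N - n).natAbs * ((2 : ℝ) ^ N * (2 : ℝ) ^ (-N)) := by
          rw [intervalIntegral.integral_const, smul_eq_mul]; ring
      _ ≤ _ := by
          rw [← zpow_add₀ (by norm_num), add_neg_cancel, zpow_zero, mul_one]
          have : 0 ≤ c * K * Q ^ (N - n).natAbs := by positivity
          linarith
  · -- points within `l s` of an endpoint of a half cell count as close to it; this `s` makes both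
    -- their proportion and the decay factor beyond that distance exponentially small in `n - N`
    obtain ⟨m, hm⟩ : ∃ m : ℕ, n = N + 1 + m := ⟨(n - N - 1).toNat, by omega⟩
    have hnat : (N - n).natAbs = m + 1 := by omega
    set l : ℝ := (2 : ℝ) ^ (-(N + 1)) with hl
    have hl0 : 0 < l := by positivity
    set s : ℝ := (2 : ℝ) ^ (-((m : ℝ) / 2)) with hs
    have hs0 : 0 < s := by positivity
    have hsQ : s ≤ Q ^ m := by
      rw [hs, hQ, ← Real.rpow_natCast, ← Real.rpow_mul (by norm_num)]
      refine Real.rpow_le_rpow_of_exponent_le (by norm_num) ?_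
      nlinarith [(Nat.cast_nonneg m : (0 : ℝ) ≤ m)]
    have hrl : (2 : ℝ) ^ n * (l * s) = (2 : ℝ) ^ ((m : ℝ) / 2) := by
      rw [← mul_assoc, hl, ← zpow_add₀ (by norm_num), hm,
        show N + 1 + (m : ℤ) + -(N + 1) = m by ring, zpow_natCast, hs, ← Real.rpow_natCast,
        ← Real.rpow_add (by norm_num)]
      congr 1; ring
    have hrQ : ((2 : ℝ) ^ n * (l * s)) ^ (-(β / 2)) ≤ Q ^ m := by
      rw [hrl, ← Real.rpow_mul (by norm_num), hQ, ← Real.rpow_natCast,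
        ← Real.rpow_mul (by norm_num)]
      refine Real.rpow_le_rpow_of_exponent_le (by norm_num) ?_
      nlinarith [(Nat.cast_nonneg m : (0 : ℝ) ≤ m)]
    have hln : (2 : ℝ) ^ (-n) ≤ l := zpow_le_zpow_right₀ (by norm_num) (by omega)
    have hhalf : ∀ v : ℝ, ∑ j ∈ F, |∫ t in v..(v + l), ψ (n, j) t| ≤ 7 * c * K * l * Q ^ m := by
      intro v
      refine (h.sum_abs_integral_le hβ hK hK' n F (by linarith)
        (by positivity : 0 < l * s)).trans ?_
      have hpos' : 0 ≤ 2 * (v + l - v) + (2 : ℝ) ^ (-n) := by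
        rw [add_sub_cancel_left]; positivity
      calc c * K * (4 * (l * s) + ((2 : ℝ) ^ n * (l * s)) ^ (-(β / 2)) *
            (2 * (v + l - v) + (2 : ℝ) ^ (-n)))
          ≤ c * K * (4 * (l * Q ^ m) + Q ^ m * (2 * (v + l - v) + l)) := by gcongr
        _ = _ := by ring
    have hQhalf : 1 ≤ 2 * Q := by
      have : (2 : ℝ) ^ (-1 : ℝ) ≤ Q :=
        Real.rpow_le_rpow_of_exponent_le (by norm_num) (by linarith)
      rw [Real.rpow_neg_one] at this
      linarith
    have h2l : (2 : ℝ) ^ N * l = 1 / 2 := by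
      rw [hl, ← zpow_add₀ (by norm_num)]
      rw [show N + -(N + 1) = -1 by ring]; norm_num
    calc ∑ j ∈ F, cellOsc u L (ψ (n, j)) i k
        ≤ ∑ j ∈ F, (2 : ℝ) ^ N * (|∫ t in (u + k * (2 : ℝ) ^ (-N))..(u + k * (2 : ℝ) ^ (-N) + l),
            ψ (n, j) t| + |∫ t in (u + k * (2 : ℝ) ^ (-N) + l)..(u + k * (2 : ℝ) ^ (-N) + l + l),
            ψ (n, j) t|) := by
          refine Finset.sum_le_sum fun j _ => ?_
          have := (abs_haarCoeff_le (h.integrable hβ (n, j)) hl0.le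
            (v := u + k * (2 : ℝ) ^ (-N))).1
          rw [show u + k * (2 : ℝ) ^ (-N) + 2 * l = u + k * (2 : ℝ) ^ (-N) + l + l by ring] at this
          exact mul_le_mul_of_nonneg_left this (by positivity)
      _ ≤ (2 : ℝ) ^ N * (7 * c * K * l * Q ^ m + 7 * c * K * l * Q ^ m) := by
          rw [← Finset.mul_sum, Finset.sum_add_distrib]
          exact mul_le_mul_of_nonneg_left (add_le_add (hhalf _) (hhalf _)) (by positivity)
      _ = ((2 : ℝ) ^ N * l) * (14 * c * K * Q ^ m) := by ring
      _ = 7 * c * K * Q ^ m := by rw [h2l]; ring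
      _ ≤ 7 * c * K * Q ^ m * (2 * Q) := le_mul_of_one_le_right (by positivity) hQhalf
      _ = _ := by rw [hnat, pow_succ]; ring

end IsAtomSystem

/-! ### A weighted Schur test -/

lemma schur_test {ι κ : Type*} (S : Finset ι) (G : Finset κ) (T : ι → κ → ℝ) (b u M : κ → ℝ)
    (v m : ι → ℝ) {R R' : ℝ} (hT : ∀ s ∈ S, ∀ p ∈ G, 0 ≤ T s p) (hm : ∀ s ∈ S, 0 ≤ m s)
    (hu : ∀ p ∈ G, 0 < u p) (hR : 0 ≤ R)
    (hrow : ∀ s ∈ S, ∑ p ∈ G, T s p * u p ≤ R * v s)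
    (hcol : ∀ p ∈ G, ∑ s ∈ S, m s * v s * T s p ≤ R' * M p * u p) :
    ∑ s ∈ S, m s * (∑ p ∈ G, b p * T s p) ^ 2 ≤ R * R' * ∑ p ∈ G, M p * b p ^ 2 := by
  have hone : ∀ s ∈ S, m s * (∑ p ∈ G, b p * T s p) ^ 2 ≤
      ∑ p ∈ G, R * (m s * v s * T s p) * (b p ^ 2 / u p) := by
    intro s hs
    have h1 : (∑ p ∈ G, b p * T s p) ^ 2 ≤
        (∑ p ∈ G, T s p * u p) * ∑ p ∈ G, T s p * (b p ^ 2 / u p) := by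
      refine Finset.sum_sq_le_sum_mul_sum_of_sq_le_mul _
        (fun p hp => mul_nonneg (hT s hs p hp) (hu p hp).le)
        (fun p hp => mul_nonneg (hT s hs p hp) (div_nonneg (sq_nonneg _) (hu p hp).le))
        fun p hp => ?_
      have := (hu p hp).ne'
      exact le_of_eq (by field_simp)
    have h2 : 0 ≤ ∑ p ∈ G, T s p * (b p ^ 2 / u p) := Finset.sum_nonneg fun p hp =>
      mul_nonneg (hT s hs p hp) (div_nonneg (sq_nonneg _) (hu p hp).le)
    calc m s * (∑ p ∈ G, b p * T s p) ^ 2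
        ≤ m s * ((R * v s) * ∑ p ∈ G, T s p * (b p ^ 2 / u p)) :=
          mul_le_mul_of_nonneg_left
            (h1.trans (mul_le_mul_of_nonneg_right (hrow s hs) h2)) (hm s hs)
      _ = _ := by
          rw [Finset.mul_sum, Finset.mul_sum]
          exact Finset.sum_congr rfl fun p _ => by ring
  calc ∑ s ∈ S, m s * (∑ p ∈ G, b p * T s p) ^ 2
      ≤ ∑ s ∈ S, ∑ p ∈ G, R * (m s * v s * T s p) * (b p ^ 2 / u p) := Finset.sum_le_sum hone
    _ = ∑ p ∈ G, R * (∑ s ∈ S, m s * v s * T s p) * (b p ^ 2 / u p) := by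
        rw [Finset.sum_comm]
        refine Finset.sum_congr rfl fun p _ => ?_
        rw [Finset.mul_sum, Finset.sum_mul]
    _ ≤ ∑ p ∈ G, R * (R' * M p * u p) * (b p ^ 2 / u p) := by
        refine Finset.sum_le_sum fun p hp => ?_
        have := hu p hp
        have := hcol p hp
        gcongr
    _ = _ := by
        rw [Finset.mul_sum]
        refine Finset.sum_congr rfl fun p hp => ?_
        have := (hu p hp).ne'
        field_simp

/-- Two-sided geometric sums are bounded uniformly in their centre. -/
lemma exists_sum_pow_natAbs_le {q : ℝ} (hq : 0 ≤ q) (hq1 : q < 1) :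
    ∃ g : ℝ, 0 ≤ g ∧ ∀ (N : ℤ) (F : Finset ℤ), ∑ n ∈ F, q ^ (N - n).natAbs ≤ g := by
  have hs : Summable fun m : ℤ => q ^ m.natAbs := by
    refine Summable.of_nat_of_neg ?_ ?_ <;> simpa using summable_geometric_of_lt_one hq hq1
  refine ⟨∑' m : ℤ, q ^ m.natAbs, tsum_nonneg fun m => by positivity, fun N F => ?_⟩
  have hs' : Summable fun n : ℤ => q ^ (N - n).natAbs := by
    have := (Equiv.subLeft N).summable_iff.2 hs
    exact this
  rw [← (Equiv.subLeft N).tsum_eq fun m : ℤ => q ^ m.natAbs]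
  exact hs'.sum_le_tsum F fun n _ => pow_nonneg hq _

namespace IsAtomSystem

variable {X : Set ℝ} {c α β : ℝ} {ψ : ℤ × ℤ → ℝ → ℝ}

/-- The square function: the oscillations of a linear combination of atoms over all
cells, estimated termwise in absolute value, are square summable with the natural bound. -/
theorem exists_sum_cellOsc_sq_le (h : IsAtomSystem X c α β ψ) (hα : 0 < α) (hβ : 0 < β)
    (hβ1 : β ≤ 1) : ∃ C : ℝ, 0 ≤ C ∧ ∀ (u : ℝ) (L : ℤ), Set.Icc u (u + (2 : ℝ) ^ (-L)) ⊆ X →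
      ∀ (I : ℕ) (G : Finset (ℤ × ℤ)) (b : ℤ × ℤ → ℝ),
      ∑ i ∈ Finset.range I, ∑ k ∈ Finset.range (2 ^ i), (2 : ℝ) ^ (-(L + i)) *
        (∑ p ∈ G, |b p| * cellOsc u L (ψ p) i k) ^ 2 ≤
      C * ∑ p ∈ G, (2 : ℝ) ^ (-p.1) * b p ^ 2 := by
  classical
  obtain ⟨K, hK1, hK, hK'⟩ := exists_isDecayConst hβ
  have hc := h.const_nonneg
  set δ : ℝ := min α (β / 4) with hδ
  have hδ0 : 0 < δ := lt_min hα (by positivity)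
  set q : ℝ := (2 : ℝ) ^ (-(δ / 2)) with hq
  have hq0 : 0 < q := by positivity
  have hq1 : q < 1 := Real.rpow_lt_one_of_one_lt_of_neg (by norm_num) (by linarith)
  have hQ : (2 : ℝ) ^ (-δ) = q ^ 2 := by
    rw [hq, ← Real.rpow_natCast, ← Real.rpow_mul (by norm_num)]; congr 1; push_cast; ring
  obtain ⟨g, hg0, hg⟩ := exists_sum_pow_natAbs_le hq0.le hq1
  refine ⟨(14 * c * K * g) * (c * K * g), by positivity, fun u L hX I G b => ?_⟩
  rw [Finset.sum_sigma']
  have hnat : ∀ a b : ℤ, q ^ (-b) = q ^ (-a) * q ^ (a - b) := fun a b => by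
    rw [← zpow_add₀ hq0.ne']; congr 1; ring
  have hzn : ∀ a b : ℤ, q ^ (a - b) * q ^ (2 * (a - b).natAbs) ≤ q ^ (a - b).natAbs := by
    intro a b
    rw [← zpow_natCast q, ← zpow_natCast q, ← zpow_add₀ hq0.ne']
    refine zpow_le_zpow_right_of_le_one₀ hq0 hq1.le ?_
    push_cast; have := neg_abs_le (a - b); omega
  -- The weights `q ^ (-n)` give away half of the decay `q ^ (2 |n - N|)` of the rows and in return
  -- produce decay in the columns, where coarse cells alone have none.
  have key := schur_test ((Finset.range I).sigma fun i => Finset.range (2 ^ i)) G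
    (fun s p => cellOsc u L (ψ p) s.1 s.2) (fun p => |b p|) (fun p => q ^ (-p.1))
    (fun p => (2 : ℝ) ^ (-p.1)) (fun s => q ^ (-(L + (s.1 : ℤ))))
    (fun s => (2 : ℝ) ^ (-(L + (s.1 : ℤ)))) (R := 14 * c * K * g) (R' := c * K * g)
    (fun s _ p _ => cellOsc_nonneg _ _ _ _ _) (fun s _ => by positivity)
    (fun p _ => by positivity) (by positivity) ?_ ?_
  · simpa only [sq_abs] using key
  · rintro ⟨i, k⟩ hs
    have hk : k < 2 ^ i := by simpa using (Finset.mem_sigma.1 hs).2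
    simp only
    have hsub : G ⊆ (G.image Prod.fst) ×ˢ (G.image Prod.snd) := fun p hp =>
      Finset.mem_product.2 ⟨Finset.mem_image_of_mem _ hp, Finset.mem_image_of_mem _ hp⟩
    calc ∑ p ∈ G, cellOsc u L (ψ p) i k * q ^ (-p.1)
        ≤ ∑ p ∈ (G.image Prod.fst) ×ˢ (G.image Prod.snd), cellOsc u L (ψ p) i k * q ^ (-p.1) :=
          Finset.sum_le_sum_of_subset_of_nonneg hsub fun p _ _ =>
            mul_nonneg (cellOsc_nonneg _ _ _ _ _) (by positivity)
      _ = ∑ n ∈ G.image Prod.fst, (∑ j ∈ G.image Prod.snd, cellOsc u L (ψ (n, j)) i k) *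
            q ^ (-n) := by
          rw [Finset.sum_product]
          exact Finset.sum_congr rfl fun n _ => by rw [Finset.sum_mul]
      _ ≤ ∑ n ∈ G.image Prod.fst, 14 * c * K * q ^ (2 * (L + i - n).natAbs) * q ^ (-n) := by
          refine Finset.sum_le_sum fun n _ => ?_
          have := h.sum_cellOsc_le hβ hβ1 hK hK' hδ0.le (min_le_left _ _) (min_le_right _ _) hX hk
            n (G.image Prod.snd)
          rw [hQ, ← pow_mul] at this
          gcongr
      _ ≤ ∑ n ∈ G.image Prod.fst, 14 * c * K * q ^ (-(L + i : ℤ)) * q ^ (L + i - n).natAbs := by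
          refine Finset.sum_le_sum fun n _ => ?_
          rw [hnat (L + i) n]
          calc 14 * c * K * q ^ (2 * (L + i - n).natAbs) *
                (q ^ (-(L + i : ℤ)) * q ^ ((L + i : ℤ) - n))
              = 14 * c * K * q ^ (-(L + i : ℤ)) *
                (q ^ ((L + i : ℤ) - n) * q ^ (2 * (L + i - n).natAbs)) := by ring
            _ ≤ _ := by gcongr; exact hzn _ _
      _ = 14 * c * K * q ^ (-(L + i : ℤ)) * ∑ n ∈ G.image Prod.fst, q ^ (L + i - n).natAbs := by
          rw [Finset.mul_sum]
      _ ≤ 14 * c * K * q ^ (-(L + i : ℤ)) * g := by gcongr; exact hg _ _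
      _ = _ := by ring
  · intro p _
    have hd := integrable_waveletDecay_dilate hβ p.1 p.2
    rw [Finset.sum_sigma]
    simp only
    have hlev : ∀ i : ℕ, ∑ k ∈ Finset.range (2 ^ i), (2 : ℝ) ^ (-(L + i : ℤ)) *
        q ^ (-(L + i : ℤ)) * cellOsc u L (ψ p) i k ≤
        c * K * (2 : ℝ) ^ (-p.1) * q ^ (-p.1) * q ^ (L + i - p.1).natAbs := by
      intro i
      set w : ℕ := if p.1 ≤ L + i then (L + i - p.1).natAbs else 0 with hw
      have h1 : ∀ k ∈ Finset.range (2 ^ i), cellOsc u L (ψ p) i k ≤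
          c * q ^ (2 * w) * ((2 : ℝ) ^ (L + i) *
          ∫ t in (u + k * (2 : ℝ) ^ (-(L + i)))..(u + (k + 1) * (2 : ℝ) ^ (-(L + i))),
          waveletDecay β ((2 : ℝ) ^ p.1 * t - p.2)) := by
        intro k hk
        rw [hw]
        split_ifs with hp
        · have := h.cellOsc_le_of_le hβ hδ0.le (min_le_left _ _) hX (Finset.mem_range.1 hk) p hp
          rwa [hQ, ← pow_mul] at this
        · simpa using h.cellOsc_le hβ u L i k p
      have h2 : ∫ t in u..(u + (2 : ℝ) ^ (-L)), waveletDecay β ((2 : ℝ) ^ p.1 * t - p.2) ≤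
          K * (2 : ℝ) ^ (-p.1) := by
        rw [intervalIntegral.integral_of_le (by
          have : (0 : ℝ) < (2 : ℝ) ^ (-L) := by positivity
          linarith)]
        exact (setIntegral_le_integral hd (ae_of_all _ fun t => (waveletDecay_pos _ _).le)).trans
          (hK.integral_dilate_le _ _)
      have h3 : q ^ (-(L + i : ℤ)) * q ^ (2 * w) ≤ q ^ (-p.1) * q ^ (L + i - p.1).natAbs := by
        rw [← zpow_natCast q, ← zpow_natCast q, ← zpow_add₀ hq0.ne', ← zpow_add₀ hq0.ne']
        refine zpow_le_zpow_right_of_le_one₀ hq0 hq1.le ?_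
        clear_value w
        split_ifs at hw <;> omega
      calc ∑ k ∈ Finset.range (2 ^ i), (2 : ℝ) ^ (-(L + i : ℤ)) *
            q ^ (-(L + i : ℤ)) * cellOsc u L (ψ p) i k
          ≤ ∑ k ∈ Finset.range (2 ^ i), (2 : ℝ) ^ (-(L + i : ℤ)) * q ^ (-(L + i : ℤ)) *
            (c * q ^ (2 * w) * ((2 : ℝ) ^ (L + i : ℤ) *
            ∫ t in (u + k * (2 : ℝ) ^ (-(L + i : ℤ)))..(u + (k + 1) * (2 : ℝ) ^ (-(L + i : ℤ))),
            waveletDecay β ((2 : ℝ) ^ p.1 * t - p.2))) := by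
            refine Finset.sum_le_sum fun k hk => ?_
            exact mul_le_mul_of_nonneg_left (h1 k hk) (by positivity)
        _ = ((2 : ℝ) ^ (-(L + i : ℤ)) * (2 : ℝ) ^ (L + i : ℤ)) * c *
            (q ^ (-(L + i : ℤ)) * q ^ (2 * w)) *
            ∫ t in u..(u + (2 : ℝ) ^ (-L)), waveletDecay β ((2 : ℝ) ^ p.1 * t - p.2) := by
            rw [← sum_integral_cell u L hd i, Finset.mul_sum]
            exact Finset.sum_congr rfl fun k _ => by ring
        _ = c * (q ^ (-(L + i : ℤ)) * q ^ (2 * w)) *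
            ∫ t in u..(u + (2 : ℝ) ^ (-L)), waveletDecay β ((2 : ℝ) ^ p.1 * t - p.2) := by
            rw [← zpow_add₀ (by norm_num)]; simp
        _ ≤ c * (q ^ (-p.1) * q ^ (L + i - p.1).natAbs) * (K * (2 : ℝ) ^ (-p.1)) := by
            refine mul_le_mul (by gcongr) h2 ?_ (by positivity)
            refine intervalIntegral.integral_nonneg ?_ fun t _ => (waveletDecay_pos _ _).le
            have : (0 : ℝ) < (2 : ℝ) ^ (-L) := by positivity
            linarith
        _ = _ := by ring
    calc ∑ i ∈ Finset.range I, ∑ k ∈ Finset.range (2 ^ i), (2 : ℝ) ^ (-(L + i : ℤ)) *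
          q ^ (-(L + i : ℤ)) * cellOsc u L (ψ p) i k
        ≤ ∑ i ∈ Finset.range I, c * K * (2 : ℝ) ^ (-p.1) * q ^ (-p.1) *
          q ^ (L + i - p.1).natAbs := Finset.sum_le_sum fun i _ => hlev i
      _ = c * K * (2 : ℝ) ^ (-p.1) * q ^ (-p.1) *
          ∑ n ∈ (Finset.range I).image (fun i : ℕ => L + (i : ℤ)), q ^ (p.1 - n).natAbs := by
          rw [Finset.sum_image (fun a _ b _ hab => by simpa using hab), Finset.mul_sum]
          refine Finset.sum_congr rfl fun i _ => ?_
          rw [← Int.natAbs_neg, neg_sub]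
      _ ≤ c * K * (2 : ℝ) ^ (-p.1) * q ^ (-p.1) * g := by gcongr; exact hg _ _
      _ = _ := by ring

end IsAtomSystem

/-! ### Subgaussian tails on the dyadic tree -/

/-- The sum of the squares of the increment bounds `d` along the path from the root to the node
`(i, k)` of the binary tree. -/
noncomputable def pathVariance (d : ℕ → ℕ → ℝ) : ℕ → ℕ → ℝ
  | 0, _ => 0
  | i + 1, k => pathVariance d i (k / 2) + d i (k / 2) ^ 2

lemma sum_range_two_pow_succ (g : ℕ → ℝ) (i : ℕ) : ∑ k ∈ Finset.range (2 ^ (i + 1)), g k =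
    ∑ k ∈ Finset.range (2 ^ i), (g (2 * k) + g (2 * k + 1)) := by
  have h : ∀ m : ℕ, ∑ k ∈ Finset.range (2 * m), g k =
      ∑ k ∈ Finset.range m, (g (2 * k) + g (2 * k + 1)) := by
    intro m
    induction m with
    | zero => simp
    | succ m ih =>
      rw [show 2 * (m + 1) = 2 * m + 1 + 1 by ring, Finset.sum_range_succ, Finset.sum_range_succ,
        ih, Finset.sum_range_succ, add_assoc]
  rw [pow_succ, mul_comm, h]

lemma pathVariance_even (d : ℕ → ℕ → ℝ) (i k : ℕ) :
    pathVariance d (i + 1) (2 * k) = pathVariance d i k + d i k ^ 2 := by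
  rw [pathVariance, show 2 * k / 2 = k by omega]

lemma pathVariance_odd (d : ℕ → ℕ → ℝ) (i k : ℕ) :
    pathVariance d (i + 1) (2 * k + 1) = pathVariance d i k + d i k ^ 2 := by
  rw [pathVariance, show (2 * k + 1) / 2 = k by omega]

lemma pathVariance_nonneg (d : ℕ → ℕ → ℝ) (i k : ℕ) : 0 ≤ pathVariance d i k := by
  induction i generalizing k with
  | zero => exact le_rfl
  | succ i ih => exact add_nonneg (ih _) (sq_nonneg _)

lemma sum_pathVariance (d : ℕ → ℕ → ℝ) (I : ℕ) :
    ∑ k ∈ Finset.range (2 ^ I), pathVariance d I k = 2 ^ I *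
      ∑ i ∈ Finset.range I, ((2 : ℝ) ^ i)⁻¹ * ∑ k ∈ Finset.range (2 ^ i), d i k ^ 2 := by
  induction I with
  | zero => simp [pathVariance]
  | succ I ih =>
    rw [sum_range_two_pow_succ, Finset.sum_range_succ, mul_add]
    simp only [pathVariance_even, pathVariance_odd]
    rw [Finset.sum_add_distrib, Finset.sum_add_distrib, ih, pow_succ]
    field_simp
    ring

/-- The exponential supermartingale inequality for a dyadic martingale `e` whose increments are
bounded by `d`. -/
lemma sum_exp_le {e d : ℕ → ℕ → ℝ}
    (he : ∀ i k, e i k = (e (i + 1) (2 * k) + e (i + 1) (2 * k + 1)) / 2)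
    (hd : ∀ i k, |e (i + 1) (2 * k) - e (i + 1) (2 * k + 1)| / 2 ≤ d i k) (s : ℝ) (I : ℕ) :
    ∑ k ∈ Finset.range (2 ^ I), Real.exp (s * e I k - s ^ 2 / 2 * pathVariance d I k) ≤
      2 ^ I * Real.exp (s * e 0 0) := by
  induction I with
  | zero => simp [pathVariance]
  | succ I ih =>
    rw [sum_range_two_pow_succ]
    have hstep : ∀ k, Real.exp (s * e (I + 1) (2 * k) -
          s ^ 2 / 2 * pathVariance d (I + 1) (2 * k)) +
        Real.exp (s * e (I + 1) (2 * k + 1) - s ^ 2 / 2 * pathVariance d (I + 1) (2 * k + 1)) ≤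
        2 * Real.exp (s * e I k - s ^ 2 / 2 * pathVariance d I k) := by
      intro k
      rw [pathVariance_even, pathVariance_odd]
      set δ := (e (I + 1) (2 * k) - e (I + 1) (2 * k + 1)) / 2 with hδ
      have h1 : e (I + 1) (2 * k) = e I k + δ := by rw [he I k, hδ]; ring
      have h2 : e (I + 1) (2 * k + 1) = e I k - δ := by rw [he I k, hδ]; ring
      have h3 : δ ^ 2 ≤ d I k ^ 2 := by
        refine sq_le_sq' ?_ ?_
        · have := neg_abs_le (e (I + 1) (2 * k) - e (I + 1) (2 * k + 1))
          have := hd I k; linarith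
        · have := le_abs_self (e (I + 1) (2 * k) - e (I + 1) (2 * k + 1))
          have := hd I k; linarith
      have h4 : Real.exp (s * δ) + Real.exp (-(s * δ)) ≤ 2 * Real.exp (s ^ 2 / 2 * d I k ^ 2) := by
        have h5 := Real.cosh_le_exp_half_sq (s * δ)
        rw [Real.cosh_eq] at h5
        have h6 : Real.exp ((s * δ) ^ 2 / 2) ≤ Real.exp (s ^ 2 / 2 * d I k ^ 2) := by
          apply Real.exp_le_exp.2
          have := mul_le_mul_of_nonneg_left h3 (sq_nonneg s)
          nlinarith
        linarith
      rw [h1, h2]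
      set V := pathVariance d I k
      have e1 : Real.exp (s * (e I k + δ) - s ^ 2 / 2 * (V + d I k ^ 2)) =
          Real.exp (s * e I k - s ^ 2 / 2 * V) * Real.exp (-(s ^ 2 / 2 * d I k ^ 2)) *
            Real.exp (s * δ) := by
        rw [← Real.exp_add, ← Real.exp_add]; congr 1; ring
      have e2 : Real.exp (s * (e I k - δ) - s ^ 2 / 2 * (V + d I k ^ 2)) =
          Real.exp (s * e I k - s ^ 2 / 2 * V) * Real.exp (-(s ^ 2 / 2 * d I k ^ 2)) *
            Real.exp (-(s * δ)) := by
        rw [← Real.exp_add, ← Real.exp_add]; congr 1; ring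
      rw [e1, e2, ← mul_add]
      calc _ ≤ Real.exp (s * e I k - s ^ 2 / 2 * V) * Real.exp (-(s ^ 2 / 2 * d I k ^ 2)) *
            (2 * Real.exp (s ^ 2 / 2 * d I k ^ 2)) := by gcongr
        _ = 2 * Real.exp (s * e I k - s ^ 2 / 2 * V) *
            (Real.exp (-(s ^ 2 / 2 * d I k ^ 2)) * Real.exp (s ^ 2 / 2 * d I k ^ 2)) := by ring
        _ = _ := by rw [← Real.exp_add]; simp
    calc _ ≤ ∑ k ∈ Finset.range (2 ^ I),
          2 * Real.exp (s * e I k - s ^ 2 / 2 * pathVariance d I k) :=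
          Finset.sum_le_sum fun k _ => hstep k
      _ ≤ 2 * (2 ^ I * Real.exp (s * e 0 0)) := by rw [← Finset.mul_sum]; gcongr
      _ = _ := by rw [pow_succ]; ring

lemma card_large_le_one_sided {e d : ℕ → ℕ → ℝ}
    (he : ∀ i k, e i k = (e (i + 1) (2 * k) + e (i + 1) (2 * k + 1)) / 2)
    (hd : ∀ i k, |e (i + 1) (2 * k) - e (i + 1) (2 * k + 1)| / 2 ≤ d i k) {lam V : ℝ}
    (hlam : 0 < lam) (hV : 0 < V) (h0 : e 0 0 ≤ lam) (I : ℕ) :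
    (((Finset.range (2 ^ I)).filter fun k => 2 * lam < e I k ∧ pathVariance d I k ≤ V).card : ℝ) ≤
      2 ^ I * Real.exp (-(lam ^ 2 / (2 * V))) := by
  set s : ℝ := lam / V with hs
  have hs0 : 0 < s := by positivity
  set B := (Finset.range (2 ^ I)).filter fun k => 2 * lam < e I k ∧ pathVariance d I k ≤ V with hB
  have h1 : (B.card : ℝ) * Real.exp (s * (2 * lam) - s ^ 2 / 2 * V) ≤
      2 ^ I * Real.exp (s * lam) := by
    calc (B.card : ℝ) * Real.exp (s * (2 * lam) - s ^ 2 / 2 * V)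
        = ∑ k ∈ B, Real.exp (s * (2 * lam) - s ^ 2 / 2 * V) := by simp
      _ ≤ ∑ k ∈ B, Real.exp (s * e I k - s ^ 2 / 2 * pathVariance d I k) := by
          refine Finset.sum_le_sum fun k hk => Real.exp_le_exp.2 ?_
          have hk := (Finset.mem_filter.1 hk).2
          exact sub_le_sub (mul_le_mul_of_nonneg_left hk.1.le hs0.le)
            (mul_le_mul_of_nonneg_left hk.2 (by positivity))
      _ ≤ ∑ k ∈ Finset.range (2 ^ I), Real.exp (s * e I k - s ^ 2 / 2 * pathVariance d I k) :=
          Finset.sum_le_sum_of_subset_of_nonneg (Finset.filter_subset _ _)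
            fun _ _ _ => (Real.exp_pos _).le
      _ ≤ 2 ^ I * Real.exp (s * e 0 0) := sum_exp_le he hd s I
      _ ≤ _ := by gcongr
  have h2 : s * lam - (s * (2 * lam) - s ^ 2 / 2 * V) = -(lam ^ 2 / (2 * V)) := by
    rw [hs]; field_simp; ring
  rw [← h2, Real.exp_sub, ← mul_div_assoc, le_div_iff₀ (Real.exp_pos _)]
  exact h1

lemma card_large_le {e d : ℕ → ℕ → ℝ}
    (he : ∀ i k, e i k = (e (i + 1) (2 * k) + e (i + 1) (2 * k + 1)) / 2)
    (hd : ∀ i k, |e (i + 1) (2 * k) - e (i + 1) (2 * k + 1)| / 2 ≤ d i k) {lam V : ℝ}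
    (hlam : 0 < lam) (hV : 0 < V) (h0 : |e 0 0| ≤ lam) (I : ℕ) :
    (((Finset.range (2 ^ I)).filter fun k => 2 * lam < |e I k| ∧ pathVariance d I k ≤ V).card : ℝ)
      ≤ 2 * 2 ^ I * Real.exp (-(lam ^ 2 / (2 * V))) := by
  classical
  have h1 := card_large_le_one_sided he hd hlam hV ((le_abs_self _).trans h0) I
  have h2 := card_large_le_one_sided (e := fun i k => -e i k) (d := d)
    (fun i k => by rw [he i k]; ring)
    (fun i k => by
      have : -e (i + 1) (2 * k) - -e (i + 1) (2 * k + 1) =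
        -(e (i + 1) (2 * k) - e (i + 1) (2 * k + 1)) := by ring
      rw [this, abs_neg]; exact hd i k) hlam hV ((neg_le_abs _).trans h0) I
  have h3 : ((Finset.range (2 ^ I)).filter fun k => 2 * lam < |e I k| ∧ pathVariance d I k ≤ V) ⊆
      ((Finset.range (2 ^ I)).filter fun k => 2 * lam < e I k ∧ pathVariance d I k ≤ V) ∪
      ((Finset.range (2 ^ I)).filter fun k => 2 * lam < -e I k ∧ pathVariance d I k ≤ V) := by
    intro k hk
    simp only [Finset.mem_filter, Finset.mem_union] at hk ⊢
    rcases lt_abs.1 hk.2.1 with h | h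
    · exact Or.inl ⟨hk.1, h, hk.2.2⟩
    · exact Or.inr ⟨hk.1, h, hk.2.2⟩
  have h4 : (((Finset.range (2 ^ I)).filter fun k =>
      2 * lam < |e I k| ∧ pathVariance d I k ≤ V).card : ℝ) ≤ _ :=
    Nat.cast_le.2 ((Finset.card_le_card h3).trans (Finset.card_union_le _ _))
  push_cast at h4
  linarith

/-! ### The maximal inequality for finitely many subsums -/

lemma cellAverage_sum (u : ℝ) (L : ℤ) {ψ : ℤ × ℤ → ℝ → ℝ} (hψ : ∀ p, Integrable (ψ p))
    (s : Finset (ℤ × ℤ)) (b : ℤ × ℤ → ℝ) (i k : ℕ) :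
    cellAverage u L (fun t => ∑ p ∈ s, b p * ψ p t) i k =
      ∑ p ∈ s, b p * cellAverage u L (ψ p) i k := by
  unfold cellAverage
  rw [intervalIntegral.integral_finsetSum fun p _ => ((hψ p).const_mul _).intervalIntegrable,
    Finset.mul_sum]
  refine Finset.sum_congr rfl fun p _ => ?_
  rw [intervalIntegral.integral_const_mul]; ring

lemma exists_cell (u : ℝ) (L : ℤ) {x : ℝ} (hx : x ∈ Set.Ico u (u + (2 : ℝ) ^ (-L))) (I : ℕ) :
    ∃ k : ℕ, k < 2 ^ I ∧ x ∈ Set.Icc (u + k * (2 : ℝ) ^ (-(L + I))) (u + (k + 1) * (2 : ℝ) ^ (-(L + I))) := by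
  have hpos : (0 : ℝ) < (2 : ℝ) ^ (-(L + (I : ℤ))) := by positivity
  have hy0 : 0 ≤ (x - u) / (2 : ℝ) ^ (-(L + (I : ℤ))) := div_nonneg (by linarith [hx.1]) hpos.le
  refine ⟨⌊(x - u) / (2 : ℝ) ^ (-(L + (I : ℤ)))⌋₊, ?_, ?_, ?_⟩
  · rw [Nat.floor_lt hy0, div_lt_iff₀ hpos]
    have : ((2 ^ I : ℕ) : ℝ) * (2 : ℝ) ^ (-(L + (I : ℤ))) = (2 : ℝ) ^ (-L) := by
      push_cast
      rw [← zpow_natCast, ← zpow_add₀ (by norm_num)]; congr 1; ring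
    rw [this]; linarith [hx.2]
  · have := Nat.floor_le hy0
    rw [le_div_iff₀ hpos] at this
    linarith
  · have := Nat.lt_floor_add_one ((x - u) / (2 : ℝ) ^ (-(L + (I : ℤ))))
    rw [div_lt_iff₀ hpos] at this
    linarith

lemma abs_sub_cellAverage_le (u : ℝ) (L : ℤ) {f : ℝ → ℝ} (hf : Integrable f) {i k : ℕ} {x η : ℝ}
    (hη : ∀ t ∈ Set.Icc (u + k * (2 : ℝ) ^ (-(L + i))) (u + (k + 1) * (2 : ℝ) ^ (-(L + i))),
      |f t - f x| ≤ η) : |cellAverage u L f i k - f x| ≤ η := by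
  have hpos : (0 : ℝ) < (2 : ℝ) ^ (-(L + (i : ℤ))) := by positivity
  have hlen : u + ((k : ℝ) + 1) * (2 : ℝ) ^ (-(L + (i : ℤ))) -
    (u + k * (2 : ℝ) ^ (-(L + (i : ℤ)))) = (2 : ℝ) ^ (-(L + (i : ℤ))) := by ring
  have hone : (2 : ℝ) ^ (L + (i : ℤ)) * (2 : ℝ) ^ (-(L + (i : ℤ))) = 1 := by
    rw [← zpow_add₀ (by norm_num)]; simp
  have h1 : cellAverage u L f i k - f x = (2 : ℝ) ^ (L + (i : ℤ)) *
      ∫ t in (u + k * (2 : ℝ) ^ (-(L + i)))..(u + (k + 1) * (2 : ℝ) ^ (-(L + i))), (f t - f x) := by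
    rw [intervalIntegral.integral_sub hf.intervalIntegrable (by simp),
      intervalIntegral.integral_const, hlen, smul_eq_mul, mul_sub, ← mul_assoc, hone, one_mul]
    rfl
  rw [h1, abs_mul, abs_of_pos (by positivity)]
  have h2 := intervalIntegral.norm_integral_le_of_norm_le_const (f := fun t => f t - f x) (C := η)
    (a := u + k * (2 : ℝ) ^ (-(L + (i : ℤ)))) (b := u + (k + 1) * (2 : ℝ) ^ (-(L + (i : ℤ))))
    (fun t ht => hη t (by
      rw [Set.uIoc_of_le (by linarith)] at ht
      exact Set.Ioc_subset_Icc_self ht))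
  rw [hlen, abs_of_pos hpos] at h2
  calc _ ≤ (2 : ℝ) ^ (L + (i : ℤ)) * (η * (2 : ℝ) ^ (-(L + (i : ℤ)))) := by
        gcongr; exact h2
    _ = η * ((2 : ℝ) ^ (L + (i : ℤ)) * (2 : ℝ) ^ (-(L + (i : ℤ)))) := by ring
    _ = η := by rw [hone, mul_one]

namespace IsAtomSystem

variable {X : Set ℝ} {c α β : ℝ} {ψ : ℤ × ℤ → ℝ → ℝ}

/-- Finite sums of atoms are uniformly close to their averages over sufficiently small cells. -/
lemma exists_level_cellAverage_close (h : IsAtomSystem X c α β ψ) (hα : 0 < α) (hβ : 0 < β)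
    {u : ℝ} {L : ℤ} (hX : Set.Icc u (u + (2 : ℝ) ^ (-L)) ⊆ X) (G : Finset (ℤ × ℤ))
    (b : ℤ × ℤ → ℝ) {lam : ℝ} (hlam : 0 < lam) :
    ∃ I : ℕ, ∀ s ⊆ G, ∀ k : ℕ, k < 2 ^ I → ∀ x ∈ Set.Icc (u + k * (2 : ℝ) ^ (-(L + I)))
      (u + (k + 1) * (2 : ℝ) ^ (-(L + I))),
      |cellAverage u L (fun t => ∑ p ∈ s, b p * ψ p t) I k - ∑ p ∈ s, b p * ψ p x| ≤ lam := by
  have hc := h.const_nonneg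
  have hlim : Tendsto (fun I : ℕ => ∑ p ∈ G, |b p| *
      (c * ((2 : ℝ) ^ p.1 * (2 : ℝ) ^ (-(L + (I : ℤ)))) ^ α)) atTop (𝓝 0) := by
    rw [show (0 : ℝ) = ∑ _p ∈ G, (0 : ℝ) by simp]
    refine tendsto_finsetSum _ fun p _ => ?_
    have h1 : Tendsto (fun I : ℕ => (2 : ℝ) ^ p.1 * (2 : ℝ) ^ (-(L + (I : ℤ)))) atTop (𝓝 0) := by
      have h2 : ∀ I : ℕ, (2 : ℝ) ^ p.1 * (2 : ℝ) ^ (-(L + (I : ℤ))) =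
          (2 : ℝ) ^ (p.1 - L) * (1 / 2) ^ I := by
        intro I
        rw [← zpow_add₀ (by norm_num), show p.1 + -(L + (I : ℤ)) = (p.1 - L) + -(I : ℤ) by ring,
          zpow_add₀ (by norm_num), zpow_neg, zpow_natCast, one_div, inv_pow]
      simp only [h2]
      simpa using (tendsto_pow_atTop_nhds_zero_of_lt_one (by norm_num : (0 : ℝ) ≤ 1 / 2)
        (by norm_num)).const_mul ((2 : ℝ) ^ (p.1 - L))
    have h3 := h1.rpow_const (p := α) (Or.inr hα.le)
    rw [Real.zero_rpow hα.ne'] at h3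
    simpa using (h3.const_mul c).const_mul |b p|
  have hev1 : ∀ᶠ I : ℕ in atTop, ∑ p ∈ G, |b p| *
      (c * ((2 : ℝ) ^ p.1 * (2 : ℝ) ^ (-(L + (I : ℤ)))) ^ α) < lam :=
    hlim.eventually (gt_mem_nhds hlam)
  have hev2 : ∀ᶠ I : ℕ in atTop, ∀ p ∈ G, p.1 ≤ L + (I : ℤ) := by
    rw [Filter.eventually_all_finset]
    intro p _
    filter_upwards [eventually_ge_atTop (p.1 - L).toNat] with I hI
    omega
  obtain ⟨I, hI1, hI2⟩ := (hev1.and hev2).exists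
  refine ⟨I, fun s hs k hk x hx => ?_⟩
  have hsub := (cell_subset u L hk).trans hX
  rw [cellAverage_sum u L (h.integrable hβ), ← Finset.sum_sub_distrib]
  refine (Finset.abs_sum_le_sum_abs _ _).trans ?_
  have hone : ∀ p ∈ G, |b p * cellAverage u L (ψ p) I k - b p * ψ p x| ≤
      |b p| * (c * ((2 : ℝ) ^ p.1 * (2 : ℝ) ^ (-(L + (I : ℤ)))) ^ α) := by
    intro p hp
    rw [← mul_sub, abs_mul]
    gcongr
    refine abs_sub_cellAverage_le u L (h.integrable hβ p) fun t ht => ?_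
    have hdist : |t - x| ≤ (2 : ℝ) ^ (-(L + (I : ℤ))) := by
      rw [abs_le]; constructor <;> linarith [ht.1, ht.2, hx.1, hx.2]
    refine (h.holder p t (hsub ht) x (hsub hx) (hdist.trans
      (zpow_le_zpow_right₀ (by norm_num) (by have := hI2 p hp; omega)))).trans ?_
    have hle1 : waveletDecay β ((2 : ℝ) ^ p.1 * t - p.2) ≤ 1 := by
      unfold waveletDecay
      rw [div_le_one (by positivity)]
      exact Real.one_le_rpow (by linarith [abs_nonneg ((2 : ℝ) ^ p.1 * t - p.2)]) (by linarith)
    have hle0 := (waveletDecay_pos β ((2 : ℝ) ^ p.1 * t - p.2)).le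
    calc _ ≤ c * ((2 : ℝ) ^ p.1 * (2 : ℝ) ^ (-(L + (I : ℤ)))) ^ α * 1 := by
          gcongr
      _ = _ := mul_one _
  calc _ ≤ ∑ p ∈ s, |b p| * (c * ((2 : ℝ) ^ p.1 * (2 : ℝ) ^ (-(L + (I : ℤ)))) ^ α) :=
        Finset.sum_le_sum fun p hp => hone p (hs hp)
    _ ≤ ∑ p ∈ G, |b p| * (c * ((2 : ℝ) ^ p.1 * (2 : ℝ) ^ (-(L + (I : ℤ)))) ^ α) :=
        Finset.sum_le_sum_of_subset_of_nonneg hs fun p _ _ => by positivity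
    _ ≤ lam := hI1.le

/-- A family `R` of subsums of one linear combination of atoms: outside the set where the common
square function exceeds `√V`, every subsum has subgaussian tails, and a union bound over `R` costs
only a factor in front of the exponential. -/
theorem exists_measure_max_le (h : IsAtomSystem X c α β ψ) (hα : 0 < α) (hβ : 0 < β)
    (hβ1 : β ≤ 1) : ∃ C : ℝ, 0 ≤ C ∧ ∀ (u : ℝ) (L : ℤ), Set.Icc u (u + (2 : ℝ) ^ (-L)) ⊆ X →
      ∀ (G : Finset (ℤ × ℤ)) (b : ℤ × ℤ → ℝ) (R : Finset (Finset (ℤ × ℤ))) (lam V : ℝ),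
      (∀ s ∈ R, s ⊆ G) → 0 < lam → 0 < V →
      (∀ s ∈ R, |cellAverage u L (fun t => ∑ p ∈ s, b p * ψ p t) 0 0| ≤ lam) →
      volume {x ∈ Set.Ico u (u + (2 : ℝ) ^ (-L)) | ∃ s ∈ R, 3 * lam < |∑ p ∈ s, b p * ψ p x|} ≤
        ENNReal.ofReal (C * (∑ p ∈ G, (2 : ℝ) ^ (-p.1) * b p ^ 2) / V +
          R.card * (2 * (2 : ℝ) ^ (-L) * Real.exp (-(lam ^ 2 / (2 * V))))) := by
  classical
  obtain ⟨C, hC0, hC⟩ := h.exists_sum_cellOsc_sq_le hα hβ hβ1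
  refine ⟨C, hC0, fun u L hX G b R lam V hRG hlam hV havg => ?_⟩
  obtain ⟨I, hI⟩ := h.exists_level_cellAverage_close hα hβ hX G b hlam
  have hint := h.integrable hβ
  set S : Finset (ℤ × ℤ) → ℝ → ℝ := fun s t => ∑ p ∈ s, b p * ψ p t with hS
  have hSi : ∀ s, Integrable (S s) := fun s =>
    integrable_finsetSum _ fun p _ => (hint p).const_mul _
  set d : ℕ → ℕ → ℝ := fun i k => ∑ p ∈ G, |b p| * cellOsc u L (ψ p) i k with hd
  set bad0 := (Finset.range (2 ^ I)).filter fun k => V < pathVariance d I k with hbad0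
  set bad : Finset (ℤ × ℤ) → Finset ℕ := fun s => (Finset.range (2 ^ I)).filter fun k =>
    2 * lam < |cellAverage u L (S s) I k| ∧ pathVariance d I k ≤ V with hbad
  set cell : ℕ → Set ℝ := fun k =>
    Set.Icc (u + k * (2 : ℝ) ^ (-(L + I))) (u + (k + 1) * (2 : ℝ) ^ (-(L + I))) with hcell
  have hcov : {x ∈ Set.Ico u (u + (2 : ℝ) ^ (-L)) | ∃ s ∈ R, 3 * lam < |S s x|} ⊆
      ⋃ k ∈ bad0 ∪ R.biUnion bad, cell k := by
    rintro x ⟨hx, s, hs, hsx⟩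
    obtain ⟨k, hk, hxk⟩ := exists_cell u L hx I
    simp only [Set.mem_iUnion]
    refine ⟨k, ?_, hxk⟩
    rw [Finset.mem_union, Finset.mem_biUnion]
    by_cases hVk : V < pathVariance d I k
    · exact Or.inl (Finset.mem_filter.2 ⟨Finset.mem_range.2 hk, hVk⟩)
    · refine Or.inr ⟨s, hs, Finset.mem_filter.2 ⟨Finset.mem_range.2 hk, ?_, not_lt.1 hVk⟩⟩
      have h1 := hI s (hRG s hs) k hk x hxk
      have h2 := abs_sub_abs_le_abs_sub (S s x) (cellAverage u L (S s) I k)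
      rw [abs_sub_comm] at h2
      have h3 : |cellAverage u L (S s) I k - S s x| ≤ lam := h1
      linarith
  have hcard0 : (bad0.card : ℝ) ≤ 2 ^ I *
      ((2 : ℝ) ^ L * (C * (∑ p ∈ G, (2 : ℝ) ^ (-p.1) * b p ^ 2) / V)) := by
    have h1 : (bad0.card : ℝ) * V ≤ ∑ k ∈ Finset.range (2 ^ I), pathVariance d I k := by
      calc (bad0.card : ℝ) * V = ∑ k ∈ bad0, V := by simp
        _ ≤ ∑ k ∈ bad0, pathVariance d I k :=
            Finset.sum_le_sum fun k hk => (Finset.mem_filter.1 hk).2.le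
        _ ≤ _ := Finset.sum_le_sum_of_subset_of_nonneg (Finset.filter_subset _ _)
            fun k _ _ => pathVariance_nonneg d I k
    have h2 : ∑ i ∈ Finset.range I, ((2 : ℝ) ^ i)⁻¹ * ∑ k ∈ Finset.range (2 ^ i), d i k ^ 2 ≤
        (2 : ℝ) ^ L * (C * ∑ p ∈ G, (2 : ℝ) ^ (-p.1) * b p ^ 2) := by
      refine le_trans (le_of_eq ?_) (mul_le_mul_of_nonneg_left (hC u L hX I G b) (by positivity))
      rw [Finset.mul_sum]
      refine Finset.sum_congr rfl fun i _ => ?_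
      rw [← Finset.mul_sum, ← mul_assoc, ← zpow_add₀ (by norm_num)]
      congr 1
      rw [← zpow_natCast, ← zpow_neg]; congr 1; ring
    rw [sum_pathVariance] at h1
    rw [← mul_div_assoc, ← mul_div_assoc, le_div_iff₀ hV]
    refine h1.trans ?_
    gcongr
  have hcard : ∀ s ∈ R, ((bad s).card : ℝ) ≤ 2 * 2 ^ I * Real.exp (-(lam ^ 2 / (2 * V))) := by
    intro s hs
    refine card_large_le (e := fun i k => cellAverage u L (S s) i k)
      (fun i k => cellAverage_eq_half u L i k (hSi s)) (fun i k => ?_) hlam hV (havg s hs) I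
    rw [hS]
    simp only [cellAverage_sum u L hint, hd]
    rw [← Finset.sum_sub_distrib]
    calc |∑ p ∈ s, (b p * cellAverage u L (ψ p) (i + 1) (2 * k) -
            b p * cellAverage u L (ψ p) (i + 1) (2 * k + 1))| / 2
        ≤ (∑ p ∈ s, |b p * cellAverage u L (ψ p) (i + 1) (2 * k) -
            b p * cellAverage u L (ψ p) (i + 1) (2 * k + 1)|) / 2 := by
          gcongr; exact Finset.abs_sum_le_sum_abs _ _
      _ = ∑ p ∈ s, |b p| * cellOsc u L (ψ p) i k := by
          rw [Finset.sum_div]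
          refine Finset.sum_congr rfl fun p _ => ?_
          rw [cellOsc_eq, ← mul_sub, abs_mul, mul_div_assoc]
      _ ≤ _ := Finset.sum_le_sum_of_subset_of_nonneg (hRG s hs) fun p _ _ =>
          mul_nonneg (abs_nonneg _) (cellOsc_nonneg _ _ _ _ _)
  have htot : ((bad0 ∪ R.biUnion bad).card : ℝ) ≤ 2 ^ I *
      ((2 : ℝ) ^ L * (C * (∑ p ∈ G, (2 : ℝ) ^ (-p.1) * b p ^ 2) / V)) +
      R.card * (2 * 2 ^ I * Real.exp (-(lam ^ 2 / (2 * V)))) := by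
    have h1 : ((bad0 ∪ R.biUnion bad).card : ℝ) ≤ bad0.card + ∑ s ∈ R, ((bad s).card : ℝ) := by
      exact_mod_cast (Finset.card_union_le _ _).trans
        (Nat.add_le_add_left Finset.card_biUnion_le _)
    refine h1.trans (add_le_add hcard0 ?_)
    refine (Finset.sum_le_sum hcard).trans_eq ?_
    simp
  calc _ ≤ volume (⋃ k ∈ bad0 ∪ R.biUnion bad, cell k) := measure_mono hcov
    _ ≤ ∑ k ∈ bad0 ∪ R.biUnion bad, volume (cell k) := measure_biUnion_finset_le _ _
    _ = ∑ k ∈ bad0 ∪ R.biUnion bad, ENNReal.ofReal ((2 : ℝ) ^ (-(L + (I : ℤ)))) := by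
        refine Finset.sum_congr rfl fun k _ => ?_
        simp only [hcell, Real.volume_Icc]; congr 1; ring
    _ = ENNReal.ofReal ((bad0 ∪ R.biUnion bad).card * (2 : ℝ) ^ (-(L + (I : ℤ)))) := by
        rw [Finset.sum_const, nsmul_eq_mul, ENNReal.ofReal_mul (by positivity),
          ENNReal.ofReal_natCast]
    _ ≤ _ := by
        refine ENNReal.ofReal_le_ofReal ((mul_le_mul_of_nonneg_right htot
          (by positivity)).trans_eq ?_)
        have h1 : (2 : ℝ) ^ (-(L + (I : ℤ))) = (2 : ℝ) ^ (-L) * ((2 : ℝ) ^ I)⁻¹ := by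
          rw [neg_add, zpow_add₀ (by norm_num), zpow_neg _ (I : ℤ), zpow_natCast]
        have h2 : (2 : ℝ) ^ L * (2 : ℝ) ^ (-L) = 1 := by
          rw [← zpow_add₀ (by norm_num)]; simp
        have h3 : (2 : ℝ) ^ I * ((2 : ℝ) ^ I)⁻¹ = 1 := mul_inv_cancel₀ (by positivity)
        rw [h1]
        linear_combination (C * (∑ p ∈ G, (2 : ℝ) ^ (-p.1) * b p ^ 2) / V) * ((2 : ℝ) ^ I *
          ((2 : ℝ) ^ I)⁻¹) * h2 + ((C * (∑ p ∈ G, (2 : ℝ) ^ (-p.1) * b p ^ 2) / V) +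
          R.card * (2 * (2 : ℝ) ^ (-L) * Real.exp (-(lam ^ 2 / (2 * V))))) * h3

end IsAtomSystem

/-! ### Convergence with the weights `log n` -/

namespace IsOrthonormalSystem

variable {ι : Type*} {φ : ι → ℝ → ℝ}

lemma comp_injective {κ : Type*} (hφ : IsOrthonormalSystem φ) {σ : κ → ι}
    (hσ : Function.Injective σ) : IsOrthonormalSystem fun k => φ (σ k) :=
  ⟨fun _ => hφ.memLp_two _, fun _ => hφ.integral_sq _,
    fun _ _ hij => hφ.integral_mul _ _ fun h => hij (hσ h)⟩

lemma integrable_mul (hφ : IsOrthonormalSystem φ) (i j : ι) :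
    Integrable fun t => φ i t * φ j t :=
  (hφ.memLp_two i).integrable_mul (hφ.memLp_two j)

lemma integrable_sum_sq (hφ : IsOrthonormalSystem φ) (s : Finset ι) (a : ι → ℝ) :
    Integrable fun t => (∑ i ∈ s, a i * φ i t) ^ 2 := by
  have h : (fun t => (∑ i ∈ s, a i * φ i t) ^ 2) =
      fun t => ∑ i ∈ s, ∑ j ∈ s, (a i * a j) * (φ i t * φ j t) := by
    ext t
    rw [sq, Finset.sum_mul_sum]
    exact Finset.sum_congr rfl fun i _ => Finset.sum_congr rfl fun j _ => by ring
  rw [h]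
  exact integrable_finsetSum _ fun i _ => integrable_finsetSum _ fun j _ =>
    (hφ.integrable_mul i j).const_mul _

lemma integral_sum_sq (hφ : IsOrthonormalSystem φ) (s : Finset ι) (a : ι → ℝ) :
    ∫ t, (∑ i ∈ s, a i * φ i t) ^ 2 = ∑ i ∈ s, a i ^ 2 := by
  classical
  have h : ∀ t, (∑ i ∈ s, a i * φ i t) ^ 2 =
      ∑ i ∈ s, ∑ j ∈ s, (a i * a j) * (φ i t * φ j t) := by
    intro t
    rw [sq, Finset.sum_mul_sum]
    exact Finset.sum_congr rfl fun i _ => Finset.sum_congr rfl fun j _ => by ring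
  simp only [h]
  rw [integral_finsetSum _ fun i _ => integrable_finsetSum _ fun j _ =>
    (hφ.integrable_mul i j).const_mul _]
  refine Finset.sum_congr rfl fun i hi => ?_
  rw [integral_finsetSum _ fun j _ => (hφ.integrable_mul i j).const_mul _]
  rw [Finset.sum_eq_single_of_mem i hi]
  · rw [integral_const_mul]
    have := hφ.integral_sq i
    simp only [sq] at this
    rw [this, mul_one, sq]
  · intro j _ hj
    rw [integral_const_mul, hφ.integral_mul i j hj.symm, mul_zero]

end IsOrthonormalSystem

/-- The average over the base interval is small when the `L²` norm is. -/
lemma abs_cellAverage_zero_le (u : ℝ) (L : ℤ) {f : ℝ → ℝ} (hf : Integrable f)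
    (hf2 : Integrable fun t => f t ^ 2) {lam : ℝ} (hlam : 0 < lam)
    (h : (2 : ℝ) ^ L * ∫ t, f t ^ 2 ≤ lam ^ 2) : |cellAverage u L f 0 0| ≤ lam := by
  have hpos : (0 : ℝ) < (2 : ℝ) ^ (-L) := by positivity
  have hone : (2 : ℝ) ^ L * (2 : ℝ) ^ (-L) = 1 := by rw [← zpow_add₀ (by norm_num)]; simp
  have hle : u ≤ u + (2 : ℝ) ^ (-L) := by linarith
  have h1 : cellAverage u L f 0 0 = (2 : ℝ) ^ L * ∫ t in u..(u + (2 : ℝ) ^ (-L)), f t := by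
    unfold cellAverage; congr 2 <;> simp
  rw [h1, abs_mul, abs_of_pos (by positivity)]
  have h2 : |∫ t in u..(u + (2 : ℝ) ^ (-L)), f t| ≤
      ∫ t in u..(u + (2 : ℝ) ^ (-L)), (lam / 2 + f t ^ 2 / (2 * lam)) := by
    refine (intervalIntegral.abs_integral_le_integral_abs hle).trans ?_
    refine intervalIntegral.integral_mono_on hle hf.abs.intervalIntegrable
      (((by simp : IntervalIntegrable (fun _ => lam / 2) volume u (u + (2 : ℝ) ^ (-L)))).add
        (hf2.div_const _).intervalIntegrable) fun t _ => ?_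
    have h3 : lam / 2 + f t ^ 2 / (2 * lam) - |f t| = (|f t| - lam) ^ 2 / (2 * lam) := by
      rw [← sq_abs (f t)]; field_simp; ring
    have : 0 ≤ (|f t| - lam) ^ 2 / (2 * lam) := by positivity
    linarith
  rw [intervalIntegral.integral_add (by simp) (hf2.div_const _).intervalIntegrable,
    intervalIntegral.integral_const, intervalIntegral.integral_div, add_sub_cancel_left,
    smul_eq_mul] at h2
  have h4 : ∫ t in u..(u + (2 : ℝ) ^ (-L)), f t ^ 2 ≤ ∫ t, f t ^ 2 := by
    rw [intervalIntegral.integral_of_le hle]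
    exact setIntegral_le_integral hf2 (ae_of_all _ fun t => sq_nonneg _)
  calc (2 : ℝ) ^ L * |∫ t in u..(u + (2 : ℝ) ^ (-L)), f t|
      ≤ (2 : ℝ) ^ L * ((2 : ℝ) ^ (-L) * (lam / 2) + (∫ t, f t ^ 2) / (2 * lam)) := by
        gcongr
        refine h2.trans ?_
        gcongr
    _ = ((2 : ℝ) ^ L * (2 : ℝ) ^ (-L)) * (lam / 2) +
        ((2 : ℝ) ^ L * ∫ t, f t ^ 2) / (2 * lam) := by ring
    _ ≤ 1 * (lam / 2) + lam ^ 2 / (2 * lam) := by rw [hone]; gcongr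
    _ = lam := by field_simp; norm_num

/-- Borel–Cantelli with a summable bound that holds from some index on. -/
lemma ae_eventually_notMem_of_summable {E : ℕ → Set ℝ} {f : ℕ → ℝ} (hf : Summable f)
    (hf0 : ∀ m, 0 ≤ f m) (hE : ∀ᶠ m in atTop, volume (E m) ≤ ENNReal.ofReal (f m)) :
    ∀ᵐ x, ∀ᶠ m in atTop, x ∉ E m := by
  obtain ⟨m₀, hm₀⟩ := eventually_atTop.1 hE
  have h1 : ∑' m, volume (E (m + m₀)) ≠ ⊤ := by
    have hs : Summable fun m => f (m + m₀) := (summable_nat_add_iff m₀).2 hf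
    refine ne_top_of_le_ne_top ?_ (ENNReal.tsum_le_tsum fun m => hm₀ (m + m₀) (by omega))
    rw [← ENNReal.ofReal_tsum_of_nonneg (fun m => hf0 _) hs]
    exact ENNReal.ofReal_ne_top
  filter_upwards [ae_eventually_notMem h1] with x hx
  obtain ⟨m₁, hm₁⟩ := eventually_atTop.1 hx
  refine eventually_atTop.2 ⟨m₁ + m₀, fun m hm => ?_⟩
  have := hm₁ (m - m₀) (by omega)
  rwa [show m - m₀ + m₀ = m by omega] at this

lemma sum_Ico_blocks {M : ℕ → ℕ} (hM : Monotone M) (f : ℕ → ℝ) (r : ℕ) :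
    ∑ m ∈ Finset.range r, ∑ k ∈ Finset.Ico (M m) (M (m + 1)), f k =
      ∑ k ∈ Finset.Ico (M 0) (M r), f k := by
  induction r with
  | zero => simp
  | succ r ih =>
    rw [Finset.sum_range_succ, ih, Finset.sum_Ico_consecutive _ (hM (Nat.zero_le r))
      (hM (Nat.le_succ r))]

/-- The numbers `2 ^ 2 ^ m`; the logarithm changes at most by a factor `2` between two successive
ones. -/
def tower (m : ℕ) : ℕ := 2 ^ 2 ^ m

lemma tower_mono : Monotone tower := fun _ _ h =>
  Nat.pow_le_pow_right (by norm_num) (Nat.pow_le_pow_right (by norm_num) h)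

lemma exists_tower_le_lt {N : ℕ} (hN : 2 ≤ N) : ∃ m, tower m ≤ N ∧ N < tower (m + 1) := by
  have h1 : Nat.log 2 N ≠ 0 := (Nat.log_pos (by norm_num) hN).ne'
  refine ⟨Nat.log 2 (Nat.log 2 N), ?_, ?_⟩
  · exact (Nat.pow_le_pow_right (by norm_num) (Nat.pow_log_le_self 2 h1)).trans
      (Nat.pow_log_le_self 2 (by omega))
  · refine (Nat.lt_pow_succ_log_self (by norm_num : 1 < 2) N).trans_le ?_
    exact Nat.pow_le_pow_right (by norm_num) (Nat.lt_pow_succ_log_self (by norm_num) _)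

/-- If the partial sums converge along `tower` and the fluctuation inside the blocks tends to
zero, the partial sums converge. -/
lemma tendsto_of_tower {S : ℕ → ℝ} {s : ℝ} (h1 : Tendsto (fun m => S (tower m)) atTop (𝓝 s))
    (h2 : ∀ r : ℕ, ∀ᶠ m in atTop, ∀ N, tower m ≤ N → N < tower (m + 1) →
      |S N - S (tower m)| ≤ 3 * (1 / ((r : ℝ) + 1))) : Tendsto S atTop (𝓝 s) := by
  rw [Metric.tendsto_atTop] at h1 ⊢
  intro ε hε
  obtain ⟨r, hr⟩ := exists_nat_one_div_lt (show 0 < ε / 6 by positivity)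
  obtain ⟨m₁, hm₁⟩ := h1 (ε / 2) (by positivity)
  obtain ⟨m₂, hm₂⟩ := eventually_atTop.1 (h2 r)
  refine ⟨tower (max m₁ m₂), fun N hN => ?_⟩
  have hN2 : 2 ≤ N := by
    refine le_trans ?_ hN
    exact (show 2 = tower 0 from rfl) ▸ tower_mono (Nat.zero_le _)
  obtain ⟨m, hm, hm'⟩ := exists_tower_le_lt hN2
  have hmm : max m₁ m₂ ≤ m := by
    by_contra hcon
    have := tower_mono (show m + 1 ≤ max m₁ m₂ by omega)
    omega
  have e1 := hm₁ m (le_trans (le_max_left _ _) hmm)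
  have e2 := hm₂ m (le_trans (le_max_right _ _) hmm) N hm hm'
  rw [Real.dist_eq] at e1 ⊢
  have e3 := abs_sub_le (S N) (S (tower m)) s
  linarith

section

variable {A B : EReal} {c α β : ℝ} {φ : waveletIndex A B → ℝ → ℝ}

/-- Almost everywhere convergence on one interval of dyadic length. -/
lemma ae_converge_on_interval (hα : 0 < α) (hβ : 0 < β) (hβ1 : β ≤ 1)
    (hφ : IsWaveletType A B c α β φ) (hφo : IsOrthonormalSystem φ) {σ : ℕ → waveletIndex A B}
    (hσ : Function.Injective σ) {a : ℕ → ℝ}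
    (ha : Summable fun k : ℕ => a k ^ 2 * Real.log ((k + 1 : ℕ) : ℝ)) {u : ℝ} {L : ℤ}
    (hX : Set.Icc u (u + (2 : ℝ) ^ (-L)) ⊆ closedInterval A B) :
    ∀ᵐ x, x ∈ Set.Ico u (u + (2 : ℝ) ^ (-L)) → ∃ s : ℝ,
      Tendsto (fun N : ℕ => ∑ k ∈ Finset.range N, a k * φ (σ k) x) atTop (𝓝 s) := by
  classical
  have hat := hφ.isAtomSystem hα
  set ψ := normalizedAtom φ with hψ
  obtain ⟨C, hC0, hC⟩ := hat.exists_measure_max_le hα hβ hβ1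
  set pt : ℕ → ℤ × ℤ := fun k => (σ k).1 with hpt
  have hptinj : Function.Injective pt := Subtype.val_injective.comp hσ
  set b : ℤ × ℤ → ℝ :=
    Function.extend pt (fun k => (2 : ℝ) ^ (((pt k).1 : ℝ) / 2) * a k) 0 with hb
  have hbk : ∀ k, b (pt k) = (2 : ℝ) ^ (((pt k).1 : ℝ) / 2) * a k := fun k =>
    hptinj.extend_apply _ _ _
  have hbψ : ∀ k x, b (pt k) * ψ (pt k) x = a k * φ (σ k) x := by
    intro k x
    rw [hbk, hψ, normalizedAtom_of_mem (σ k).2]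
    simp only
    have : (2 : ℝ) ^ (((pt k).1 : ℝ) / 2) * (2 : ℝ) ^ (-(((σ k).1.1 : ℝ) / 2)) = 1 := by
      rw [← Real.rpow_add (by norm_num)]; simp [hpt]
    linear_combination (a k * φ (σ k) x) * this
  have hbsq : ∀ k, (2 : ℝ) ^ (-(pt k).1) * b (pt k) ^ 2 = a k ^ 2 := by
    intro k
    rw [hbk, mul_pow, ← Real.rpow_natCast, ← Real.rpow_mul (by norm_num), ← mul_assoc,
      ← Real.rpow_intCast, ← Real.rpow_add (by norm_num)]
    push_cast
    rw [show -((pt k).1 : ℝ) + ((pt k).1 : ℝ) / 2 * 2 = 0 by ring, Real.rpow_zero, one_mul]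
  have hsum : ∀ (s : Finset ℕ) x, ∑ p ∈ s.image pt, b p * ψ p x = ∑ k ∈ s, a k * φ (σ k) x := by
    intro s x
    rw [Finset.sum_image (fun _ _ _ _ h => hptinj h)]
    exact Finset.sum_congr rfl fun k _ => hbψ k x
  -- the `L²` norms of finite sums
  have horth : IsOrthonormalSystem fun k => φ (σ k) := hφo.comp_injective hσ
  have hsumi : ∀ s : Finset ℕ, Integrable fun x => ∑ k ∈ s, a k * φ (σ k) x := by
    intro s
    have : (fun x => ∑ k ∈ s, a k * φ (σ k) x) = fun x => ∑ p ∈ s.image pt, b p * ψ p x := by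
      ext x; rw [hsum]
    rw [this]
    exact integrable_finsetSum _ fun p _ => (hat.integrable hβ p).const_mul _
  -- square sums of the coefficients over the blocks
  set W : ℕ → ℝ := fun m => ∑ k ∈ Finset.Ico (tower m) (tower (m + 1)), a k ^ 2 with hW
  have hW0 : ∀ m, 0 ≤ W m := fun m => Finset.sum_nonneg fun k _ => sq_nonneg _
  have hlog0 : ∀ k : ℕ, 0 ≤ a k ^ 2 * Real.log ((k + 1 : ℕ) : ℝ) := fun k =>
    mul_nonneg (sq_nonneg _) (Real.log_natCast_nonneg _)
  have hl2 : 0 < Real.log 2 := Real.log_pos (by norm_num)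
  have hWs : Summable fun m => (2 : ℝ) ^ m * W m := by
    have hle : ∀ m, (2 : ℝ) ^ m * W m * Real.log 2 ≤
        ∑ k ∈ Finset.Ico (tower m) (tower (m + 1)), a k ^ 2 * Real.log ((k + 1 : ℕ) : ℝ) := by
      intro m
      rw [hW, Finset.mul_sum, Finset.sum_mul]
      refine Finset.sum_le_sum fun k hk => ?_
      have h1 : tower m ≤ k + 1 := by have := (Finset.mem_Ico.1 hk).1; omega
      have h2 : (2 : ℝ) ^ m * Real.log 2 ≤ Real.log ((k + 1 : ℕ) : ℝ) := by
        have h3 : ((tower m : ℕ) : ℝ) ≤ ((k + 1 : ℕ) : ℝ) := by exact_mod_cast h1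
        have h4 : Real.log ((tower m : ℕ) : ℝ) = (2 : ℝ) ^ m * Real.log 2 := by
          unfold tower; push_cast; rw [Real.log_pow]; push_cast; ring
        rw [← h4]
        exact Real.log_le_log (by unfold tower; positivity) h3
      calc (2 : ℝ) ^ m * a k ^ 2 * Real.log 2 = a k ^ 2 * ((2 : ℝ) ^ m * Real.log 2) := by ring
        _ ≤ _ := mul_le_mul_of_nonneg_left h2 (sq_nonneg _)
    have h5 : Summable fun m => (2 : ℝ) ^ m * W m * Real.log 2 := by
      refine summable_of_sum_range_le (c := ∑' k : ℕ, a k ^ 2 * Real.log ((k + 1 : ℕ) : ℝ))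
        (fun m => mul_nonneg (mul_nonneg (by positivity) (hW0 m)) hl2.le) fun r => ?_
      refine (Finset.sum_le_sum fun m _ => hle m).trans ?_
      rw [sum_Ico_blocks tower_mono (fun k : ℕ => a k ^ 2 * Real.log ((k + 1 : ℕ) : ℝ))]
      exact ha.sum_le_tsum _ fun k _ => hlog0 k
    refine (summable_mul_right_iff hl2.ne').1 h5
  have hW_tendsto : Tendsto W atTop (𝓝 0) := by
    refine squeeze_zero hW0 (fun m => ?_) hWs.tendsto_atTop_zero
    exact le_mul_of_one_le_left (hW0 m) (one_le_pow₀ (by norm_num))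
  -- the sums over whole blocks
  set D : ℕ → ℝ → ℝ := fun m x => ∑ k ∈ Finset.Ico (tower m) (tower (m + 1)), a k * φ (σ k) x
    with hD
  have hDae : ∀ᵐ x, ∀ᶠ m in atTop, x ∉ {x | (2 : ℝ)⁻¹ ^ m ≤ D m x ^ 2} := by
    refine ae_eventually_notMem_of_summable hWs (fun m => mul_nonneg (by positivity) (hW0 m))
      (Eventually.of_forall fun m => ?_)
    have hi := horth.integrable_sum_sq (Finset.Ico (tower m) (tower (m + 1))) a
    have h1 := mul_meas_ge_le_integral_of_nonneg (ae_of_all _ fun x => sq_nonneg (D m x)) hi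
      ((2 : ℝ)⁻¹ ^ m)
    rw [horth.integral_sum_sq] at h1
    have hfin : volume {x | (2 : ℝ)⁻¹ ^ m ≤ D m x ^ 2} ≠ ⊤ :=
      (hi.measure_ge_lt_top (by positivity)).ne
    rw [← ENNReal.ofReal_toReal hfin]
    refine ENNReal.ofReal_le_ofReal ?_
    have h2 : (2 : ℝ) ^ m * ((2 : ℝ)⁻¹ ^ m) = 1 := by rw [← mul_pow]; norm_num
    calc (volume {x | (2 : ℝ)⁻¹ ^ m ≤ D m x ^ 2}).toReal
        = (2 : ℝ) ^ m * ((2 : ℝ)⁻¹ ^ m * volume.real {x | (2 : ℝ)⁻¹ ^ m ≤ D m x ^ 2}) := by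
          rw [← mul_assoc, h2, one_mul]; rfl
      _ ≤ (2 : ℝ) ^ m * W m := by gcongr
  -- the fluctuation inside the blocks
  have hmax : ∀ r : ℕ, ∀ᵐ x, ∀ᶠ m in atTop, x ∉ {x ∈ Set.Ico u (u + (2 : ℝ) ^ (-L)) |
      ∃ s ∈ (Finset.range (tower (m + 1))).image fun N => (Finset.Ico (tower m) N).image pt,
        3 * (1 / ((r : ℝ) + 1)) < |∑ p ∈ s, b p * ψ p x|} := by
    intro r
    set lam : ℝ := 1 / ((r : ℝ) + 1) with hlam
    have hlam0 : 0 < lam := by positivity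
    set f : ℕ → ℝ := fun m => C * 8 / lam ^ 2 * ((2 : ℝ) ^ m * W m) +
      2 * (2 : ℝ) ^ (-L) * Real.exp (-1) ^ m with hf
    refine ae_eventually_notMem_of_summable (f := f) ?_ ?_ ?_
    · refine (hWs.mul_left _).add ((summable_geometric_of_lt_one (Real.exp_pos _).le ?_).mul_left _)
      rw [Real.exp_lt_one_iff]; norm_num
    · intro m; have := hW0 m; positivity
    · have hev : ∀ᶠ m in atTop, W m < lam ^ 2 * (2 : ℝ) ^ (-L) :=
        hW_tendsto.eventually (gt_mem_nhds (by positivity))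
      filter_upwards [hev] with m hm
      -- this `V` makes the tail `exp (-4 * 2 ^ m)`, against `2 ^ 2 ^ (m + 1)` partial sums
      set V : ℝ := lam ^ 2 / (8 * 2 ^ m) with hV
      refine (hC u L hX ((Finset.Ico (tower m) (tower (m + 1))).image pt) b _ lam V ?_ hlam0
        (by positivity) ?_).trans (ENNReal.ofReal_le_ofReal ?_)
      · intro s hs
        obtain ⟨N, hN, rfl⟩ := Finset.mem_image.1 hs
        exact Finset.image_subset_image
          (Finset.Ico_subset_Ico le_rfl (Finset.mem_range.1 hN).le)
      · intro s hs
        obtain ⟨N, hN, rfl⟩ := Finset.mem_image.1 hs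
        simp only [hsum]
        refine abs_cellAverage_zero_le u L (hsumi _) (horth.integrable_sum_sq _ a) hlam0 ?_
        rw [horth.integral_sum_sq]
        have h1 : ∑ k ∈ Finset.Ico (tower m) N, a k ^ 2 ≤ W m :=
          Finset.sum_le_sum_of_subset_of_nonneg
            (Finset.Ico_subset_Ico le_rfl (Finset.mem_range.1 hN).le) fun _ _ _ => sq_nonneg _
        have h2 : (2 : ℝ) ^ L * (2 : ℝ) ^ (-L) = 1 := by
          rw [← zpow_add₀ (by norm_num)]; simp
        calc _ ≤ (2 : ℝ) ^ L * (lam ^ 2 * (2 : ℝ) ^ (-L)) := by gcongr; exact h1.trans hm.le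
          _ = lam ^ 2 * ((2 : ℝ) ^ L * (2 : ℝ) ^ (-L)) := by ring
          _ = lam ^ 2 := by rw [h2, mul_one]
      · rw [Finset.sum_image (fun _ _ _ _ h => hptinj h)]
        simp only [hbsq]
        have h1 : C * W m / V = C * 8 / lam ^ 2 * ((2 : ℝ) ^ m * W m) := by
          rw [hV]; field_simp
        have h2 : lam ^ 2 / (2 * V) = 4 * 2 ^ m := by
          rw [hV]; field_simp; norm_num
        have h3 : ((((Finset.range (tower (m + 1))).image fun N =>
            (Finset.Ico (tower m) N).image pt).card : ℕ) : ℝ) ≤ Real.exp (2 * 2 ^ m) := by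
          have h4 : ((((Finset.range (tower (m + 1))).image fun N =>
            (Finset.Ico (tower m) N).image pt).card : ℕ) : ℝ) ≤ (tower (m + 1) : ℕ) := by
            exact_mod_cast Finset.card_image_le.trans (Finset.card_range _).le
          refine h4.trans ?_
          have h5 : ((tower (m + 1) : ℕ) : ℝ) = (2 : ℝ) ^ (2 * 2 ^ m) := by
            unfold tower; push_cast; rw [pow_succ, mul_comm]
          rw [h5, show (2 * 2 ^ m : ℝ) = ((2 * 2 ^ m : ℕ) : ℝ) * 1 by push_cast; ring,
            Real.exp_nat_mul]
          refine pow_le_pow_left₀ (by norm_num) ?_ _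
          have := Real.add_one_le_exp (1 : ℝ); linarith
        have h6 : Real.exp (2 * 2 ^ m) * Real.exp (-(4 * 2 ^ m)) ≤ Real.exp (-1) ^ m := by
          rw [← Real.exp_add, ← Real.exp_nat_mul]
          refine Real.exp_le_exp.2 ?_
          have h7 : (m : ℝ) ≤ 2 ^ m := by exact_mod_cast (Nat.lt_two_pow_self).le
          linarith
        rw [h2]
        change C * W m / V + _ ≤ _
        rw [h1]
        refine add_le_add le_rfl ?_
        calc _ ≤ Real.exp (2 * 2 ^ m) * (2 * (2 : ℝ) ^ (-L) * Real.exp (-(4 * 2 ^ m))) := by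
              gcongr
          _ = 2 * (2 : ℝ) ^ (-L) * (Real.exp (2 * 2 ^ m) * Real.exp (-(4 * 2 ^ m))) := by ring
          _ ≤ _ := by gcongr
  filter_upwards [hDae, ae_all_iff.2 hmax] with x hx1 hx2 hxJ
  have hDs : Summable fun m => D m x := by
    refine Summable.of_norm_bounded_eventually_nat (g := fun m => Real.sqrt 2⁻¹ ^ m) ?_ ?_
    · refine summable_geometric_of_lt_one (Real.sqrt_nonneg _) ?_
      rw [Real.sqrt_lt' (by norm_num)]; norm_num
    · filter_upwards [hx1] with m hm
      simp only [not_le] at hm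
      rw [Real.norm_eq_abs]
      refine abs_le_of_sq_le_sq ?_ (by positivity)
      rw [← pow_mul, mul_comm m 2, pow_mul, Real.sq_sqrt (by norm_num)]
      exact hm.le
  set S : ℕ → ℝ := fun N => ∑ k ∈ Finset.range N, a k * φ (σ k) x with hS
  have hSsub : ∀ m N, m ≤ N → S N - S m = ∑ k ∈ Finset.Ico m N, a k * φ (σ k) x := fun m N h =>
    (Finset.sum_Ico_eq_sub _ h).symm
  refine ⟨∑' m, D m x + S (tower 0), tendsto_of_tower ?_ fun r => ?_⟩
  · have h1 := (hDs.hasSum.tendsto_sum_nat).add_const (S (tower 0))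
    refine h1.congr fun m => ?_
    rw [hD, sum_Ico_blocks tower_mono (fun k => a k * φ (σ k) x),
      ← hSsub _ _ (tower_mono (Nat.zero_le m))]
    ring
  · filter_upwards [hx2 r] with m hm N h1 h2
    simp only [not_and, not_exists] at hm
    have h3 := hm hxJ _ (Finset.mem_image_of_mem _ (Finset.mem_range.2 h2))
    rw [hsum, not_lt] at h3
    rwa [hSsub _ _ h1]

/-- The sequence `log n` is an almost everywhere convergence multiplier for all rearrangements. -/
theorem isRCMultiplier_log (hα : 0 < α) (hβ : 0 < β) (hβ1 : β ≤ 1)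
    (hφ : IsWaveletType A B c α β φ) (hφo : IsOrthonormalSystem φ) :
    IsRCMultiplier (fun n : ℕ => Real.log n) φ := by
  intro σ hσ a ha
  have hnull : ∀ E : EReal, ∀ᵐ x : ℝ, (x : EReal) ≠ E := by
    intro E
    have hsub : {x : ℝ | (x : EReal) = E}.Subsingleton := fun x hx y hy =>
      EReal.coe_injective (hx.trans hy.symm)
    rw [ae_iff]
    simpa using hsub.measure_zero volume
  have hall : ∀ᵐ x, ∀ (u : ℚ) (L : ℕ),
      Set.Icc (u : ℝ) (u + (2 : ℝ) ^ (-(L : ℤ))) ⊆ closedInterval A B →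
      x ∈ Set.Ico (u : ℝ) (u + (2 : ℝ) ^ (-(L : ℤ))) → ∃ s : ℝ,
        Tendsto (fun N : ℕ => ∑ k ∈ Finset.range N, a k * φ (σ k) x) atTop (𝓝 s) := by
    rw [ae_all_iff]; intro u
    rw [ae_all_iff]; intro L
    by_cases hX : Set.Icc (u : ℝ) (u + (2 : ℝ) ^ (-(L : ℤ))) ⊆ closedInterval A B
    · filter_upwards [ae_converge_on_interval hα hβ hβ1 hφ hφo hσ ha hX] with x hx _
      exact hx
    · exact ae_of_all _ fun x h => absurd h hX
  filter_upwards [hnull A, hnull B, hall] with x hxA hxB hx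
  by_cases hxX : x ∈ closedInterval A B
  · obtain ⟨y, hAy, hyx⟩ := EReal.lt_iff_exists_real_btwn.1 (lt_of_le_of_ne hxX.1 hxA.symm)
    obtain ⟨z, hxz, hzB⟩ := EReal.lt_iff_exists_real_btwn.1 (lt_of_le_of_ne hxX.2 hxB)
    rw [EReal.coe_lt_coe_iff] at hyx hxz
    obtain ⟨L, hL⟩ := exists_pow_lt_of_lt_one
      (lt_min (sub_pos.2 hyx) (sub_pos.2 hxz)) (by norm_num : (1 / 2 : ℝ) < 1)
    have hLz : (2 : ℝ) ^ (-(L : ℤ)) = (1 / 2) ^ L := by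
      rw [zpow_neg, zpow_natCast, one_div, inv_pow]
    rw [← hLz, lt_min_iff] at hL
    have hpos : (0 : ℝ) < (2 : ℝ) ^ (-(L : ℤ)) := by positivity
    obtain ⟨u, hu1, hu2⟩ := exists_rat_btwn (show x - (2 : ℝ) ^ (-(L : ℤ)) < x by linarith)
    refine hx u L (fun t ht => ⟨?_, ?_⟩) ⟨hu2.le, by linarith⟩
    · exact hAy.le.trans (EReal.coe_le_coe_iff.2 (by linarith [ht.1, hL.1]))
    · exact le_trans (EReal.coe_le_coe_iff.2 (by linarith [ht.2, hL.2])) hzB.le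
  · refine ⟨0, ?_⟩
    have h0 : ∀ k, φ (σ k) x = 0 := fun k => by
      by_contra hne
      exact hxX (hφ.support_subset _ hne)
    simp [h0]

end

/-! ### Orderings by keys -/

/-- A finite set can be listed so that all sublevel sets of a given key are initial segments. -/
lemma exists_list_sublevel {ι : Type*} [DecidableEq ι] (key : ι → ℝ) (P : Finset ι) :
    ∃ l : List ι, l.Nodup ∧ l.toFinset = P ∧
      ∀ z : ℝ, ∃ m : ℕ, m ≤ l.length ∧ (l.take m).toFinset = P.filter fun p => key p < z := by
  classical
  refine Finset.induction_on_max_value key P ?_ ?_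
  · exact ⟨[], List.nodup_nil, rfl, fun z => ⟨0, le_rfl, rfl⟩⟩
  · rintro a s ha hmax ⟨l, hl, hs, hz⟩
    have hal : a ∉ l := fun h => ha (hs ▸ List.mem_toFinset.2 h)
    refine ⟨l ++ [a], ?_, ?_, fun z => ?_⟩
    · rw [List.nodup_append]
      refine ⟨hl, List.nodup_singleton a, fun b hb b' hb' => ?_⟩
      rw [List.mem_singleton] at hb'
      rintro rfl
      exact hal (hb' ▸ hb)
    · rw [List.toFinset_append, hs]; ext b; simp
    · by_cases haz : key a < z
      · refine ⟨(l ++ [a]).length, le_rfl, ?_⟩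
        rw [List.take_length, List.toFinset_append, hs]
        ext b
        simp only [Finset.mem_union, List.mem_toFinset, List.mem_singleton, Finset.mem_filter,
          Finset.mem_insert]
        constructor
        · rintro (hb | rfl)
          · exact ⟨Or.inr hb, (hmax b hb).trans_lt haz⟩
          · exact ⟨Or.inl rfl, haz⟩
        · rintro ⟨rfl | hb, _⟩
          · exact Or.inr rfl
          · exact Or.inl hb
      · obtain ⟨m, hm, hm'⟩ := hz z
        refine ⟨m, hm.trans (by simp), ?_⟩
        rw [List.take_append_of_le_length hm, hm', Finset.filter_insert, if_neg haz]

open Classical in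
/-- The number in `[0, 1]` with ternary digits `2` at the places `i < N` where `s i` holds, and `0`
elsewhere. -/
noncomputable def ternaryKey (N : ℕ) (s : ℕ → Prop) : ℝ :=
  ∑ i ∈ Finset.range N, if s i then 2 * (3 : ℝ)⁻¹ ^ (i + 1) else 0

/-- If two digit sequences agree before the place `k`, the key truncated at `k` and continued by the
digit `1` is compared with the full key according to the digit at `k`. -/
lemma ternaryKey_lt_iff {N k : ℕ} (hk : k < N) {s t : ℕ → Prop} (hst : ∀ i < k, s i ↔ t i) :
    ternaryKey k t + (3 : ℝ)⁻¹ ^ (k + 1) < ternaryKey N s ↔ s k := by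
  classical
  have h1 : ternaryKey k t = ternaryKey k s := by
    unfold ternaryKey
    refine Finset.sum_congr rfl fun i hi => ?_
    simp only [hst i (Finset.mem_range.1 hi)]
  obtain ⟨r, rfl⟩ : ∃ r, N = k + 1 + r := ⟨N - (k + 1), by omega⟩
  have h2 : ternaryKey (k + 1 + r) s = ternaryKey k s +
      (if s k then 2 * (3 : ℝ)⁻¹ ^ (k + 1) else 0) +
      ∑ i ∈ Finset.range r, if s (k + 1 + i) then 2 * (3 : ℝ)⁻¹ ^ (k + 1 + i + 1) else 0 := by
    unfold ternaryKey
    rw [Finset.sum_range_add, Finset.sum_range_succ]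
  have h3 : 0 ≤ ∑ i ∈ Finset.range r,
      if s (k + 1 + i) then 2 * (3 : ℝ)⁻¹ ^ (k + 1 + i + 1) else 0 := by
    refine Finset.sum_nonneg fun i _ => ?_
    split_ifs <;> positivity
  have h4 : ∑ i ∈ Finset.range r, (if s (k + 1 + i) then 2 * (3 : ℝ)⁻¹ ^ (k + 1 + i + 1) else 0) <
      (3 : ℝ)⁻¹ ^ (k + 1) := by
    have h5 : ∀ r : ℕ, ∑ i ∈ Finset.range r, 2 * (3 : ℝ)⁻¹ ^ (k + 1 + i + 1) =
        (3 : ℝ)⁻¹ ^ (k + 1) - (3 : ℝ)⁻¹ ^ (k + 1 + r) := by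
      intro r
      induction r with
      | zero => simp
      | succ r ih => rw [Finset.sum_range_succ, ih, ← add_assoc, pow_succ]; ring
    calc _ ≤ ∑ i ∈ Finset.range r, 2 * (3 : ℝ)⁻¹ ^ (k + 1 + i + 1) := by
          refine Finset.sum_le_sum fun i _ => ?_
          split_ifs
          · exact le_rfl
          · positivity
      _ < _ := by
          rw [h5]
          have : (0 : ℝ) < (3 : ℝ)⁻¹ ^ (k + 1 + r) := by positivity
          linarith
  have h6 : (0 : ℝ) < (3 : ℝ)⁻¹ ^ (k + 1) := by positivity
  rw [h1, h2]
  by_cases hsk : s k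
  · simp only [hsk, if_true, iff_true]; linarith
  · simp only [hsk, if_false, iff_false, not_lt]; linarith

/-! ### A good threshold -/

/-- Among the thresholds `θ ∈ (0, η)` there is one for which the sets where `F` is within `δ m` of
`θ` have on the whole at most their mean measure. -/
lemma exists_threshold {F : ℝ → ℝ} (hF : Measurable F) {I : Set ℝ}
    (hIfin : volume I ≠ ⊤) {η : ℝ} (hη : 0 < η) {δ : ℕ → ℝ} (hδ : ∀ m, 0 ≤ δ m) (N : ℕ) :
    ∃ θ ∈ Set.Ioo 0 η, ∑ m ∈ Finset.range N, volume.real {x ∈ I | |F x - θ| ≤ δ m} ≤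
      2 * volume.real I * (∑ m ∈ Finset.range N, δ m) / η := by
  set T : ℕ → Set (ℝ × ℝ) := fun m => {z | |F z.2 - z.1| ≤ δ m} with hT
  have hTm : ∀ m, MeasurableSet (T m) := fun m =>
    measurableSet_le (((hF.comp measurable_snd).sub measurable_fst).norm) measurable_const
  set f : ℕ → ℝ → ℝ → ENNReal := fun m θ x => (T m).indicator (fun _ => 1) (θ, x) with hf
  have hfm : ∀ m, Measurable (Function.uncurry (f m)) := fun m =>
    measurable_const.indicator (hTm m)
  set g : ℝ → ENNReal := fun θ => ∑ m ∈ Finset.range N, ∫⁻ x in I, f m θ x with hg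
  have hinner : ∀ m, Measurable fun θ => ∫⁻ x in I, f m θ x := fun m =>
    (hfm m).lintegral_prod_right'
  have hgm : Measurable g := Finset.measurable_sum _ fun m _ => hinner m
  have hfeq : ∀ m θ, ∫⁻ x in I, f m θ x = volume {x ∈ I | |F x - θ| ≤ δ m} := by
    intro m θ
    have hS : MeasurableSet {x | |F x - θ| ≤ δ m} :=
      measurableSet_le ((hF.sub_const θ).norm) measurable_const
    have : ∀ x, f m θ x = {x | |F x - θ| ≤ δ m}.indicator (fun _ => 1) x := fun x => by
      simp only [hf, hT, Set.indicator]; rfl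
    simp only [this]
    rw [lintegral_indicator hS, setLIntegral_one, Measure.restrict_apply hS, Set.inter_comm]
    rfl
  have hvol : volume (Set.Ioo 0 η) = ENNReal.ofReal η := by simp
  have hswap : ∀ m, ∫⁻ θ in Set.Ioo 0 η, ∫⁻ x in I, f m θ x ≤
      ENNReal.ofReal (2 * δ m) * volume I := by
    intro m
    rw [lintegral_lintegral_swap (hfm m).aemeasurable]
    calc ∫⁻ x in I, ∫⁻ θ in Set.Ioo 0 η, f m θ x
        ≤ ∫⁻ x in I, ENNReal.ofReal (2 * δ m) := by
          refine lintegral_mono fun x => ?_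
          have hsub : ∀ θ, f m θ x ≤ (Set.Icc (F x - δ m) (F x + δ m)).indicator
              (fun _ => 1) θ := by
            intro θ
            simp only [hf, hT]
            by_cases h : |F x - θ| ≤ δ m
            · have h' := abs_le.1 h
              rw [Set.indicator_of_mem (by simpa using h),
                Set.indicator_of_mem (Set.mem_Icc.2 ⟨by linarith, by linarith⟩)]
            · rw [Set.indicator_of_notMem (by simpa using h)]
              exact zero_le
          calc ∫⁻ θ in Set.Ioo 0 η, f m θ x ≤ ∫⁻ θ, f m θ x := setLIntegral_le_lintegral _ _
            _ ≤ ∫⁻ θ, (Set.Icc (F x - δ m) (F x + δ m)).indicator (fun _ => 1) θ :=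
                lintegral_mono hsub
            _ = _ := by
                rw [lintegral_indicator measurableSet_Icc, setLIntegral_one, Real.volume_Icc]
                congr 1; ring
      _ = _ := by rw [setLIntegral_const]
  obtain ⟨θ, hθ, hle⟩ := exists_le_setLAverage (μ := volume) (s := Set.Ioo 0 η) (f := g)
    (by rw [hvol]; simpa using hη) (by rw [hvol]; exact ENNReal.ofReal_ne_top) hgm.aemeasurable
  refine ⟨θ, hθ, ?_⟩
  have htot : g θ ≤ ENNReal.ofReal (2 * volume.real I * (∑ m ∈ Finset.range N, δ m) / η) := by
    refine hle.trans ?_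
    rw [setLAverage_eq, hvol, ENNReal.ofReal_div_of_pos hη]
    gcongr
    calc ∫⁻ θ in Set.Ioo 0 η, g θ
        = ∑ m ∈ Finset.range N, ∫⁻ θ in Set.Ioo 0 η, ∫⁻ x in I, f m θ x :=
          lintegral_finsetSum _ fun m _ => hinner m
      _ ≤ ∑ m ∈ Finset.range N, ENNReal.ofReal (2 * δ m) * volume I :=
          Finset.sum_le_sum fun m _ => hswap m
      _ = _ := by
          have hIr : volume I = ENNReal.ofReal (volume.real I) := (ENNReal.ofReal_toReal hIfin).symm
          rw [← Finset.sum_mul, ← ENNReal.ofReal_sum_of_nonneg fun m _ => by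
            have := hδ m; positivity, hIr, ← ENNReal.ofReal_mul
            (Finset.sum_nonneg fun m _ => by have := hδ m; positivity), ← Finset.mul_sum]
          congr 1
          ring
  have hfin : ∀ m, volume {x ∈ I | |F x - θ| ≤ δ m} ≠ ⊤ := fun m =>
    ne_top_of_le_ne_top hIfin (measure_mono fun x hx => hx.1)
  have : ∑ m ∈ Finset.range N, volume.real {x ∈ I | |F x - θ| ≤ δ m} = (g θ).toReal := by
    simp only [hg, hfeq]
    rw [ENNReal.toReal_sum fun m _ => hfin m]
    rfl
  rw [this]
  refine ENNReal.toReal_le_of_le_ofReal ?_ htot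
  have : 0 ≤ ∑ m ∈ Finset.range N, δ m := Finset.sum_nonneg fun m _ => hδ m
  positivity

/-! ### One level of the system -/

/-- The integers `j` with `|j 2⁻ⁿ - x₀| ≤ ρ`. -/
noncomputable def positions (x₀ ρ : ℝ) (n : ℤ) : Finset ℤ :=
  Finset.Icc ⌈(2 : ℝ) ^ n * (x₀ - ρ)⌉ ⌊(2 : ℝ) ^ n * (x₀ + ρ)⌋

lemma mem_positions {x₀ ρ : ℝ} {n j : ℤ} :
    j ∈ positions x₀ ρ n ↔ x₀ - ρ ≤ (j : ℝ) * (2 : ℝ) ^ (-n) ∧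
      (j : ℝ) * (2 : ℝ) ^ (-n) ≤ x₀ + ρ := by
  have h2n : (0 : ℝ) < (2 : ℝ) ^ n := by positivity
  rw [positions, Finset.mem_Icc, Int.ceil_le, Int.le_floor, zpow_neg, ← div_eq_mul_inv,
    le_div_iff₀ h2n, div_le_iff₀ h2n, mul_comm (x₀ - ρ), mul_comm (x₀ + ρ)]

lemma card_positions {x₀ ρ : ℝ} {n : ℤ} (hn : (2 : ℝ) ^ (-n) ≤ ρ) :
    ρ ≤ (2 : ℝ) ^ (-n) * (positions x₀ ρ n).card ∧
      (2 : ℝ) ^ (-n) * (positions x₀ ρ n).card ≤ 3 * ρ := by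
  have h2n : (0 : ℝ) < (2 : ℝ) ^ n := by positivity
  have h2n' : (0 : ℝ) < (2 : ℝ) ^ (-n) := by positivity
  have hmul : (2 : ℝ) ^ (-n) * (2 : ℝ) ^ n = 1 := by rw [← zpow_add₀ (by norm_num)]; simp
  have h1 : 1 ≤ (2 : ℝ) ^ n * ρ := by
    calc (1 : ℝ) = (2 : ℝ) ^ n * (2 : ℝ) ^ (-n) := by rw [mul_comm, hmul]
      _ ≤ _ := by gcongr
  have hc1 := Int.le_ceil ((2 : ℝ) ^ n * (x₀ - ρ))
  have hc2 := Int.ceil_lt_add_one ((2 : ℝ) ^ n * (x₀ - ρ))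
  have hf1 := Int.floor_le ((2 : ℝ) ^ n * (x₀ + ρ))
  have hf2 := Int.lt_floor_add_one ((2 : ℝ) ^ n * (x₀ + ρ))
  have hdiff : (2 : ℝ) ^ n * (x₀ + ρ) - (2 : ℝ) ^ n * (x₀ - ρ) = 2 * ((2 : ℝ) ^ n * ρ) := by ring
  have hnn : 0 ≤ ⌊(2 : ℝ) ^ n * (x₀ + ρ)⌋ + 1 - ⌈(2 : ℝ) ^ n * (x₀ - ρ)⌉ := by
    have : (0 : ℝ) < ((⌊(2 : ℝ) ^ n * (x₀ + ρ)⌋ + 1 - ⌈(2 : ℝ) ^ n * (x₀ - ρ)⌉ + 1 : ℤ) : ℝ) := by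
      push_cast; linarith
    have : 0 < ⌊(2 : ℝ) ^ n * (x₀ + ρ)⌋ + 1 - ⌈(2 : ℝ) ^ n * (x₀ - ρ)⌉ + 1 := by exact_mod_cast this
    omega
  have hcard : ((positions x₀ ρ n).card : ℝ) =
      (⌊(2 : ℝ) ^ n * (x₀ + ρ)⌋ : ℝ) + 1 - ⌈(2 : ℝ) ^ n * (x₀ - ρ)⌉ := by
    rw [positions, Int.card_Icc]
    exact_mod_cast Int.toNat_of_nonneg hnn
  constructor
  · calc ρ = (2 : ℝ) ^ (-n) * ((2 : ℝ) ^ n * ρ) := by rw [← mul_assoc, hmul, one_mul]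
      _ ≤ _ := by gcongr; rw [hcard]; linarith
  · calc _ ≤ (2 : ℝ) ^ (-n) * (3 * ((2 : ℝ) ^ n * ρ)) := by gcongr; rw [hcard]; linarith
      _ = ((2 : ℝ) ^ (-n) * (2 : ℝ) ^ n) * (3 * ρ) := by ring
      _ = _ := by rw [hmul, one_mul]

/-- The sum of all atoms of level `n` centred within `ρ` of `x₀`. -/
noncomputable def levelSum (ψ : ℤ × ℤ → ℝ → ℝ) (x₀ ρ : ℝ) (n : ℤ) (t : ℝ) : ℝ :=
  ∑ j ∈ positions x₀ ρ n, ψ (n, j) t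

namespace IsAtomSystem

variable {X : Set ℝ} {c α β : ℝ} {ψ : ℤ × ℤ → ℝ → ℝ}

lemma measurable_levelSum (h : IsAtomSystem X c α β ψ) (x₀ ρ : ℝ) (n : ℤ) :
    Measurable (levelSum ψ x₀ ρ n) :=
  Finset.measurable_sum _ fun j _ => h.measurable (n, j)

lemma abs_levelSum_le (h : IsAtomSystem X c α β ψ) {K : ℝ} (hK : IsDecayConst β K)
    (x₀ ρ : ℝ) (n : ℤ) (t : ℝ) : |levelSum ψ x₀ ρ n t| ≤ c * K :=
  (Finset.abs_sum_le_sum_abs _ _).trans (h.sum_abs_le hK n _ t)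

/-- The atoms of one level that are centred far from a point contribute little there. -/
lemma sum_abs_far_le (h : IsAtomSystem X c α β ψ) (hβ : 0 < β) {K : ℝ}
    (hK' : IsDecayConst (β / 2) K) (n : ℤ) (F : Finset ℤ) {x R : ℝ} (hR : 0 < R)
    (hF : ∀ j ∈ F, R ≤ |(2 : ℝ) ^ n * x - j|) :
    ∑ j ∈ F, |ψ (n, j) x| ≤ c * K * R ^ (-(β / 2)) := by
  have hc := h.const_nonneg
  calc ∑ j ∈ F, |ψ (n, j) x|
      ≤ ∑ j ∈ F, c * R ^ (-(β / 2)) * waveletDecay (β / 2) ((2 : ℝ) ^ n * x - j) := by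
        refine Finset.sum_le_sum fun j hj => (h.decay (n, j) x).trans ?_
        rw [mul_assoc]
        gcongr
        exact waveletDecay_le_rpow_mul hβ hR (hF j hj)
    _ = c * R ^ (-(β / 2)) * ∑ j ∈ F, waveletDecay (β / 2) ((2 : ℝ) ^ n * x - j) := by
        rw [Finset.mul_sum]
    _ ≤ c * R ^ (-(β / 2)) * K := by gcongr; exact hK'.sum_le _ _
    _ = _ := by ring

lemma abs_levelSum_sub_le (h : IsAtomSystem X c α β ψ) {K : ℝ} (hK : IsDecayConst β K)
    (x₀ ρ : ℝ) {n : ℤ} {t t' : ℝ} (ht : t ∈ X) (ht' : t' ∈ X) (htt : |t - t'| ≤ (2 : ℝ) ^ (-n)) :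
    |levelSum ψ x₀ ρ n t - levelSum ψ x₀ ρ n t'| ≤ c * K * ((2 : ℝ) ^ n * |t - t'|) ^ α := by
  have hc := h.const_nonneg
  unfold levelSum
  rw [← Finset.sum_sub_distrib]
  calc _ ≤ ∑ j ∈ positions x₀ ρ n, |ψ (n, j) t - ψ (n, j) t'| := Finset.abs_sum_le_sum_abs _ _
    _ ≤ ∑ j ∈ positions x₀ ρ n, c * ((2 : ℝ) ^ n * |t - t'|) ^ α *
        waveletDecay β ((2 : ℝ) ^ n * t - j) :=
        Finset.sum_le_sum fun j _ => h.holder (n, j) t ht t' ht' htt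
    _ = c * ((2 : ℝ) ^ n * |t - t'|) ^ α *
        ∑ j ∈ positions x₀ ρ n, waveletDecay β ((2 : ℝ) ^ n * t - j) := by rw [Finset.mul_sum]
    _ ≤ c * ((2 : ℝ) ^ n * |t - t'|) ^ α * K := by gcongr; exact hK.sum_le _ _
    _ = _ := by ring

/-- The atoms of level `n + 2d` whose centre lies on the other side of a threshold for the level
sum of level `n` than `x` have small total size at `x`, unless that level sum is close to the
threshold at `x`. -/
lemma sum_abs_separated_le (h : IsAtomSystem X c α β ψ) (hα : 0 < α) (hβ : 0 < β) {K : ℝ}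
    (hK : IsDecayConst β K) (hK' : IsDecayConst (β / 2) K) {γ : ℝ} (hγα : γ ≤ α)
    (hγβ : γ ≤ β / 2) (x₀ ρ : ℝ) (n : ℤ) (d : ℕ) {η : ℝ} (hη : |η| = 1) (θ : ℝ)
    (F : Finset ℤ) (hF : ∀ j ∈ F, (j : ℝ) * (2 : ℝ) ^ (-(n + 2 * d)) ∈ X) {x : ℝ} (hx : x ∈ X)
    (hsep : ∀ j ∈ F, ¬ (θ < η * levelSum ψ x₀ ρ n (j * (2 : ℝ) ^ (-(n + 2 * d))) ↔
      θ < η * levelSum ψ x₀ ρ n x)) :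
    ∑ j ∈ F, |ψ (n + 2 * d, j) x| ≤ c * K *
      ({z | |η * levelSum ψ x₀ ρ n z - θ| ≤ c * K * ((2 : ℝ) ^ (-γ)) ^ d}.indicator (fun _ => 1) x +
        ((2 : ℝ) ^ (-γ)) ^ d) := by
  classical
  have hc := h.const_nonneg
  have hK0 : 0 ≤ K := by simpa using hK.sum_le 0 ∅
  set n' : ℤ := n + 2 * d with hn'
  set e : ℝ := ((2 : ℝ) ^ (-γ)) ^ d with he
  have h2 : (0 : ℝ) < (2 : ℝ) ^ n' := by positivity
  rw [← Finset.sum_filter_add_sum_filter_not F fun j : ℤ => (2 : ℝ) ^ d ≤ |(2 : ℝ) ^ n' * x - j|]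
  have hfar : ∑ j ∈ F.filter (fun j : ℤ => (2 : ℝ) ^ d ≤ |(2 : ℝ) ^ n' * x - j|), |ψ (n', j) x| ≤
      c * K * e := by
    refine (h.sum_abs_far_le hβ hK' n' _ (by positivity : (0 : ℝ) < 2 ^ d)
      fun j hj => (Finset.mem_filter.1 hj).2).trans ?_
    gcongr
    rw [he, ← Real.rpow_natCast, ← Real.rpow_natCast, ← Real.rpow_mul (by norm_num),
      ← Real.rpow_mul (by norm_num)]
    refine Real.rpow_le_rpow_of_exponent_le (by norm_num) ?_
    nlinarith [(Nat.cast_nonneg d : (0 : ℝ) ≤ d)]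
  have hnear : ∑ j ∈ F.filter (fun j : ℤ => ¬ (2 : ℝ) ^ d ≤ |(2 : ℝ) ^ n' * x - j|), |ψ (n', j) x| ≤
      c * K * {z | |η * levelSum ψ x₀ ρ n z - θ| ≤ c * K * e}.indicator (fun _ => 1) x := by
    rcases (F.filter (fun j : ℤ => ¬ (2 : ℝ) ^ d ≤ |(2 : ℝ) ^ n' * x - j|)).eq_empty_or_nonempty
      with hempty | ⟨j, hj⟩
    · rw [hempty, Finset.sum_empty]
      exact mul_nonneg (mul_nonneg hc hK0) (Set.indicator_nonneg (fun _ _ => zero_le_one) _)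
    · obtain ⟨hjF, hjn⟩ := Finset.mem_filter.1 hj
      set y : ℝ := j * (2 : ℝ) ^ (-n') with hy
      have hyX : y ∈ X := hF j hjF
      have hxy : (2 : ℝ) ^ n * |x - y| ≤ (2 : ℝ) ^ (-(d : ℤ)) := by
        have h3 : (2 : ℝ) ^ n' * (x - y) = (2 : ℝ) ^ n' * x - j := by
          rw [mul_sub, hy, mul_left_comm, ← zpow_add₀ (by norm_num)]; simp
        have h4 : (2 : ℝ) ^ n' * |x - y| ≤ 2 ^ d := by
          rw [← abs_of_pos h2, ← abs_mul, h3]; exact (not_le.1 hjn).le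
        have h5 : (2 : ℝ) ^ n = (2 : ℝ) ^ (-(2 * d : ℤ)) * (2 : ℝ) ^ n' := by
          rw [← zpow_add₀ (by norm_num)]; congr 1; rw [hn']; ring
        calc (2 : ℝ) ^ n * |x - y| = (2 : ℝ) ^ (-(2 * d : ℤ)) * ((2 : ℝ) ^ n' * |x - y|) := by
              rw [h5, mul_assoc]
          _ ≤ (2 : ℝ) ^ (-(2 * d : ℤ)) * 2 ^ d := by gcongr
          _ = _ := by
              rw [← zpow_natCast, ← zpow_add₀ (by norm_num)]; congr 1; ring
      have hdist : |x - y| ≤ (2 : ℝ) ^ (-n) := by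
        have h6 : (2 : ℝ) ^ n * |x - y| ≤ 1 :=
          hxy.trans (zpow_le_one_of_nonpos₀ (by norm_num) (by omega))
        rw [zpow_neg, ← one_div, le_div_iff₀ (by positivity), mul_comm]
        exact h6
      have hclose : |η * levelSum ψ x₀ ρ n x - η * levelSum ψ x₀ ρ n y| ≤ c * K * e := by
        rw [← mul_sub, abs_mul, hη, one_mul]
        refine (h.abs_levelSum_sub_le hK x₀ ρ hx hyX hdist).trans ?_
        gcongr
        exact (Real.rpow_le_rpow (by positivity) hxy hα.le).trans (two_zpow_neg_rpow_le hγα d)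
      have hmem : x ∈ {z | |η * levelSum ψ x₀ ρ n z - θ| ≤ c * K * e} := by
        have hs := hsep j hjF
        have hcl := abs_le.1 hclose
        change |η * levelSum ψ x₀ ρ n x - θ| ≤ c * K * e
        by_cases hxθ : θ < η * levelSum ψ x₀ ρ n x
        · have hyθ : ¬ θ < η * levelSum ψ x₀ ρ n y := fun hyθ => hs ⟨fun _ => hxθ, fun _ => hyθ⟩
          rw [abs_le]; constructor <;> linarith
        · have hyθ : θ < η * levelSum ψ x₀ ρ n y := by
            by_contra hyθ
            exact hs ⟨fun h => absurd h hyθ, fun h => absurd h hxθ⟩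
          rw [abs_le]; constructor <;> linarith
      rw [Set.indicator_of_mem hmem, mul_one]
      exact h.sum_abs_le hK n' _ x
  linarith

end IsAtomSystem

namespace IsAtomSystem

variable {X : Set ℝ} {c α β : ℝ} {ψ : ℤ × ℤ → ℝ → ℝ}

lemma integrable_levelSum (h : IsAtomSystem X c α β ψ) (hβ : 0 < β) (x₀ ρ : ℝ) (n : ℤ) :
    Integrable (levelSum ψ x₀ ρ n) :=
  integrable_finsetSum _ fun j _ => h.integrable hβ (n, j)

/-- The level sums of high level have `L¹` norm bounded below on a neighbourhood of the
positions, because they are uniformly bounded, their `L²` norm is bounded below and little of it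
lies far from the positions. -/
lemma exists_integral_abs_levelSum_ge (h : IsAtomSystem X c α β ψ) (hβ : 0 < β) {x₀ ρ : ℝ}
    (hρ : 0 < ρ) {n₀ : ℤ} (hnorm : ∀ n ≥ n₀,
      ∫ t, levelSum ψ x₀ ρ n t ^ 2 = (2 : ℝ) ^ (-n) * (positions x₀ ρ n).card) :
    ∃ (n₁ : ℤ) (c₁ : ℝ), (2 : ℝ) ^ (-n₁) ≤ ρ ∧ 0 < c₁ ∧ ∀ n ≥ n₁,
      c₁ ≤ ∫ t in Set.Icc (x₀ - 2 * ρ) (x₀ + 2 * ρ), |levelSum ψ x₀ ρ n t| := by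
  obtain ⟨K, hK1, hK, hK'⟩ := exists_isDecayConst hβ
  have hc := h.const_nonneg
  have hlim1 : Tendsto (fun m : ℕ => (2 : ℝ) ^ m * ρ) atTop atTop :=
    (tendsto_pow_atTop_atTop_of_one_lt (by norm_num)).atTop_mul_const hρ
  have hlim2 : Tendsto (fun m : ℕ => (c * K) ^ 2 * ((2 : ℝ) ^ m * ρ) ^ (-(β / 2))) atTop (𝓝 0) := by
    simpa using ((tendsto_rpow_neg_atTop (half_pos hβ)).comp hlim1).const_mul ((c * K) ^ 2)
  obtain ⟨m, ⟨hm1, hm2⟩, hm3⟩ := (((hlim2.eventually (ge_mem_nhds (by norm_num : (0 : ℝ) < 1 / 2))).and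
    (hlim1.eventually_ge_atTop 1)).and (eventually_ge_atTop n₀.toNat)).exists
  have h2m : (2 : ℝ) ^ (-(m : ℤ)) ≤ ρ := by
    rw [zpow_neg, zpow_natCast, ← one_div, div_le_iff₀ (by positivity), mul_comm]
    exact hm2
  refine ⟨m, ρ / (2 * (c * K + 1)), h2m, by positivity, fun n hn => ?_⟩
  set I : Set ℝ := Set.Icc (x₀ - 2 * ρ) (x₀ + 2 * ρ) with hI
  set F := levelSum ψ x₀ ρ n with hF
  set w : ℝ := (2 : ℝ) ^ (-n) * (positions x₀ ρ n).card with hw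
  have hIm : MeasurableSet I := measurableSet_Icc
  have h2n : (0 : ℝ) < (2 : ℝ) ^ n := by positivity
  have hwρ : ρ ≤ w :=
    (card_positions ((zpow_le_zpow_right₀ (by norm_num) (by omega)).trans h2m)).1
  have hFi : Integrable F := h.integrable_levelSum hβ x₀ ρ n
  have hFb : ∀ t, |F t| ≤ c * K := h.abs_levelSum_le hK x₀ ρ n
  have hF2i : Integrable fun t => F t ^ 2 := by
    refine (hFi.abs.const_mul (c * K)).mono'
      ((h.measurable_levelSum x₀ ρ n).pow_const 2).aestronglyMeasurable (ae_of_all _ fun t => ?_)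
    rw [Real.norm_eq_abs, abs_of_nonneg (sq_nonneg _), ← sq_abs, sq]
    exact mul_le_mul_of_nonneg_right (hFb t) (abs_nonneg _)
  have hL1 : ∫ t, |F t| ≤ c * K * w := by
    calc ∫ t, |F t| ≤ ∫ t, ∑ j ∈ positions x₀ ρ n, c * waveletDecay β ((2 : ℝ) ^ n * t - j) := by
          refine integral_mono hFi.abs (integrable_finsetSum _ fun j _ =>
            (integrable_waveletDecay_dilate hβ n j).const_mul c) fun t => ?_
          exact (Finset.abs_sum_le_sum_abs _ _).trans
            (Finset.sum_le_sum fun j _ => h.decay (n, j) t)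
      _ = ∑ j ∈ positions x₀ ρ n, c * ∫ t, waveletDecay β ((2 : ℝ) ^ n * t - j) := by
          rw [integral_finsetSum _ fun j _ => (integrable_waveletDecay_dilate hβ n j).const_mul c]
          simp only [integral_const_mul]
      _ ≤ ∑ j ∈ positions x₀ ρ n, c * (K * (2 : ℝ) ^ (-n)) := by
          refine Finset.sum_le_sum fun j _ => ?_
          gcongr
          exact hK.integral_dilate_le n j
      _ = _ := by rw [Finset.sum_const, nsmul_eq_mul, hw]; ring
  set ε : ℝ := ((2 : ℝ) ^ n * ρ) ^ (-(β / 2)) with hε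
  have hεle : (c * K) ^ 2 * ε ≤ 1 / 2 := by
    refine le_trans ?_ hm1
    gcongr
    refine Real.rpow_le_rpow_of_nonpos (by positivity) ?_ (by linarith)
    gcongr
    rw [← zpow_natCast]
    exact zpow_le_zpow_right₀ (by norm_num) hn
  have hout : ∀ t ∈ Iᶜ, |F t| ≤ c * K * ε := by
    intro t ht
    refine (Finset.abs_sum_le_sum_abs _ _).trans
      (h.sum_abs_far_le hβ hK' n _ (by positivity) fun j hj => ?_)
    have hj' := mem_positions.1 hj
    have h3 : (2 : ℝ) ^ n * t - j = (2 : ℝ) ^ n * (t - j * (2 : ℝ) ^ (-n)) := by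
      rw [mul_sub, mul_left_comm, ← zpow_add₀ (by norm_num)]; simp
    rw [h3, abs_mul, abs_of_pos h2n]
    gcongr
    by_contra hcon
    rw [not_le, abs_lt] at hcon
    exact ht ⟨by linarith, by linarith⟩
  have htail : ∫ t in Iᶜ, F t ^ 2 ≤ w / 2 := by
    calc ∫ t in Iᶜ, F t ^ 2 ≤ ∫ t in Iᶜ, c * K * ε * |F t| := by
          refine setIntegral_mono_on hF2i.integrableOn (hFi.abs.const_mul _).integrableOn hIm.compl
            fun t ht => ?_
          rw [← sq_abs, sq]
          exact mul_le_mul_of_nonneg_right (hout t ht) (abs_nonneg _)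
      _ ≤ ∫ t, c * K * ε * |F t| :=
          setIntegral_le_integral (hFi.abs.const_mul _) (ae_of_all _ fun t => by positivity)
      _ = c * K * ε * ∫ t, |F t| := integral_const_mul _ _
      _ ≤ c * K * ε * (c * K * w) := by gcongr
      _ = ((c * K) ^ 2 * ε) * w := by ring
      _ ≤ 1 / 2 * w := by gcongr
      _ = _ := by ring
  have hin : w / 2 ≤ ∫ t in I, F t ^ 2 := by
    have h1 := integral_add_compl hIm hF2i
    have h2 := hnorm n (by omega)
    linarith
  have hfin : ∫ t in I, F t ^ 2 ≤ (c * K + 1) * ∫ t in I, |F t| := by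
    rw [← integral_const_mul]
    refine integral_mono hF2i.integrableOn (hFi.abs.const_mul _).integrableOn fun t => ?_
    simp only
    rw [← sq_abs, sq]
    exact mul_le_mul_of_nonneg_right ((hFb t).trans (by linarith)) (abs_nonneg _)
  rw [div_le_iff₀ (by positivity)]
  linarith

end IsAtomSystem

/-- Either a function or its negative has a positive part carrying half of the integral of the
absolute value. -/
lemma exists_sign_integral_posPart {F : ℝ → ℝ} {I : Set ℝ} (hF : IntegrableOn F I) {a : ℝ}
    (ha : a ≤ ∫ t in I, |F t|) : ∃ η : ℝ, |η| = 1 ∧ a / 2 ≤ ∫ t in I, max (η * F t) 0 := by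
  have h1 : IntegrableOn (fun t => max (F t) 0) I := hF.pos_part
  have h2 : IntegrableOn (fun t => max (-F t) 0) I := hF.neg_part
  have h3 : ∫ t in I, |F t| = (∫ t in I, max (F t) 0) + ∫ t in I, max (-F t) 0 := by
    rw [← integral_add h1 h2]
    refine integral_congr_ae (ae_of_all _ fun t => ?_)
    rcases le_total 0 (F t) with h | h
    · simp [abs_of_nonneg h, h]
    · simp [abs_of_nonpos h, h]
  rcases le_total (a / 2) (∫ t in I, max (F t) 0) with h | h
  · exact ⟨1, abs_one, by simpa using h⟩
  · exact ⟨-1, by simp, by simp only [neg_mul, one_mul]; linarith⟩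

lemma sum_sum_sub_le {f : ℕ → ℕ → ℝ} (hf : ∀ i m, 0 ≤ f i m) (N : ℕ) :
    ∑ k ∈ Finset.range N, ∑ i ∈ Finset.range k, f i (k - i - 1) ≤
      ∑ i ∈ Finset.range N, ∑ m ∈ Finset.range N, f i m := by
  have h1 : ∑ k ∈ Finset.range N, ∑ i ∈ Finset.range k, f i (k - i - 1) =
      ∑ i ∈ Finset.range N, ∑ k ∈ Finset.Ico (i + 1) N, f i (k - i - 1) := by
    refine Finset.sum_comm' fun k i => ?_
    simp only [Finset.mem_range, Finset.mem_Ico]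
    omega
  rw [h1]
  refine Finset.sum_le_sum fun i _ => ?_
  rw [Finset.sum_Ico_eq_sum_range]
  calc ∑ m ∈ Finset.range (N - (i + 1)), f i (i + 1 + m - i - 1)
      = ∑ m ∈ Finset.range (N - (i + 1)), f i m :=
        Finset.sum_congr rfl fun m _ => by congr 1; omega
    _ ≤ _ := Finset.sum_le_sum_of_subset_of_nonneg
        (Finset.range_subset_range.2 (by omega)) fun m _ _ => hf i m

lemma sum_geometric_succ_le {q : ℝ} (hq : 0 ≤ q) (hq2 : q ≤ 1 / 2) (N : ℕ) :
    ∑ m ∈ Finset.range N, q ^ (m + 1) ≤ 2 * q := by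
  have h : ∑ m ∈ Finset.range N, q ^ (m + 1) ≤ 2 * q - 2 * q ^ (N + 1) := by
    induction N with
    | zero => simp
    | succ N ih =>
      rw [Finset.sum_range_succ]
      have : 0 ≤ q ^ (N + 1) := by positivity
      have h2 : 2 * q ^ (N + 1 + 1) ≤ q ^ (N + 1) := by rw [pow_succ]; nlinarith
      linarith
  have : 0 ≤ q ^ (N + 1) := by positivity
  linarith

/-! ### Blocks with a large rearranged partial sum -/

namespace IsAtomSystem

variable {X : Set ℝ} {c α β : ℝ} {ψ : ℤ × ℤ → ℝ → ℝ}

/-- The rearrangement. The atoms of levels `n + 2 M i`, `i < N`, centred near `x₀` are sorted by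
ternary keys that record on which side of a threshold the coarser level sums lie at the centre. At a
point `x` the atoms with key below that of `x` make up, apart from an error, exactly those level
sums that exceed their thresholds at `x`; hence some partial sum is comparable with `N` in the mean,
while the norm of the whole sum is of the order of `√N`. -/
theorem exists_block (h : IsAtomSystem X c α β ψ) (hα : 0 < α) (hβ : 0 < β) {x₀ ρ : ℝ}
    (hρ : 0 < ρ) (hX : Set.Icc (x₀ - 2 * ρ) (x₀ + 2 * ρ) ⊆ X) {n₀ : ℤ} (hnorm : ∀ n ≥ n₀,
      ∫ t, levelSum ψ x₀ ρ n t ^ 2 = (2 : ℝ) ^ (-n) * (positions x₀ ρ n).card) :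
    ∃ (M : ℕ) (n₁ : ℤ) (c₁ C : ℝ), 0 < M ∧ (2 : ℝ) ^ (-n₁) ≤ ρ ∧ 0 < c₁ ∧
      ∀ n ≥ n₁, ∀ N : ℕ, 0 < N → ∃ (η : ℕ → ℝ) (l : List (Σ _ : ℕ, ℤ)) (H : ℝ → ℝ),
        (∀ i, |η i| = 1) ∧ l.Nodup ∧
        l.toFinset = (Finset.range N).sigma (fun i => positions x₀ ρ (n + 2 * (M * i : ℕ))) ∧
        Measurable H ∧ (∀ x, 0 ≤ H x) ∧ (∀ x, H x ≤ C) ∧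
        c₁ ≤ ∫ x in Set.Icc (x₀ - 2 * ρ) (x₀ + 2 * ρ), H x ∧
        ∀ x ∈ Set.Icc (x₀ - 2 * ρ) (x₀ + 2 * ρ), ∃ m ≤ l.length, H x ≤
          |∑ p ∈ (l.take m).toFinset, η p.1 / N * ψ (n + 2 * (M * p.1 : ℕ), p.2) x| := by
  classical
  obtain ⟨K, hK1, hK, hK'⟩ := exists_isDecayConst hβ
  obtain ⟨n₁, c₁, hn₁ρ, hc₁, hlow⟩ := h.exists_integral_abs_levelSum_ge hβ hρ hnorm
  have hc := h.const_nonneg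
  set κ : ℝ := c * K with hκ
  have hκ0 : 0 ≤ κ := by positivity
  set I : Set ℝ := Set.Icc (x₀ - 2 * ρ) (x₀ + 2 * ρ) with hI
  have hIm : MeasurableSet I := measurableSet_Icc
  have hIfin : volume I ≠ ⊤ := by simp [hI]
  set V : ℝ := volume.real I with hV
  have hV0 : 0 < V := by
    rw [hV, hI, Real.volume_real_Icc_of_le (by linarith)]; linarith
  -- thresholds below `τ` lower the mean of the main term by at most `N τ V = N c₁ / 8`
  set τ : ℝ := c₁ / (8 * V) with hτ
  have hτ0 : 0 < τ := by positivity
  set γ : ℝ := min α (β / 2) with hγ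
  have hγ0 : 0 < γ := lt_min hα (by positivity)
  set E : ℝ := κ * V * (2 * κ / τ + 1) with hE
  have hE0 : 0 ≤ E := by positivity
  -- with `q` the gain from one level to the next, the error term has mean at most `2 E q N`
  obtain ⟨M₀, hM₀⟩ := exists_pow_lt_of_lt_one
    (lt_min (by norm_num : (0 : ℝ) < 1 / 2) (by positivity : 0 < c₁ / (16 * (E + 1))))
    (Real.rpow_lt_one_of_one_lt_of_neg (by norm_num : (1 : ℝ) < 2) (by linarith : -γ < 0))
  set M : ℕ := M₀ + 1 with hM
  set q : ℝ := ((2 : ℝ) ^ (-γ)) ^ M with hq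
  have hq0 : 0 < q := by positivity
  have hqlt : q < min (1 / 2) (c₁ / (16 * (E + 1))) := by
    refine lt_of_le_of_lt (pow_le_pow_of_le_one (by positivity) ?_ (Nat.le_succ _)) hM₀
    exact Real.rpow_le_one_of_one_le_of_nonpos (by norm_num) (by linarith)
  have hq2 : q ≤ 1 / 2 := (lt_min_iff.1 hqlt).1.le
  have hqE : E * (2 * q) ≤ c₁ / 8 := by
    have h1 := (lt_min_iff.1 hqlt).2
    rw [lt_div_iff₀ (by positivity)] at h1
    nlinarith
  refine ⟨M, n₁, c₁ / 4, κ, Nat.succ_pos _, hn₁ρ, by positivity, fun n hn N hN => ?_⟩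
  set lev : ℕ → ℤ := fun i => n + 2 * (M * i : ℕ) with hlev
  -- signs, level sums, thresholds
  have hsign : ∀ i, ∃ η : ℝ, |η| = 1 ∧
      c₁ / 2 ≤ ∫ t in I, max (η * levelSum ψ x₀ ρ (lev i) t) 0 := fun i =>
    exists_sign_integral_posPart (h.integrable_levelSum hβ x₀ ρ (lev i)).integrableOn
      (hlow (lev i) (by simp only [hlev]; omega))
  choose η hη hηint using hsign
  set F : ℕ → ℝ → ℝ := fun i t => η i * levelSum ψ x₀ ρ (lev i) t with hF
  have hFm : ∀ i, Measurable (F i) := fun i => (h.measurable_levelSum x₀ ρ (lev i)).const_mul _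
  have hFb : ∀ i t, |F i t| ≤ κ := fun i t => by
    simp only [hF, abs_mul, hη, one_mul]
    exact h.abs_levelSum_le hK x₀ ρ (lev i) t
  have hFi : ∀ i, Integrable (F i) := fun i =>
    (h.integrable_levelSum hβ x₀ ρ (lev i)).const_mul _
  have hthr : ∀ i, ∃ θ ∈ Set.Ioo 0 τ, ∑ m ∈ Finset.range N,
      volume.real {x ∈ I | |F i x - θ| ≤ κ * q ^ (m + 1)} ≤
      2 * volume.real I * (∑ m ∈ Finset.range N, κ * q ^ (m + 1)) / τ := fun i =>
    exists_threshold (hFm i) hIfin hτ0 (fun m => by positivity) N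
  choose θ hθ hθsum using hthr
  set s : ℕ → ℝ → Prop := fun i x => θ i < F i x with hs
  -- the main term and the error term
  set T : ℕ → ℕ → Set ℝ := fun i m => {x | |F i x - θ i| ≤ κ * q ^ (m + 1)} with hT
  have hTm : ∀ i m, MeasurableSet (T i m) := fun i m =>
    measurableSet_le ((hFm i).sub_const _).norm measurable_const
  have hsm : ∀ i, MeasurableSet {x | s i x} := fun i => measurableSet_lt measurable_const (hFm i)
  set G : ℝ → ℝ := fun x => ∑ i ∈ Finset.range N, {x | s i x}.indicator (F i) x with hG
  set e : ℕ → ℕ → ℝ → ℝ := fun i m x => κ * ((T i m).indicator (fun _ => 1) x + q ^ (m + 1))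
    with he
  have he0 : ∀ i m x, 0 ≤ e i m x := fun i m x =>
    mul_nonneg hκ0 (add_nonneg (Set.indicator_nonneg (fun _ _ => zero_le_one) _) (by positivity))
  set R : ℝ → ℝ := fun x => ∑ i ∈ Finset.range N, ∑ m ∈ Finset.range N, e i m x with hR
  have hR0 : ∀ x, 0 ≤ R x := fun x =>
    Finset.sum_nonneg fun i _ => Finset.sum_nonneg fun m _ => he0 i m x
  have hGm : Measurable G := Finset.measurable_sum _ fun i _ => (hFm i).indicator (hsm i)
  have hem : ∀ i m, Measurable (e i m) := fun i m =>
    ((measurable_const.indicator (hTm i m)).add_const _).const_mul κ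
  have hRm : Measurable R :=
    Finset.measurable_sum _ fun i _ => Finset.measurable_sum _ fun m _ => hem i m
  have hGle : ∀ x, G x ≤ N * κ := by
    intro x
    calc G x ≤ ∑ i ∈ Finset.range N, κ := by
          refine Finset.sum_le_sum fun i _ => ?_
          by_cases hx : x ∈ {x | s i x}
          · rw [Set.indicator_of_mem hx]; exact (le_abs_self _).trans (hFb i x)
          · rw [Set.indicator_of_notMem hx]; exact hκ0
      _ = _ := by simp
  have hNpos : (0 : ℝ) < N := by exact_mod_cast hN
  set H : ℝ → ℝ := fun x => max ((G x - R x) / N) 0 with hH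
  -- the ordering
  set P : Finset (Σ _ : ℕ, ℤ) := (Finset.range N).sigma fun i => positions x₀ ρ (lev i) with hP
  set y : (Σ _ : ℕ, ℤ) → ℝ := fun p => (p.2 : ℝ) * (2 : ℝ) ^ (-(lev p.1)) with hy
  obtain ⟨l, hl, hlP, hlsub⟩ := exists_list_sublevel
    (fun p : Σ _ : ℕ, ℤ => ternaryKey p.1 (fun i => s i (y p)) + (3 : ℝ)⁻¹ ^ (p.1 + 1)) P
  refine ⟨η, l, H, hη, hl, hlP, ((hGm.sub hRm).div_const _).max measurable_const,
    fun x => le_max_right _ _, fun x => ?_, ?_, fun x hx => ?_⟩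
  · refine max_le ?_ hκ0
    rw [div_le_iff₀ hNpos]
    linarith [hGle x, hR0 x]
  · -- the mean of the main term minus the error
    have hbdd : ∀ {f : ℝ → ℝ} {b : ℝ}, Measurable f → (∀ x, |f x| ≤ b) → IntegrableOn f I :=
      fun {f b} hf hb => Measure.integrableOn_of_bounded hIfin hf.aestronglyMeasurable
        (M := b) (ae_of_all _ hb)
    have hind : ∀ i, IntegrableOn ({x | s i x}.indicator (F i)) I := fun i =>
      ((hFi i).indicator (hsm i)).integrableOn
    have hone : ∀ i m, IntegrableOn ((T i m).indicator fun _ => (1 : ℝ)) I := fun i m =>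
      hbdd (b := 1) (measurable_const.indicator (hTm i m)) fun x => by
        by_cases hx : x ∈ T i m <;> simp [hx]
    have hconst : ∀ b : ℝ, IntegrableOn (fun _ => b) I := fun b => by simp [hIfin.lt_top]
    have hei : ∀ i m, IntegrableOn (e i m) I := fun i m =>
      ((hone i m).add (hconst _)).const_mul κ
    have hGi : IntegrableOn G I := integrable_finsetSum _ fun i _ => hind i
    have hRi : IntegrableOn R I :=
      integrable_finsetSum _ fun i _ => integrable_finsetSum _ fun m _ => hei i m
    have hGint : N * (c₁ / 2 - τ * V) ≤ ∫ x in I, G x := by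
      have h1 : ∀ i, c₁ / 2 - τ * V ≤ ∫ x in I, {x | s i x}.indicator (F i) x := by
        intro i
        have h2 : ∫ x in I, (max (F i x) 0 - τ) ≤ ∫ x in I, {x | s i x}.indicator (F i) x := by
          refine integral_mono (((hFi i).integrableOn.pos_part).sub (hconst τ)) (hind i) fun x => ?_
          have hθi := hθ i
          by_cases hx : x ∈ {x | s i x}
          · rw [Set.indicator_of_mem hx]
            have hx' : θ i < F i x := hx
            have : max (F i x) 0 = F i x := max_eq_left (by linarith [hθi.1])
            simp only [this]; linarith
          · rw [Set.indicator_of_notMem hx]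
            have hx' : ¬ θ i < F i x := hx
            have : max (F i x) 0 ≤ τ := max_le (by linarith [hθi.2]) hτ0.le
            simp only; linarith
        rw [integral_sub (hFi i).integrableOn.pos_part (hconst τ), setIntegral_const,
          smul_eq_mul] at h2
        have := hηint i
        linarith
      rw [integral_finsetSum _ fun i _ => hind i]
      calc N * (c₁ / 2 - τ * V) = ∑ i ∈ Finset.range N, (c₁ / 2 - τ * V) := by
            rw [Finset.sum_const, nsmul_eq_mul, Finset.card_range]
        _ ≤ _ := Finset.sum_le_sum fun i _ => h1 i
    have hRint : ∫ x in I, R x ≤ N * (c₁ / 8) := by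
      have h1 : ∀ i m, ∫ x in I, e i m x =
          κ * (volume.real {x ∈ I | |F i x - θ i| ≤ κ * q ^ (m + 1)} + q ^ (m + 1) * V) := by
        intro i m
        simp only [he]
        rw [integral_const_mul, integral_add (hone i m) (hconst _), setIntegral_const, smul_eq_mul,
          integral_indicator (hTm i m), Measure.restrict_restrict (hTm i m), setIntegral_const,
          smul_eq_mul, mul_one, mul_comm V, Set.inter_comm]
        rfl
      have h2 : ∀ i, ∑ m ∈ Finset.range N, ∫ x in I, e i m x ≤ c₁ / 8 := by
        intro i
        simp only [h1]
        rw [← Finset.mul_sum, Finset.sum_add_distrib, ← Finset.sum_mul]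
        have h3 := sum_geometric_succ_le hq0.le hq2 N
        have h4 : ∑ m ∈ Finset.range N, volume.real {x ∈ I | |F i x - θ i| ≤ κ * q ^ (m + 1)} ≤
            2 * V * (κ * (2 * q)) / τ := by
          refine (hθsum i).trans ?_
          rw [← Finset.mul_sum]
          gcongr
        calc _ ≤ κ * (2 * V * (κ * (2 * q)) / τ + 2 * q * V) := by gcongr
          _ = E * (2 * q) := by rw [hE]; ring
          _ ≤ _ := hqE
      rw [integral_finsetSum _ fun i _ => integrable_finsetSum _ fun m _ => hei i m]
      calc _ ≤ ∑ i ∈ Finset.range N, c₁ / 8 := by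
            refine Finset.sum_le_sum fun i _ => ?_
            rw [integral_finsetSum _ fun m _ => hei i m]
            exact h2 i
        _ = _ := by simp
    have hτV : τ * V = c₁ / 8 := by rw [hτ]; field_simp
    calc c₁ / 4 ≤ (∫ x in I, (G x - R x)) / N := by
          rw [le_div_iff₀ hNpos, integral_sub hGi hRi]
          rw [hτV] at hGint
          linarith
      _ = ∫ x in I, (G x - R x) / N := (integral_div _ _).symm
      _ ≤ ∫ x in I, H x := by
          have hi : IntegrableOn (fun x => (G x - R x) / N) I := (hGi.sub hRi).div_const _
          exact integral_mono hi hi.pos_part fun x => le_max_left _ _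
  · -- the partial sum selected at `x`
    have hxX : x ∈ X := hX hx
    obtain ⟨m, hm, hmeq⟩ := hlsub (ternaryKey N fun i => s i x)
    refine ⟨m, hm, ?_⟩
    rw [hmeq]
    set key : (Σ _ : ℕ, ℤ) → ℝ :=
      fun p => ternaryKey p.1 (fun i => s i (y p)) + (3 : ℝ)⁻¹ ^ (p.1 + 1) with hkey
    set S : ℝ := ∑ k ∈ Finset.range N, ∑ j ∈ positions x₀ ρ (lev k),
      if key ⟨k, j⟩ < ternaryKey N (fun i => s i x) then η k * ψ (lev k, j) x else 0 with hS
    have hsumS : ∑ p ∈ P.filter (fun p => key p < ternaryKey N fun i => s i x),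
        η p.1 / N * ψ (n + 2 * (M * p.1 : ℕ), p.2) x = S / N := by
      rw [Finset.sum_filter, hP, Finset.sum_sigma, hS, Finset.sum_div]
      refine Finset.sum_congr rfl fun k _ => ?_
      rw [Finset.sum_div]
      refine Finset.sum_congr rfl fun j _ => ?_
      simp only
      split_ifs
      · rw [div_mul_eq_mul_div]
      · rw [zero_div]
    have hlevel : ∀ k ∈ Finset.range N, |(∑ j ∈ positions x₀ ρ (lev k),
        if key ⟨k, j⟩ < ternaryKey N (fun i => s i x) then η k * ψ (lev k, j) x else 0) -
        {x | s k x}.indicator (F k) x| ≤ ∑ i ∈ Finset.range k, e i (k - i - 1) x := by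
      intro k hk
      have hkN := Finset.mem_range.1 hk
      set bad : ℕ → Finset ℤ := fun i =>
        (positions x₀ ρ (lev k)).filter fun j => ¬ (s i (y ⟨k, j⟩) ↔ s i x) with hbad
      have hind : {x | s k x}.indicator (F k) x = ∑ j ∈ positions x₀ ρ (lev k),
          if s k x then η k * ψ (lev k, j) x else 0 := by
        by_cases hx : s k x
        · rw [Set.indicator_of_mem (show x ∈ {x | s k x} from hx)]
          simp only [hx, if_true, hF, levelSum, Finset.mul_sum]
        · rw [Set.indicator_of_notMem (show x ∉ {x | s k x} from hx)]
          simp [hx]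
      rw [hind, ← Finset.sum_sub_distrib]
      have hterm : ∀ j ∈ positions x₀ ρ (lev k),
          |(if key ⟨k, j⟩ < ternaryKey N (fun i => s i x) then η k * ψ (lev k, j) x else 0) -
            (if s k x then η k * ψ (lev k, j) x else 0)| ≤
          ∑ i ∈ Finset.range k, if ¬ (s i (y ⟨k, j⟩) ↔ s i x) then |ψ (lev k, j) x| else 0 := by
        intro j _
        have hnn : ∀ i ∈ Finset.range k,
            0 ≤ if ¬ (s i (y ⟨k, j⟩) ↔ s i x) then |ψ (lev k, j) x| else 0 := by
          intro i _
          split_ifs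
          · exact le_rfl
          · exact abs_nonneg _
        by_cases hag : ∀ i < k, s i x ↔ s i (y ⟨k, j⟩)
        · have hiff : key ⟨k, j⟩ < ternaryKey N (fun i => s i x) ↔ s k x :=
            ternaryKey_lt_iff hkN hag
          simp only [hiff, sub_self, abs_zero]
          exact Finset.sum_nonneg hnn
        · push Not at hag
          obtain ⟨i, hik, hi⟩ := hag
          have hi' : ¬ (s i (y ⟨k, j⟩) ↔ s i x) := by tauto
          have hle := Finset.single_le_sum hnn (Finset.mem_range.2 hik)
          rw [if_pos hi'] at hle
          refine le_trans ?_ hle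
          have habs : |η k * ψ (lev k, j) x| = |ψ (lev k, j) x| := by
            rw [abs_mul, hη, one_mul]
          split_ifs <;> simp [habs]
      calc _ ≤ ∑ j ∈ positions x₀ ρ (lev k), ∑ i ∈ Finset.range k,
            (if ¬ (s i (y ⟨k, j⟩) ↔ s i x) then |ψ (lev k, j) x| else 0) :=
            (Finset.abs_sum_le_sum_abs _ _).trans (Finset.sum_le_sum hterm)
        _ = ∑ i ∈ Finset.range k, ∑ j ∈ bad i, |ψ (lev k, j) x| := by
            rw [Finset.sum_comm]
            refine Finset.sum_congr rfl fun i _ => ?_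
            rw [hbad, Finset.sum_filter]
        _ ≤ _ := by
            refine Finset.sum_le_sum fun i hi => ?_
            have hik := Finset.mem_range.1 hi
            have hlevk : lev i + 2 * ((M * (k - i) : ℕ) : ℤ) = lev k := by
              simp only [hlev]
              have : M * k = M * i + M * (k - i) := by rw [← Nat.mul_add]; congr 1; omega
              rw [this]; push_cast; ring
            have := h.sum_abs_separated_le hα hβ hK hK' (min_le_left _ _) (min_le_right _ _)
              x₀ ρ (lev i) (M * (k - i)) (hη i) (θ i) (bad i) (x := x) ?_ hxX ?_
            · rw [hlevk, ← hγ, pow_mul, ← hq, show k - i = k - i - 1 + 1 by omega] at this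
              exact this
            · intro j hj
              rw [hlevk]
              have := mem_positions.1 (Finset.mem_filter.1 hj).1
              exact hX ⟨by linarith, by linarith⟩
            · intro j hj
              rw [hlevk]
              exact (Finset.mem_filter.1 hj).2
    have hSG : |S - G x| ≤ R x := by
      rw [hS, hG, ← Finset.sum_sub_distrib]
      calc _ ≤ ∑ k ∈ Finset.range N, ∑ i ∈ Finset.range k, e i (k - i - 1) x :=
            (Finset.abs_sum_le_sum_abs _ _).trans (Finset.sum_le_sum hlevel)
        _ ≤ _ := sum_sum_sub_le (fun i m => he0 i m x) N
    rw [hsumS]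
    refine max_le ?_ (abs_nonneg _)
    rw [abs_div, abs_of_pos hNpos]
    gcongr
    have h1 := abs_le.1 hSG
    exact le_trans (by linarith [h1.1]) (le_abs_self S)

end IsAtomSystem

/-! ### Concatenation of the blocks -/

lemma sum_range_getD {ι : Type*} [DecidableEq ι] {l : List ι} (hl : l.Nodup) (d : ι) (g : ι → ℝ)
    {r : ℕ} (hr : r ≤ l.length) :
    ∑ i ∈ Finset.range r, g (l.getD i d) = ∑ p ∈ (l.take r).toFinset, g p := by
  rw [List.sum_toFinset g (hl.sublist (List.take_sublist r l))]
  induction r with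
  | zero => simp
  | succ r ih =>
    have hr' : r < l.length := hr
    rw [Finset.sum_range_succ, ih hr'.le, List.take_add_one, List.getElem?_eq_getElem hr',
      List.getD_eq_getElem _ _ hr']
    simp only [Option.toList_some, List.map_append, List.sum_append, List.map_cons, List.map_nil,
      List.sum_singleton]

/-- Every natural number lies in exactly one of the consecutive blocks `[T m, T (m + 1))`. -/
lemma exists_block_index {T : ℕ → ℕ} (hT0 : T 0 = 0) (hT : StrictMono T) :
    ∃ blk : ℕ → ℕ, (∀ k, T (blk k) ≤ k ∧ k < T (blk k + 1)) ∧
      ∀ m k, T m ≤ k → k < T (m + 1) → blk k = m := by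
  have hex : ∀ k, ∃ m, T m ≤ k ∧ k < T (m + 1) := by
    intro k
    have h : ∃ m, k < T (m + 1) := ⟨k, (Nat.lt_succ_self k).trans_le (hT.id_le (k + 1))⟩
    classical
    refine ⟨Nat.find h, ?_, Nat.find_spec h⟩
    rcases Nat.eq_zero_or_pos (Nat.find h) with h0 | h0
    · rw [h0, hT0]; exact Nat.zero_le k
    · have := Nat.find_min h (m := Nat.find h - 1) (by omega)
      rwa [show Nat.find h - 1 + 1 = Nat.find h by omega, not_lt] at this
  choose blk hblk using hex
  refine ⟨blk, hblk, fun m k h1 h2 => ?_⟩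
  have h3 := hT.lt_iff_lt.1 ((hblk k).1.trans_lt h2)
  have h4 := hT.lt_iff_lt.1 (h1.trans_lt (hblk k).2)
  omega

section

variable {A B : EReal} {c α β : ℝ} {φ : waveletIndex A B → ℝ → ℝ}

lemma integral_levelSum_sq {x₀ ρ : ℝ} (hφo : IsOrthonormalSystem φ) {n : ℤ}
    (hmem : ∀ j ∈ positions x₀ ρ n, (n, j) ∈ waveletIndex A B) :
    ∫ t, levelSum (normalizedAtom φ) x₀ ρ n t ^ 2 =
      (2 : ℝ) ^ (-n) * (positions x₀ ρ n).card := by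
  have horth := hφo.comp_injective
    (σ := fun j : positions x₀ ρ n => (⟨(n, j.1), hmem j.1 j.2⟩ : waveletIndex A B))
    fun i j hij => Subtype.ext (congrArg (fun p : waveletIndex A B => p.1.2) hij)
  have h := horth.integral_sum_sq (positions x₀ ρ n).attach fun _ => (2 : ℝ) ^ (-((n : ℝ) / 2))
  have hsq : ((2 : ℝ) ^ (-((n : ℝ) / 2))) ^ 2 = (2 : ℝ) ^ (-n) := by
    rw [← Real.rpow_natCast, ← Real.rpow_mul (by norm_num), ← Real.rpow_intCast]
    congr 1; push_cast; ring
  rw [Finset.sum_const, Finset.card_attach, nsmul_eq_mul, hsq, mul_comm] at h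
  rw [← h]
  congr 1
  ext t
  congr 1
  rw [levelSum, ← Finset.sum_attach]
  exact Finset.sum_congr rfl fun j _ => by rw [normalizedAtom_of_mem (hmem j.1 j.2)]

/-- No weights that grow more slowly than the logarithm suffice for all rearrangements. -/
theorem not_isRCMultiplier_of_isLittleO (hAB : A < B) (hα : 0 < α) (hβ : 0 < β)
    (hφ : IsWaveletType A B c α β φ) (hφo : IsOrthonormalSystem φ) {w : ℕ → ℝ}
    (hw0 : ∀ n, 1 ≤ n → 0 < w n) (hwmono : ∀ m n, 1 ≤ m → m ≤ n → w m ≤ w n)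
    (hwo : Asymptotics.IsLittleO atTop w (fun n : ℕ => Real.log n)) : ¬ IsRCMultiplier w φ := by
  classical
  intro hRC
  have hat := hφ.isAtomSystem hα
  set ψ := normalizedAtom φ with hψ
  -- an interval inside `(A, B)`
  obtain ⟨a₁, ha₁, ha₁B⟩ := EReal.lt_iff_exists_real_btwn.1 hAB
  obtain ⟨b₁, hab, hb₁⟩ := EReal.lt_iff_exists_real_btwn.1 ha₁B
  rw [EReal.coe_lt_coe_iff] at hab
  set ρ : ℝ := (b₁ - a₁) / 4 with hρdef
  set x₀ : ℝ := (a₁ + b₁) / 2 with hx₀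
  have hρ : 0 < ρ := by rw [hρdef]; linarith
  have hIab : Set.Icc (x₀ - 2 * ρ) (x₀ + 2 * ρ) = Set.Icc a₁ b₁ := by
    rw [hx₀, hρdef]; congr 1 <;> ring
  have hX : Set.Icc (x₀ - 2 * ρ) (x₀ + 2 * ρ) ⊆ closedInterval A B := by
    rw [hIab]
    exact fun t ht => ⟨ha₁.le.trans (EReal.coe_le_coe_iff.2 ht.1),
      (EReal.coe_le_coe_iff.2 ht.2).trans hb₁.le⟩
  have hmem : ∀ n : ℤ, (2 : ℝ) ^ (-n) ≤ ρ → ∀ j ∈ positions x₀ ρ n,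
      (n, j) ∈ waveletIndex A B := by
    intro n hn j hj
    have hj' := mem_positions.1 hj
    refine ⟨?_, ?_, ?_⟩
    · refine le_trans ?_ (EReal.sub_le_sub hb₁.le ha₁.le)
      rw [← EReal.coe_sub]
      exact EReal.coe_le_coe_iff.2 (by simp only; linarith)
    · exact ha₁.trans (EReal.coe_lt_coe_iff.2 (by simp only; linarith))
    · exact (EReal.coe_le_coe_iff.2 (by simp only; linarith)).trans hb₁.le
  obtain ⟨m₀, hm₀⟩ := exists_pow_lt_of_lt_one hρ (by norm_num : (1 / 2 : ℝ) < 1)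
  have hm₀' : (2 : ℝ) ^ (-(m₀ : ℤ)) ≤ ρ := by
    rw [zpow_neg, zpow_natCast, ← one_div, ← one_div_pow]; exact hm₀.le
  obtain ⟨M, n₁, c₁, C, hM, hn₁ρ, hc₁, hblock⟩ := hat.exists_block hα hβ hρ hX (n₀ := m₀)
    fun n hn => integral_levelSum_sq hφo
      (hmem n ((zpow_le_zpow_right₀ (by norm_num) (by omega)).trans hm₀'))
  have hlevρ : ∀ n : ℤ, n₁ ≤ n → (2 : ℝ) ^ (-n) ≤ ρ := fun n hn =>
    (zpow_le_zpow_right₀ (by norm_num) (by omega)).trans hn₁ρ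
  set I : Set ℝ := Set.Icc (x₀ - 2 * ρ) (x₀ + 2 * ρ) with hI
  -- the block number `e` has `2 ^ e` levels, the first of which is `n₁ + 2 M 2 ^ e`; so different
  -- blocks have no level in common
  set st : ℕ → ℤ := fun e => n₁ + 2 * (M * 2 ^ e : ℕ) with hst
  have hb := fun e : ℕ => hblock (st e) (by simp only [hst]; omega) (2 ^ e) (by positivity)
  choose η l H hη hl hlP hHm hH0 hHC hHint hHle using hb
  set lev : ℕ → ℕ → ℤ := fun e i => st e + 2 * (M * i : ℕ) with hlev
  have hlevn₁ : ∀ e i, n₁ ≤ lev e i := fun e i => by simp only [hlev, hst]; omega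
  have hlen_eq : ∀ e, (l e).length =
      ∑ i ∈ Finset.range (2 ^ e), (positions x₀ ρ (lev e i)).card := fun e => by
    rw [← List.toFinset_card_of_nodup (hl e), hlP, Finset.card_sigma]
  have hlen_pos : ∀ e, 0 < (l e).length := by
    intro e
    rw [hlen_eq]
    refine Finset.sum_pos (fun i _ => ?_) ⟨0, Finset.mem_range.2 (by positivity)⟩
    have h1 := (card_positions (x₀ := x₀) (hlevρ _ (hlevn₁ e i))).1
    by_contra h0
    rw [Nat.eq_zero_of_not_pos h0] at h1
    simp only [Nat.cast_zero, mul_zero] at h1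
    linarith
  -- the number of atoms in a block
  obtain ⟨D, hD⟩ : ∃ D : ℕ, ∀ e, (l e).length ≤ 2 ^ (D * 2 ^ e) := by
    obtain ⟨D₀, hD₀⟩ := pow_unbounded_of_one_lt (3 * ρ * (2 : ℝ) ^ n₁) (by norm_num : (1 : ℝ) < 2)
    refine ⟨D₀ + 1 + 4 * M, fun e => ?_⟩
    have hi : ∀ i ∈ Finset.range (2 ^ e), ((positions x₀ ρ (lev e i)).card : ℝ) ≤
        2 ^ (D₀ + 4 * M * 2 ^ e) := by
      intro i hi
      have hi' := Finset.mem_range.1 hi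
      have h1 := (card_positions (x₀ := x₀) (hlevρ _ (hlevn₁ e i))).2
      have h2 : (2 : ℝ) ^ (lev e i) * (2 : ℝ) ^ (-(lev e i)) = 1 := by
        rw [← zpow_add₀ (by norm_num)]; simp
      have h3 : (2 : ℝ) ^ (lev e i) ≤ (2 : ℝ) ^ n₁ * 2 ^ (4 * M * 2 ^ e) := by
        rw [← zpow_natCast, ← zpow_add₀ (by norm_num)]
        refine zpow_le_zpow_right₀ (by norm_num) ?_
        simp only [hlev, hst]
        have h4 : M * i ≤ M * 2 ^ e := Nat.mul_le_mul_left _ hi'.le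
        have h5 : 4 * M * 2 ^ e = 4 * (M * 2 ^ e) := by ring
        rw [h5]
        omega
      calc ((positions x₀ ρ (lev e i)).card : ℝ)
          = (2 : ℝ) ^ (lev e i) * ((2 : ℝ) ^ (-(lev e i)) * (positions x₀ ρ (lev e i)).card) := by
            rw [← mul_assoc, h2, one_mul]
        _ ≤ ((2 : ℝ) ^ n₁ * 2 ^ (4 * M * 2 ^ e)) * (3 * ρ) := by gcongr
        _ = (3 * ρ * (2 : ℝ) ^ n₁) * 2 ^ (4 * M * 2 ^ e) := by ring
        _ ≤ 2 ^ D₀ * 2 ^ (4 * M * 2 ^ e) := by gcongr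
        _ = _ := by rw [pow_add]
    have hsum : ((l e).length : ℝ) ≤ 2 ^ e * 2 ^ (D₀ + 4 * M * 2 ^ e) := by
      rw [hlen_eq]
      push_cast
      refine (Finset.sum_le_sum hi).trans_eq ?_
      simp
    have hsum' : (l e).length ≤ 2 ^ e * 2 ^ (D₀ + 4 * M * 2 ^ e) := by exact_mod_cast hsum
    refine hsum'.trans ?_
    rw [← pow_add]
    refine Nat.pow_le_pow_right (by norm_num) ?_
    have h6 : e ≤ 2 ^ e := Nat.lt_two_pow_self.le
    have h7 : D₀ ≤ D₀ * 2 ^ e := Nat.le_mul_of_pos_right _ (by positivity)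
    calc e + (D₀ + 4 * M * 2 ^ e) ≤ 2 ^ e + (D₀ * 2 ^ e + 4 * M * 2 ^ e) := by omega
      _ = _ := by ring
  set U : ℕ → ℕ := fun e => 2 ^ ((D + 1) * 2 ^ e) with hU
  -- the weights are small compared with the size of the blocks
  have hUtop : Tendsto U atTop atTop := by
    refine tendsto_atTop_mono (fun e => ?_) tendsto_id
    calc e ≤ 2 ^ e := Nat.lt_two_pow_self.le
      _ ≤ (D + 1) * 2 ^ e := Nat.le_mul_of_pos_left _ (by omega)
      _ ≤ _ := Nat.lt_two_pow_self.le
  have hwU : ∀ m : ℕ, ∀ᶠ e in atTop, w (U e) * (3 * ρ / 2 ^ e) ≤ (1 / 2 : ℝ) ^ m := by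
    intro m
    set ε : ℝ := (1 / 2 : ℝ) ^ m / (3 * ρ * (D + 1)) with hε
    have hε0 : 0 < ε := by positivity
    filter_upwards [hUtop.eventually (hwo.def hε0)] with e he
    have h1 : w (U e) ≤ ε * Real.log (U e) := by
      refine (le_abs_self _).trans (he.trans_eq ?_)
      rw [Real.norm_eq_abs, abs_of_nonneg (Real.log_natCast_nonneg _)]
    have h2 : Real.log (U e) ≤ (D + 1) * 2 ^ e := by
      simp only [hU]
      push_cast
      rw [Real.log_pow]
      have h3 : Real.log 2 ≤ 1 := by
        have := Real.log_le_sub_one_of_pos (by norm_num : (0 : ℝ) < 2); linarith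
      push_cast
      calc ((D : ℝ) + 1) * 2 ^ e * Real.log 2 ≤ ((D : ℝ) + 1) * 2 ^ e * 1 := by gcongr
        _ = _ := mul_one _
    calc w (U e) * (3 * ρ / 2 ^ e) ≤ (ε * ((D + 1) * 2 ^ e)) * (3 * ρ / 2 ^ e) := by
          gcongr
          exact h1.trans (by gcongr)
      _ = (1 / 2 : ℝ) ^ m := by rw [hε]; field_simp
  obtain ⟨E, hEmono, hE⟩ := extraction_forall_of_eventually hwU
  -- the concatenation
  set len : ℕ → ℕ := fun m => (l (E m)).length with hlen
  set T : ℕ → ℕ := fun m => ∑ i ∈ Finset.range m, len i with hT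
  have hTsucc : ∀ m, T (m + 1) = T m + len m := fun m => Finset.sum_range_succ _ _
  have hTmono : StrictMono T := strictMono_nat_of_lt_succ fun m => by
    have := hlen_pos (E m)
    rw [hTsucc]; simp only [hlen]; omega
  have hT0 : T 0 = 0 := by simp [hT]
  have hTU : ∀ m, T (m + 1) ≤ U (E m) := by
    intro m
    have h1 : ∀ i ∈ Finset.range (m + 1), len i ≤ 2 ^ (D * 2 ^ (E m)) := by
      intro i hi
      refine (hD (E i)).trans (Nat.pow_le_pow_right (by norm_num) ?_)
      refine Nat.mul_le_mul_left _ (Nat.pow_le_pow_right (by norm_num) ?_)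
      exact hEmono.monotone (by have := Finset.mem_range.1 hi; omega)
    have h2 : m + 1 ≤ 2 ^ 2 ^ (E m) := by
      have h3 : m ≤ E m := hEmono.id_le m
      have h4 : E m < 2 ^ (E m) := Nat.lt_two_pow_self
      have h5 : 2 ^ (E m) < 2 ^ 2 ^ (E m) := Nat.lt_two_pow_self
      omega
    calc T (m + 1) ≤ ∑ _i ∈ Finset.range (m + 1), 2 ^ (D * 2 ^ (E m)) := Finset.sum_le_sum h1
      _ = (m + 1) * 2 ^ (D * 2 ^ (E m)) := by simp
      _ ≤ 2 ^ 2 ^ (E m) * 2 ^ (D * 2 ^ (E m)) := Nat.mul_le_mul_right _ h2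
      _ = _ := by simp only [hU]; rw [← pow_add]; congr 1; ring
  obtain ⟨blk, hblk, hblk_eq⟩ := exists_block_index hT0 hTmono
  set pt : ℕ → (Σ _ : ℕ, ℤ) :=
    fun k => (l (E (blk k))).getD (k - T (blk k)) ⟨0, 0⟩ with hpt
  have hoff : ∀ k, k - T (blk k) < (l (E (blk k))).length := by
    intro k
    have h1 := hblk k
    rw [hTsucc] at h1
    simp only [hlen] at h1
    omega
  have hpt_mem : ∀ k, (pt k).1 < 2 ^ E (blk k) ∧
      (pt k).2 ∈ positions x₀ ρ (lev (E (blk k)) (pt k).1) := by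
    intro k
    have h1 : pt k ∈ (l (E (blk k))).toFinset := by
      rw [List.mem_toFinset, hpt]
      simp only
      rw [List.getD_eq_getElem _ _ (hoff k)]
      exact List.getElem_mem _
    rw [hlP, Finset.mem_sigma, Finset.mem_range] at h1
    exact h1
  set σ : ℕ → waveletIndex A B := fun k => ⟨(lev (E (blk k)) (pt k).1, (pt k).2),
    hmem _ (hlevρ _ (hlevn₁ _ _)) _ (hpt_mem k).2⟩ with hσdef
  have hσ : Function.Injective σ := by
    intro k k' hkk
    have h1 : lev (E (blk k)) (pt k).1 = lev (E (blk k')) (pt k').1 :=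
      congrArg (fun p : waveletIndex A B => p.1.1) hkk
    have h2 : (pt k).2 = (pt k').2 := congrArg (fun p : waveletIndex A B => p.1.2) hkk
    have h3 : 2 ^ E (blk k) + (pt k).1 = 2 ^ E (blk k') + (pt k').1 := by
      simp only [hlev, hst] at h1
      have h4 : M * 2 ^ E (blk k) + M * (pt k).1 = M * 2 ^ E (blk k') + M * (pt k').1 := by omega
      rw [← Nat.mul_add, ← Nat.mul_add] at h4
      exact Nat.eq_of_mul_eq_mul_left hM h4
    have hlt : ∀ {k k' : ℕ}, 2 ^ E (blk k) + (pt k).1 = 2 ^ E (blk k') + (pt k').1 →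
        blk k < blk k' → False := by
      intro k k' h3 h5
      have h6 : 2 ^ (E (blk k) + 1) ≤ 2 ^ E (blk k') :=
        Nat.pow_le_pow_right (by norm_num) (hEmono h5)
      have h7 := (hpt_mem k).1
      rw [pow_succ] at h6
      omega
    have hbb : blk k = blk k' := by
      rcases lt_trichotomy (blk k) (blk k') with h5 | h5 | h5
      · exact (hlt h3 h5).elim
      · exact h5
      · exact (hlt h3.symm h5).elim
    have h8 : pt k = pt k' := by
      refine Sigma.ext ?_ (heq_of_eq h2)
      rw [hbb] at h3; omega
    have h9 := hoff k
    have h10 := hoff k'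
    simp only [hpt] at h8
    rw [List.getD_eq_getElem _ _ h9, List.getD_eq_getElem _ _ h10] at h8
    have h11 := hblk k
    have h12 := hblk k'
    rw [hbb] at h11
    have h13 : k - T (blk k') = k' - T (blk k') := by
      have h14 : (l (E (blk k')))[k - T (blk k')]'(hbb ▸ h9) = (l (E (blk k')))[k' - T (blk k')] := by
        rw [← h8]; simp only [hbb]
      exact (hl _).getElem_inj_iff.1 h14
    omega
  set a : ℕ → ℝ := fun k => η (E (blk k)) (pt k).1 / (2 ^ E (blk k) : ℕ) *
    (2 : ℝ) ^ (-((lev (E (blk k)) (pt k).1 : ℝ) / 2)) with ha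
  -- one block of the series
  have hblk_add : ∀ m i, i < len m → blk (T m + i) = m := fun m i hi =>
    hblk_eq m _ (Nat.le_add_right _ _) (by rw [hTsucc]; omega)
  have hpt_add : ∀ m i, i < len m → pt (T m + i) = (l (E m)).getD i ⟨0, 0⟩ := by
    intro m i hi
    simp only [hpt, hblk_add m i hi, Nat.add_sub_cancel_left]
  have hsum_block : ∀ m r x, r ≤ len m →
      ∑ k ∈ Finset.Ico (T m) (T m + r), a k * φ (σ k) x =
      ∑ p ∈ ((l (E m)).take r).toFinset, η (E m) p.1 / (2 ^ E m : ℕ) *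
        ψ (st (E m) + 2 * (M * p.1 : ℕ), p.2) x := by
    intro m r x hr
    rw [Finset.sum_Ico_eq_sum_range, Nat.add_sub_cancel_left,
      ← sum_range_getD (hl (E m)) ⟨0, 0⟩ (fun p => η (E m) p.1 / (2 ^ E m : ℕ) *
        ψ (st (E m) + 2 * (M * p.1 : ℕ), p.2) x) hr]
    refine Finset.sum_congr rfl fun i hi => ?_
    have hi' : i < len m := (Finset.mem_range.1 hi).trans_le hr
    have h1 : ψ (lev (E (blk (T m + i))) (pt (T m + i)).1, (pt (T m + i)).2) x =
        (2 : ℝ) ^ (-((lev (E (blk (T m + i))) (pt (T m + i)).1 : ℝ) / 2)) *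
          φ (σ (T m + i)) x := by
      rw [hψ, normalizedAtom_of_mem (σ (T m + i)).2]
    simp only [ha]
    rw [mul_assoc, ← h1, hblk_add m i hi', hpt_add m i hi']
  have hsq_block : ∀ m, ∑ k ∈ Finset.Ico (T m) (T (m + 1)), a k ^ 2 * w (k + 1) ≤
      (1 / 2 : ℝ) ^ m := by
    intro m
    have h1 : ∑ k ∈ Finset.Ico (T m) (T (m + 1)), a k ^ 2 ≤ 3 * ρ / 2 ^ E m := by
      have h2 : ∑ k ∈ Finset.Ico (T m) (T (m + 1)), a k ^ 2 =
          ∑ p ∈ (l (E m)).toFinset, (1 / 2 ^ E m) ^ 2 * (2 : ℝ) ^ (-(lev (E m) p.1)) := by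
        have h3 := sum_range_getD (hl (E m)) ⟨0, 0⟩
          (fun p : (Σ _ : ℕ, ℤ) => (1 / 2 ^ E m) ^ 2 * (2 : ℝ) ^ (-(lev (E m) p.1))) le_rfl
        rw [List.take_length] at h3
        rw [← h3, hTsucc, Finset.sum_Ico_eq_sum_range, Nat.add_sub_cancel_left]
        refine Finset.sum_congr rfl fun i hi => ?_
        have hi' : i < len m := Finset.mem_range.1 hi
        simp only [ha]
        rw [hblk_add m i hi', hpt_add m i hi', mul_pow, ← sq_abs (η _ _ / _), abs_div, hη,
          ← Real.rpow_natCast ((2 : ℝ) ^ _), ← Real.rpow_mul (by norm_num),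
          ← Real.rpow_intCast]
        congr 1
        · simp
        · congr 1; push_cast; ring
      rw [h2, hlP, Finset.sum_sigma]
      calc _ ≤ ∑ i ∈ Finset.range (2 ^ E m), (1 / 2 ^ E m : ℝ) ^ 2 * (3 * ρ) := by
            refine Finset.sum_le_sum fun i _ => ?_
            change ∑ _s ∈ positions x₀ ρ (lev (E m) i),
              (1 / 2 ^ E m : ℝ) ^ 2 * (2 : ℝ) ^ (-(lev (E m) i)) ≤ _
            rw [Finset.sum_const, nsmul_eq_mul, mul_left_comm, mul_comm ((positions _ _ _).card : ℝ)]
            exact mul_le_mul_of_nonneg_left (card_positions (hlevρ _ (hlevn₁ _ _))).2 (by positivity)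
        _ = 3 * ρ / 2 ^ E m := by
            rw [Finset.sum_const, nsmul_eq_mul, Finset.card_range]
            push_cast
            field_simp
    have hwT : ∀ k ∈ Finset.Ico (T m) (T (m + 1)), w (k + 1) ≤ w (U (E m)) := fun k hk =>
      hwmono _ _ (by omega) (le_trans (by have := (Finset.mem_Ico.1 hk).2; omega) (hTU m))
    have hwU0 : 0 ≤ w (U (E m)) := (hw0 _ (Nat.one_le_two_pow)).le
    calc ∑ k ∈ Finset.Ico (T m) (T (m + 1)), a k ^ 2 * w (k + 1)
        ≤ ∑ k ∈ Finset.Ico (T m) (T (m + 1)), a k ^ 2 * w (U (E m)) :=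
          Finset.sum_le_sum fun k hk => mul_le_mul_of_nonneg_left (hwT k hk) (sq_nonneg _)
      _ = w (U (E m)) * ∑ k ∈ Finset.Ico (T m) (T (m + 1)), a k ^ 2 := by
          rw [← Finset.sum_mul, mul_comm]
      _ ≤ w (U (E m)) * (3 * ρ / 2 ^ E m) := by gcongr
      _ ≤ _ := hE m
  have hnn : ∀ k, 0 ≤ a k ^ 2 * w (k + 1) := fun k =>
    mul_nonneg (sq_nonneg _) (hw0 _ (by omega)).le
  have hsummable : Summable fun k => a k ^ 2 * w (k + 1) := by
    refine summable_of_sum_range_le (c := 2) hnn fun r => ?_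
    calc ∑ k ∈ Finset.range r, a k ^ 2 * w (k + 1)
        ≤ ∑ k ∈ Finset.Ico (T 0) (T r), a k ^ 2 * w (k + 1) := by
          refine Finset.sum_le_sum_of_subset_of_nonneg (fun k hk => ?_) fun k _ _ => hnn k
          have h1 : r ≤ T r := hTmono.id_le r
          have := Finset.mem_range.1 hk
          exact Finset.mem_Ico.2 ⟨by omega, by omega⟩
      _ = ∑ m ∈ Finset.range r, ∑ k ∈ Finset.Ico (T m) (T (m + 1)), a k ^ 2 * w (k + 1) :=
          (sum_Ico_blocks hTmono.monotone _ r).symm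
      _ ≤ ∑ m ∈ Finset.range r, (1 / 2 : ℝ) ^ m := Finset.sum_le_sum fun m _ => hsq_block m
      _ ≤ ∑' m : ℕ, (1 / 2 : ℝ) ^ m :=
          summable_geometric_two.sum_le_tsum _ fun m _ => by positivity
      _ = 2 := tsum_geometric_two
  -- convergence forces the minorants of the block fluctuations to vanish in the mean
  have hconv := hRC σ hσ a hsummable
  have hH_tendsto : ∀ᵐ x ∂(volume.restrict I), Tendsto (fun m => H (E m) x) atTop (𝓝 0) := by
    rw [ae_restrict_iff' measurableSet_Icc]
    filter_upwards [hconv] with x ⟨s, hs⟩ hxI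
    rw [Metric.tendsto_atTop]
    intro ε hε
    obtain ⟨N, hN⟩ := Metric.cauchySeq_iff.1 hs.cauchySeq ε hε
    refine ⟨N, fun m hm => ?_⟩
    obtain ⟨r, hr, hle⟩ := hHle (E m) x hxI
    have hTm : N ≤ T m := hm.trans (hTmono.id_le m)
    have h1 := hN (T m + r) (by omega) (T m) hTm
    rw [Real.dist_eq, ← Finset.sum_Ico_eq_sub _ (Nat.le_add_right _ _), hsum_block m r x hr] at h1
    rw [Real.dist_eq, sub_zero, abs_of_nonneg (hH0 _ _)]
    exact hle.trans_lt h1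
  have hint : Tendsto (fun m => ∫ x in I, H (E m) x) atTop (𝓝 (∫ _x in I, (0 : ℝ))) := by
    refine tendsto_integral_of_dominated_convergence (fun _ => C)
      (fun m => (hHm (E m)).aestronglyMeasurable) (by simp [hI]) (fun m => ?_)
      hH_tendsto
    refine ae_of_all _ fun x => ?_
    rw [Real.norm_eq_abs, abs_of_nonneg (hH0 _ _)]
    exact hHC _ _
  rw [integral_zero] at hint
  have := ge_of_tendsto' hint fun m => hHint (E m)
  linarith

end

theorem corollary2 (A B : EReal) (hAB : A < B) (c α β : ℝ)
    (hα : 0 < α) (hα1 : α ≤ 1) (hβ : 0 < β) (hβ1 : β ≤ 1)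
    (φ : waveletIndex A B → ℝ → ℝ)
    (hφ : IsWaveletType A B c α β φ) (hφo : IsOrthonormalSystem φ) :
    IsRCMultiplier (fun n : ℕ => Real.log n) φ ∧
    ∀ w : ℕ → ℝ, (∀ n, 1 ≤ n → 0 < w n) → (∀ m n, 1 ≤ m → m ≤ n → w m ≤ w n) →
      Asymptotics.IsLittleO atTop w (fun n : ℕ => Real.log n) →
      ¬ IsRCMultiplier w φ :=
  ⟨isRCMultiplier_log hα hβ hβ1 hφ hφo, fun _ hw0 hwmono hwo =>
    not_isRCMultiplier_of_isLittleO hAB hα hβ hφ hφo hw0 hwmono hwo⟩
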